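/- Fix $\lambda>0$ and $0<m<2\pi/\lambda$. Let $t_a=\sigma_a/2$, write $u=P_0+\tfrac{i\lambda}{2}\vec P\cdot\vec\sigma\in SU_2$ (so $P_0^2+\tfrac{\lambda^2}{4}\vec P^2=1$), $u=e^{i\lambda\vec p\cdot\vec t}$ with Lie coordinates $|\vec p|<2\pi/\lambda$ (for $u\neq-1$), and let $S^3_{NS}=SU_2\setminus\{1,-1\}$. It is the disjoint union, over $0<m<2\pi/\lambda$, of the conjugacy classes $C_m=\{ve^{im\lambda t_3}v^{-1}\}=\{|\vec p|=m\}=\{P_0=\cos(m\lambda/2)\}$. Let $s\in\frac12\mathbb N_0$, let $\rho^s$ be the spin-$s$ representation of $SU_2$ with lowest weight vector $|s,-s\rangle$, and put $M=\frac{\sin(m\lambda/2)}{\lambda/2}$. Let $D(SU_2)$ be $C(SU_2\times SU_2)$ with the product $(F_1\bullet F_2)(g,u)=\int F_1(z,(z^{-1}g)u(z^{-1}g)^{-1})F_2(z^{-1}g,u)\,dz$ and involution $F^*(g,u)=\overline{F(g^{-1},gug^{-1})}$; its singular elements multiply by $(\delta_{g_1}\otimes f_1)\bullet(\delta_{g_2}\otimes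 f_2)=\delta_{g_1g_2}\otimes f_1(g_2(\cdot)g_2^{-1})f_2$. Call $(m,s)$ generic if $km\lambda\notin2\pi\mathbb Z$ for $1\le k\le2s$ (no condition for $s=0,\frac12$; $m\ne\pi/\lambda$ for $s=1$). Let $H_m=\{u: P_0(u)\cos(m\lambda/2)\ge0\}$ be the closed hemisphere containing $C_m$ (all of $SU_2$ if $m=\pi/\lambda$). **(1) Irreps.** Let $V_{ms}=\{\psi:SU_2\to\mathbb C\mid\psi(ve^{i\alpha t_3})=e^{is\alpha}\psi(v)\}$ with $\Pi_{ms}(\delta_g\otimes f)\psi(v)=f(g^{-1}ve^{im\lambda t_3}v^{-1}g)\psi(g^{-1}v)$, and $$W_{ms}=\{\tilde\phi:S^3_{NS}\to\mathbb C^{2s+1}\mid\rho^s(u)\tilde\phi(u)=e^{-im\lambda s}\tilde\phi(u)\}$$ with $\Pi_{ms}(\delta_g\otimes f)\tilde\phi(u)=f(g^{-1}ug)\rho^s(g)\tilde\phi(g^{-1}ug)$. These formulas are compatible with the product of singular elements, and they preserve $V_{ms}$, $W_{ms}$ and the subspace of $W_{ms}$ of fields supported on $C_m$. For generic $(m,s)$,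 $\tilde\phi(ve^{im\lambda t_3}v^{-1})=\psi(v)\rho^s(v)|s,-s\rangle$ is a linear isomorphism of $V_{ms}$ onto that subspace and intertwines the actions. On the Hilbert space of square-integrable elements of $V_{ms}$, $\Pi_{ms}(F)\psi(v)=\int F(g,g^{-1}ve^{im\lambda t_3}v^{-1}g)\psi(g^{-1}v)\,dg$ defines an irreducible $*$-representation of $D(SU_2)$. For generic $(m,s)$ so does $\Pi_{ms}(F)\tilde\phi(u)=\int F(g,g^{-1}ug)\rho^s(g)\tilde\phi(g^{-1}ug)\,dg$ on the fields of $W_{ms}$ supported on and square-integrable over $C_m$ (with the conjugation-invariant probability measure), and the above isomorphism is a unitary equivalence of the two. **(2) Support.** For $s=0$ the constraint is empty. For $s=\frac12$ every element of $W_{ms}$ is supported on $C_m$. For $s=1$ every element of $W_{ms}$ is supported on $C_m\cup C_{2\pi/\lambda-m}$, and on $C_m$ if it vanishes outside the hemisphere $H_m$. **(3) Momentum space.** At each point $u\in S^3_{NS}$: (spin 0) $P_0\tilde\phi=\cos(m\lambda/2)\tilde\phi$ implies $(\vec P^2-M^2)\tilde\phi=0$; (spin $\frac12$) the constraint implies $(\vec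 P\cdot\vec\sigma+M)\tilde\phi=0$; (spin 1, Cartesian components, in which $\rho^1(u)$ is $\tilde\phi\cdot\vec\sigma\mapsto u(\tilde\phi\cdot\vec\sigma)u^{-1}$) the constraint implies $\vec P\cdot\tilde\phi=0$ and $(\vec P^2-M^2)\tilde\phi=0$. On $H_m$ the converses hold for spins $0$ and $\frac12$, and for spin 1 with $m\ne\pi/\lambda$ the constraint is equivalent to $\vec P\times\tilde\phi-iM\tilde\phi=0$. **(4) Noncommutative wave equations.** Let $x_a=\lambda t_a$ be the generators of $U(su_2)$, $[x_a,x_b]=i\lambda\epsilon_{abc}x_c$, and let $\hat U$ be the completion of $U(su_2)$ consisting of the families of operators on all finite-dimensional representations that commute with intertwiners. The functions $P_0$ and $P_a$ on $SU_2$ act on $\hat U$ by the coregular action $h\mapsto\langle f,h_{(1)}\rangle h_{(2)}$; put $\partial_a=iP_a$. Then $\partial_a1=0$, $\partial_ax_b=\delta_{ab}$, and for $u\in S^3_{NS}$ with coordinates $\vec p$ the plane wave $\psi_{\vec p}(x)=e^{i\vec p\cdot\vec x}$ satisfies $\partial_a\psi_{\vec p}=iP_a(u)\psi_{\vec p}$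 and $P_0\psi_{\vec p}=P_0(u)\psi_{\vec p}$. For a Borel measure $\nu$ on $S^3_{NS}$ (for instance Haar measure or the invariant measure of $C_m$) and $\nu$-integrable $\tilde\phi$ let $\phi(x)=\int\tilde\phi(u)\,\psi_{\vec p(u)}(x)\,d\nu(u)\in\hat U\otimes\mathbb C^k$. This Fourier transform is injective modulo $\nu$-null functions and turns multiplication by $P_a$ and $P_0$ into $-i\partial_a$ and $P_0$. With $\Delta=\partial_a\partial_a$ and all momentum-space equations understood $\nu$-almost everywhere: * spin 0: $P_0\tilde\phi=\cos(m\lambda/2)\tilde\phi$ implies $(\Delta+M^2)\phi=0$, and is equivalent to it if $\tilde\phi$ vanishes outside $H_m$; * spin $\frac12$: the constraint implies $(i\vec\partial\cdot\vec\sigma-M)\phi=0$ and $(\Delta+M^2)\phi=0$, and is equivalent to $(i\vec\partial\cdot\vec\sigma-M)\phi=0$ if $\tilde\phi$ vanishes outside $H_m$; * spin 1: the constraint implies $\vec\partial\cdot\phi=0$ and $(\Delta+M^2)\phi=0$; if $m\ne\pi/\lambda$ and $\tilde\phi$ vanishes outside $H_m$, it is equivalent to $\vec\partial\times\phi+M\phi=0$.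 -/

import Mathlib

open MeasureTheory
open scoped Matrix

namespace SpinModel

noncomputable section

/-! ### The group `SU₂` and its coordinates -/

/-- The group `SU₂`, the curved momentum space. -/
abbrev SU2 : Type := Matrix.specialUnitaryGroup (Fin 2) ℂ

instance : SecondCountableTopology SU2 :=
  haveI : SecondCountableTopology (Matrix (Fin 2) (Fin 2) ℂ) :=
    inferInstanceAs (SecondCountableTopology (Fin 2 → Fin 2 → ℂ))
  TopologicalSpace.Subtype.secondCountableTopology
    (Matrix.specialUnitaryGroup (Fin 2) ℂ : Set (Matrix (Fin 2) (Fin 2) ℂ))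

instance : IsTopologicalGroup SU2 where
  continuous_inv := by
    refine Continuous.subtype_mk (f := fun u : SU2 => star (u : Matrix (Fin 2) (Fin 2) ℂ)) ?_ _
    fun_prop

instance : CompactSpace SU2 := by
  refine isCompact_iff_compactSpace (s := (Matrix.specialUnitaryGroup (Fin 2) ℂ :
    Set (Matrix (Fin 2) (Fin 2) ℂ))).1 ?_
  have hK : IsCompact (Set.univ.pi fun _ : Fin 2 => Set.univ.pi fun _ : Fin 2 =>
      Metric.closedBall (0 : ℂ) 1) :=
    isCompact_univ_pi fun _ => isCompact_univ_pi fun _ => isCompact_closedBall _ _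
  have hK' : IsCompact {A : Matrix (Fin 2) (Fin 2) ℂ | ∀ i j, ‖A i j‖ ≤ 1} := by
    have h : {A : Matrix (Fin 2) (Fin 2) ℂ | ∀ i j, ‖A i j‖ ≤ 1} =
        Set.univ.pi fun _ : Fin 2 => Set.univ.pi fun _ : Fin 2 =>
          Metric.closedBall (0 : ℂ) 1 :=
      Set.ext fun A => ⟨fun h i _ j _ => by simpa using h i j,
        fun h i j => by simpa using h i trivial j trivial⟩
    rw [h]
    exact hK
  refine hK'.of_isClosed_subset ?_ ?_
  · have h : (Matrix.specialUnitaryGroup (Fin 2) ℂ : Set (Matrix (Fin 2) (Fin 2) ℂ)) =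
        {A | star A * A = 1} ∩ {A | A * star A = 1} ∩ {A | A.det = 1} := by
      ext A
      simp only [SetLike.mem_coe, Matrix.mem_specialUnitaryGroup_iff, Matrix.unitaryGroup,
        Unitary.mem_iff, Set.mem_inter_iff, Set.mem_ofPred_eq]
    rw [h]
    refine ((isClosed_eq ?_ ?_).inter (isClosed_eq ?_ ?_)).inter (isClosed_eq ?_ ?_) <;> fun_prop
  · intro A hA i j
    exact entry_norm_bound_of_unitary (Matrix.mem_specialUnitaryGroup_iff.1 hA).1 i j

instance : MeasurableSpace SU2 := borel SU2
instance : BorelSpace SU2 := ⟨rfl⟩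

/-- The Haar probability measure of `SU₂`. -/
def haar : Measure SU2 := Measure.haarMeasure ⊤

instance : IsFiniteMeasure haar := ⟨by
  have h : haar (Set.univ : Set SU2) = 1 := by
    simpa [haar] using Measure.haarMeasure_self (K₀ := (⊤ : TopologicalSpace.PositiveCompacts SU2))
  rw [h]
  exact ENNReal.one_lt_top⟩

/-- The Pauli matrices. -/
def pauli : Fin 3 → Matrix (Fin 2) (Fin 2) ℂ :=
  ![!![0, 1; 1, 0], !![0, -Complex.I; Complex.I, 0], !![1, 0; 0, -1]]

/-- The contraction `v · σ` of a vector with the Pauli matrices. -/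
def slash (v : Fin 3 → ℂ) : Matrix (Fin 2) (Fin 2) ℂ := ∑ a, v a • pauli a

/-- The global coordinate `P₀` on `SU₂`, i.e. half of the trace. -/
def P0 (u : SU2) : ℝ := (u : Matrix (Fin 2) (Fin 2) ℂ).trace.re / 2

/-- The global coordinates `P₁, P₂, P₃` on `SU₂`, where `u = P₀ + (i λ / 2) P · σ`,
so that `Tr (σ_a u) = i λ P_a`. -/
def P (lam : ℝ) (u : SU2) (a : Fin 3) : ℝ :=
  (pauli a * (u : Matrix (Fin 2) (Fin 2) ℂ)).trace.im / lam

/-- The complexified vector `(P₁, P₂, P₃)`. -/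
def Pvec (lam : ℝ) (u : SU2) : Fin 3 → ℂ := fun a => (P lam u a : ℂ)

/-- The Lie algebra coordinates `p` of a group element `u`, where `u = exp (i λ p · t)`
with `t_a = σ_a / 2` and `P_a = p_a sin (λ |p| / 2) / (λ |p| / 2)`, `P₀ = cos (λ |p| / 2)`. -/
def lieCoord (lam : ℝ) (u : SU2) (a : Fin 3) : ℝ :=
  Real.arccos (P0 u) / √(1 - P0 u ^ 2) * P lam u a

/-- The element `exp (i α t₃)` of `SU₂`. -/
def torus (α : ℝ) : SU2 :=
  ⟨Matrix.diagonal ![Complex.exp (Complex.I * α / 2), Complex.exp (-(Complex.I * α / 2))], by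
    have hc : ∀ z : ℂ, (starRingEnd ℂ) (Complex.exp z) = Complex.exp ((starRingEnd ℂ) z) :=
      fun z => (Complex.exp_conj z).symm
    rw [Matrix.mem_specialUnitaryGroup_iff, Matrix.mem_unitaryGroup_iff]
    constructor
    · rw [Matrix.star_eq_conjTranspose, Matrix.diagonal_conjTranspose, Matrix.diagonal_mul_diagonal,
        ← Matrix.diagonal_one]
      congr 1
      ext i
      fin_cases i <;> simp [hc, ← Complex.exp_add, neg_div, Complex.conj_ofNat]
    · simp [Matrix.det_diagonal, Fin.prod_univ_two, ← Complex.exp_add]⟩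

/-- The point `v exp (i m λ t₃) v⁻¹`. -/
def orbitPt (lam m : ℝ) (v : SU2) : SU2 := v * torus (m * lam) * v⁻¹

/-- The conjugacy class `C_m`. -/
def conjClass (lam m : ℝ) : Set SU2 := Set.range (orbitPt lam m)

/-- The closed hemisphere `P₀ ≥ 0` or `P₀ ≤ 0` that contains `C_m`
(all of `SU₂` when `C_m` is the equator). -/
def patch (lam m : ℝ) : Set SU2 := {u | 0 ≤ P0 u * Real.cos (m * lam / 2)}

/-- The three-sphere without its poles `1` and `-1`. -/
abbrev S3NS : Type :=
  {u : SU2 // (u : Matrix (Fin 2) (Fin 2) ℂ) ≠ 1 ∧ (u : Matrix (Fin 2) (Fin 2) ℂ) ≠ -1}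

/-- The point `g⁻¹ u g` of the sphere without poles. -/
def S3NS.conj (g : SU2) (u : S3NS) : S3NS :=
  ⟨g⁻¹ * u.1 * g, by
    have key : ∀ c : Matrix (Fin 2) (Fin 2) ℂ, (∀ A, A * c = c * A) →
        ((g⁻¹ * u.1 * g : SU2) : Matrix (Fin 2) (Fin 2) ℂ) = c → (u.1 : Matrix _ _ ℂ) = c := by
      intro c hc h
      have h1 : ((g * (g⁻¹ * u.1 * g) * g⁻¹ : SU2) : Matrix (Fin 2) (Fin 2) ℂ) = c := by
        rw [Submonoid.coe_mul, Submonoid.coe_mul, h, hc, mul_assoc, ← Submonoid.coe_mul]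
        simp
      have h2 : g * (g⁻¹ * u.1 * g) * g⁻¹ = u.1 := by group
      rwa [h2] at h1
    exact ⟨fun h => u.2.1 (key 1 (by simp) h), fun h => u.2.2 (key (-1) (by simp) h)⟩⟩

/-- The measure on the sphere without poles carried by the orbit `C_m` and invariant under
conjugation: the image of the Haar measure under `v ↦ v exp (i m λ t₃) v⁻¹`. -/
def orbitMeasure (lam m : ℝ) : Measure S3NS :=
  (haar.map (orbitPt lam m)).comap (Subtype.val : S3NS → SU2)

/-! ### The irreducible representations of `SU₂` -/

/-- The space `ℂ^{2s+1}`, with `n = 2 s`. -/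
abbrev E (n : ℕ) : Type := EuclideanSpace ℂ (Fin (n + 1))

/-- The matrix of the spin `n / 2` representation `ρ^{n/2}`: the `n`-th symmetric power of the
defining representation, in the orthonormal basis `√(n choose k) X^{n-k} Y^k`, `0 ≤ k ≤ n`, of
homogeneous polynomials; `g` sends `X` to `g₀₀ X + g₁₀ Y` and `Y` to `g₀₁ X + g₁₁ Y`, and
polynomials are written at `X = 1`. The `k`-th basis vector has `t₃`-weight `n / 2 - k`. -/
def rho (n : ℕ) (g : SU2) : Matrix (Fin (n + 1)) (Fin (n + 1)) ℂ :=
  Matrix.of fun l k =>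
    ((√(n.choose k) / √(n.choose l) : ℝ) : ℂ) *
      ((Polynomial.C (g.1 0 0) + Polynomial.C (g.1 1 0) * Polynomial.X) ^ (n - (k : ℕ)) *
        (Polynomial.C (g.1 0 1) + Polynomial.C (g.1 1 1) * Polynomial.X) ^ (k : ℕ)).coeff l

/-- The operator `ρ^{n/2}(g)` on `ℂ^{n+1}`. -/
def spin (n : ℕ) (g : SU2) : E n →ₗ[ℂ] E n := Matrix.toEuclideanLin (rho n g)

/-- The lowest weight vector `|s, -s⟩`, with `s = n / 2`. -/
def lowest (n : ℕ) : E n := EuclideanSpace.single (Fin.last n) 1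

/-- The change of basis from Cartesian components to the weight basis of spin `1`. -/
def cartToWeight : Matrix (Fin 3) (Fin 3) ℂ :=
  !![1 / √2, -Complex.I / √2, 0; 0, 0, -1; -1 / √2, -Complex.I / √2, 0]

/-- The group-valued spin constraint `ρ^s(u) x = e^{-i m λ s} x` at the point `u`, `s = n / 2`. -/
def Constraint (lam m : ℝ) (n : ℕ) (u : SU2) (x : E n) : Prop :=
  spin n u x = Complex.exp (-(Complex.I * m * lam * (n / 2))) • x

/-- The spin constraint for spin `1` on a vector given by its Cartesian components. -/
def CartConstraint (lam m : ℝ) (u : SU2) (x : Fin 3 → ℂ) : Prop :=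
  Constraint lam m 2 u (WithLp.toLp 2 (cartToWeight *ᵥ x))

/-! ### The quantum double `D(SU₂)` -/

/-- The quantum double in its convolution form: continuous functions `F (g, u)` on `SU₂ × SU₂`. -/
abbrev DSU2 : Type := C(SU2 × SU2, ℂ)

/-- The product `(F₁ • F₂)(g, u) = ∫ F₁ (z, (z⁻¹ g) u (z⁻¹ g)⁻¹) F₂ (z⁻¹ g, u) dz`. -/
def dmul (F₁ F₂ : DSU2) : DSU2 where
  toFun x := ∫ z, F₁ (z, (z⁻¹ * x.1) * x.2 * (z⁻¹ * x.1)⁻¹) * F₂ (z⁻¹ * x.1, x.2) ∂haar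
  continuous_toFun := by
    have h := continuous_parametric_integral_of_continuous (μ := haar) (X := SU2 × SU2)
      (f := fun x z => F₁ (z, (z⁻¹ * x.1) * x.2 * (z⁻¹ * x.1)⁻¹) * F₂ (z⁻¹ * x.1, x.2))
      (by simp only [Function.uncurry_def]; fun_prop) (s := Set.univ) isCompact_univ
    simpa using h

/-- The involution `F*(g, u)`, the conjugate of `F (g⁻¹, g u g⁻¹)`. -/
def dstar (F : DSU2) : DSU2 where
  toFun x := (starRingEnd ℂ) (F (x.1⁻¹, x.1 * x.2 * x.1⁻¹))
  continuous_toFun := by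
    refine Complex.continuous_conj.comp (F.continuous.comp ?_)
    fun_prop

/-- The function part of the product of singular elements
`(δ_{g₁} ⊗ f₁) • (δ_{g₂} ⊗ f₂) = δ_{g₁ g₂} ⊗ f₁ (g₂ ( ) g₂⁻¹) f₂`. -/
def singMul (f₁ : C(SU2, ℂ)) (g₂ : SU2) (f₂ : C(SU2, ℂ)) : C(SU2, ℂ) where
  toFun u := f₁ (g₂ * u * g₂⁻¹) * f₂ u

/-- Irreducible `*`-representation of the quantum double by bounded operators on a Hilbert
space. -/
structure IsIrrep {H : Type*} [NormedAddCommGroup H] [InnerProductSpace ℂ H]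
    (π : DSU2 →ₗ[ℂ] (H →L[ℂ] H)) : Prop where
  complete : CompleteSpace H
  map_mul : ∀ F₁ F₂, π (dmul F₁ F₂) = (π F₁).comp (π F₂)
  map_star : ∀ F x y, inner ℂ (π (dstar F) x) y = inner ℂ x (π F y)
  ne_zero : π ≠ 0
  irreducible : ∀ K : Submodule ℂ H, IsClosed (K : Set H) → (∀ F, ∀ x ∈ K, π F x ∈ K) →
    K = ⊥ ∨ K = ⊤

/-- The masses for which the eigenvalue `e^{-i m λ s}` of `ρ^s(u)`, `u ∈ C_m`, `s = n / 2`, is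
simple: no `k m λ` with `1 ≤ k ≤ n` is an integer multiple of `2 π`. -/
def Generic (lam m : ℝ) (n : ℕ) : Prop :=
  ∀ k : ℕ, 1 ≤ k → k ≤ n → ∀ j : ℤ, (k : ℝ) * (m * lam) ≠ 2 * Real.pi * j

/-! ### Monopole sections and constrained fields -/

/-- The space `V_{ms}` of monopole sections, `ψ (v e^{i α t₃}) = e^{i s α} ψ (v)`, `s = n / 2`. -/
def V (n : ℕ) : Submodule ℂ (SU2 → ℂ) where
  carrier := {ψ | ∀ (α : ℝ) (v : SU2),
    ψ (v * torus α) = Complex.exp (Complex.I * (n / 2) * α) * ψ v}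
  add_mem' := fun {ψ χ} hψ hχ α v => by simp [hψ α v, hχ α v, mul_add]
  zero_mem' := fun α v => by simp
  smul_mem' := fun c ψ hψ α v => by simp [hψ α v, mul_left_comm]

/-- The space `W_{ms}` of all functions on the sphere without poles, with values in `ℂ^{2s+1}`,
that satisfy the group-valued constraint. -/
def W (lam m : ℝ) (n : ℕ) : Submodule ℂ (S3NS → E n) where
  carrier := {φ | ∀ u : S3NS, Constraint lam m n u.1 (φ u)}
  add_mem' := fun {φ χ} hφ hχ u => by
    have h1 := hφ u
    have h2 := hχ u
    simp only [Constraint] at h1 h2 ⊢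
    simp [h1, h2]
  zero_mem' := fun u => by simp [Constraint]
  smul_mem' := fun c φ hφ u => by
    have h1 := hφ u
    simp only [Constraint] at h1 ⊢
    simp [h1, smul_comm c]

/-- The fields in `W_{ms}` with support on `C_m`. -/
def Wsupp (lam m : ℝ) (n : ℕ) : Submodule ℂ (S3NS → E n) where
  carrier := {φ | φ ∈ W lam m n ∧ ∀ u : S3NS, u.1 ∉ conjClass lam m → φ u = 0}
  add_mem' := fun {φ χ} hφ hχ =>
    ⟨add_mem hφ.1 hχ.1, fun u hu => by simp [hφ.2 u hu, hχ.2 u hu]⟩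
  zero_mem' := ⟨zero_mem _, fun u _ => rfl⟩
  smul_mem' := fun c φ hφ => ⟨Submodule.smul_mem _ c hφ.1, fun u hu => by simp [hφ.2 u hu]⟩

/-- Action of the singular element `δ_g ⊗ f` on functions on `SU₂`, for the mass `m`. -/
def singV (lam m : ℝ) (g : SU2) (f : C(SU2, ℂ)) (ψ : SU2 → ℂ) : SU2 → ℂ :=
  fun v => f (g⁻¹ * orbitPt lam m v * g) * ψ (g⁻¹ * v)

/-- Action of the singular element `δ_g ⊗ f` on fields on the sphere without poles. -/
def singW (n : ℕ) (g : SU2) (f : C(SU2, ℂ)) (φ : S3NS → E n) : S3NS → E n :=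
  fun u => f (g⁻¹ * u.1 * g) • spin n g (φ (u.conj g))

/-- Action of `F` on functions on `SU₂`, for the mass `m`. -/
def convV (lam m : ℝ) (F : DSU2) (ψ : SU2 → ℂ) : SU2 → ℂ :=
  fun v => ∫ g, F (g, g⁻¹ * orbitPt lam m v * g) * ψ (g⁻¹ * v) ∂haar

/-- Action of `F` on fields on the sphere without poles. -/
def convW (n : ℕ) (F : DSU2) (φ : S3NS → E n) : S3NS → E n :=
  fun u => ∫ g, F (g, g⁻¹ * u.1 * g) • spin n g (φ (u.conj g)) ∂haar

/-- The Hilbert space of square integrable monopole sections (classes of functions in `V_{ms}`). -/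
def VL2 (n : ℕ) : Submodule ℂ (Lp ℂ 2 haar) where
  carrier := {ψ | ∃ ψ' ∈ V n, ψ =ᵐ[haar] ψ'}
  add_mem' := by
    rintro ψ χ ⟨ψ', hψ, h1⟩ ⟨χ', hχ, h2⟩
    exact ⟨ψ' + χ', add_mem hψ hχ, (Lp.coeFn_add ψ χ).trans (h1.add h2)⟩
  zero_mem' := ⟨0, zero_mem _, Lp.coeFn_zero _ _ _⟩
  smul_mem' := by
    rintro c ψ ⟨ψ', hψ, h1⟩
    exact ⟨c • ψ', Submodule.smul_mem _ c hψ, (Lp.coeFn_smul c ψ).trans (h1.const_smul c)⟩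

/-- The Hilbert space of fields that are square integrable over `C_m` and satisfy the group-valued
constraint. -/
def WL2 (lam m : ℝ) (n : ℕ) : Submodule ℂ (Lp (E n) 2 (orbitMeasure lam m)) where
  carrier := {φ | ∃ φ' ∈ Wsupp lam m n, φ =ᵐ[orbitMeasure lam m] φ'}
  add_mem' := by
    rintro ψ χ ⟨ψ', hψ, h1⟩ ⟨χ', hχ, h2⟩
    exact ⟨ψ' + χ', add_mem hψ hχ, (Lp.coeFn_add ψ χ).trans (h1.add h2)⟩
  zero_mem' := ⟨0, zero_mem _, Lp.coeFn_zero _ _ _⟩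
  smul_mem' := by
    rintro c ψ ⟨ψ', hψ, h1⟩
    exact ⟨c • ψ', Submodule.smul_mem _ c hψ, (Lp.coeFn_smul c ψ).trans (h1.const_smul c)⟩

/-! ### The noncommutative position space `U(su₂)` and its completion -/

attribute [local instance 100] LieRing.ofAssociativeRing

/-- The complexification of the Lie algebra `su₂`. -/
abbrev Lsu2 : Type := LieAlgebra.SpecialLinear.sl (Fin 2) ℂ

/-- The enveloping algebra `U(su₂)`. -/
abbrev Usu2 : Type := UniversalEnvelopingAlgebra ℂ Lsu2

/-- The generators `t_a = σ_a / 2` of `su₂`. -/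
def tgen (a : Fin 3) : Lsu2 :=
  ⟨(1 / 2 : ℂ) • pauli a, by
    change Matrix.trace ((1 / 2 : ℂ) • pauli a) = 0
    fin_cases a <;> simp [pauli, Matrix.trace_fin_two]⟩

/-- A finite dimensional representation of `su₂` by matrices. -/
structure FinRep where
  dim : ℕ
  hom : Lsu2 →ₗ⁅ℂ⁆ Matrix (Fin dim) (Fin dim) ℂ

/-- Intertwiners of finite dimensional representations. -/
def Intertwines (X Y : FinRep) (T : Matrix (Fin Y.dim) (Fin X.dim) ℂ) : Prop :=
  ∀ y, T * X.hom y = Y.hom y * T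

/-- The completion of `U(su₂)` in which the exponentials live: families of operators on all finite
dimensional representations that commute with intertwiners. It is the full dual of the coordinate
algebra of `SU₂`, equivalently the product of the endomorphism algebras of the irreducible
representations. -/
def Uhat : Subalgebra ℂ (∀ X : FinRep, Matrix (Fin X.dim) (Fin X.dim) ℂ) where
  carrier := {h | ∀ X Y T, Intertwines X Y T → T * h X = h Y * T}
  mul_mem' := fun {h k} hh hk X Y T hT => by
    simp only [Pi.mul_apply]
    rw [← Matrix.mul_assoc, hh X Y T hT, Matrix.mul_assoc, hk X Y T hT, Matrix.mul_assoc]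
  add_mem' := fun {h k} hh hk X Y T hT => by
    simp only [Pi.add_apply]
    rw [Matrix.mul_add, Matrix.add_mul, hh X Y T hT, hk X Y T hT]
  algebraMap_mem' := fun c X Y T _ => by
    simp [Algebra.algebraMap_eq_smul_one]

/-- The canonical map of `U(su₂)` to its completion: an element acts on every representation. -/
def ofU : Usu2 →ₐ[ℂ] Uhat :=
  UniversalEnvelopingAlgebra.lift ℂ
    { toFun := fun y => ⟨fun X => X.hom y, fun _ _ _ hT => hT y⟩
      map_add' := fun y z => Subtype.ext (funext fun X => map_add X.hom y z)
      map_smul' := fun c y => Subtype.ext (funext fun X => map_smul X.hom c y)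
      map_lie' := fun {y z} => Subtype.ext (funext fun X => LieHom.map_lie X.hom y z) }

/-- The generators `x_a = λ t_a` of the spin-model spacetime `[x_a, x_b] = i λ ε_{abc} x_c`. -/
def pos (lam : ℝ) (a : Fin 3) : Usu2 := (lam : ℂ) • UniversalEnvelopingAlgebra.ι ℂ (tgen a)

/-- Left multiplication by a rectangular matrix. -/
def mulLeftLin {k l : ℕ} (T : Matrix (Fin k) (Fin l) ℂ) :
    Matrix (Fin l) (Fin l) ℂ →ₗ[ℂ] Matrix (Fin k) (Fin l) ℂ where
  toFun M := T * M
  map_add' M N := Matrix.mul_add T M N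
  map_smul' c M := Matrix.mul_smul T c M

/-- Right multiplication by a rectangular matrix. -/
def mulRightLin {k l : ℕ} (T : Matrix (Fin k) (Fin l) ℂ) :
    Matrix (Fin k) (Fin k) ℂ →ₗ[ℂ] Matrix (Fin k) (Fin l) ℂ where
  toFun M := M * T
  map_add' M N := Matrix.add_mul M N T
  map_smul' c M := Matrix.smul_mul c M T

/-- Exponentials commute with intertwiners. -/
theorem exp_intertwine {k l : ℕ} (T : Matrix (Fin k) (Fin l) ℂ) (A : Matrix (Fin l) (Fin l) ℂ)
    (B : Matrix (Fin k) (Fin k) ℂ) (h : T * A = B * T) :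
    T * NormedSpace.exp A = NormedSpace.exp B * T := by
  have hpow : ∀ n : ℕ, T * A ^ n = B ^ n * T := by
    intro n
    induction n with
    | zero => simp
    | succ n ih => rw [pow_succ, ← Matrix.mul_assoc, ih, Matrix.mul_assoc, h, ← Matrix.mul_assoc, ← pow_succ]
  have hs : ∀ (d : ℕ) (M : Matrix (Fin d) (Fin d) ℂ),
      HasSum (fun n : ℕ => ((n.factorial : ℂ)⁻¹) • M ^ n) (NormedSpace.exp M) := by
    intro d M
    let _ := Matrix.linftyOpNormedRing (n := Fin d) (α := ℂ)
    let _ := Matrix.linftyOpNormedAlgebra (n := Fin d) (R := ℂ) (α := ℂ)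
    exact NormedSpace.exp_series_hasSum_exp' (𝕂 := ℂ) M
  have h1 := (hs l A).map (mulLeftLin T) (by
    change Continuous fun M : Matrix (Fin l) (Fin l) ℂ => T * M
    fun_prop)
  have h2 := (hs k B).map (mulRightLin T) (by
    change Continuous fun M : Matrix (Fin k) (Fin k) ℂ => M * T
    fun_prop)
  have h3 : (mulLeftLin T ∘ fun n : ℕ => ((n.factorial : ℂ)⁻¹) • A ^ n) =
      mulRightLin T ∘ fun n : ℕ => ((n.factorial : ℂ)⁻¹) • B ^ n := by
    funext n
    simp [mulLeftLin, mulRightLin, hpow]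
  rw [h3] at h1
  exact h1.unique h2

/-- The noncommutative plane wave `ψ_p(x) = exp (i p · x)`. -/
def planeWave (lam : ℝ) (p : Fin 3 → ℝ) : Uhat :=
  ⟨fun X => NormedSpace.exp (∑ a, (Complex.I * p a) • (ofU (pos lam a)).1 X), fun X Y T hT => by
    refine exp_intertwine T _ _ ?_
    rw [Matrix.mul_sum, Matrix.sum_mul]
    refine Finset.sum_congr rfl fun a _ => ?_
    rw [Matrix.mul_smul, Matrix.smul_mul, (ofU (pos lam a)).2 X Y T hT]⟩

/-- The tensor product of the defining representation of `su₂` with `X`. -/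
def halfTensor (X : FinRep) : FinRep where
  dim := 2 * X.dim
  hom :=
    { toFun := fun y => Matrix.reindexAlgEquiv ℂ ℂ finProdFinEquiv
        (Matrix.kroneckerMap (· * ·) y.1 1 + Matrix.kroneckerMap (· * ·) 1 (X.hom y))
      map_add' := fun y z => by
        rw [← map_add]
        congr 1
        ext ⟨i, i'⟩ ⟨j, j'⟩
        simp [Matrix.kroneckerMap_apply, add_mul, mul_add]
        ring
      map_smul' := fun c y => by
        rw [RingHom.id_apply, ← map_smul]
        congr 1
        ext ⟨i, i'⟩ ⟨j, j'⟩
        simp [Matrix.kroneckerMap_apply, mul_add]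
        ring
      map_lie' := fun {y z} => by
        rw [LieRing.of_associative_ring_bracket, ← map_mul, ← map_mul, ← map_sub]
        congr 1
        simp only [LieHom.map_lie, LieAlgebra.SpecialLinear.sl_bracket,
          LieRing.of_associative_ring_bracket, mul_add, add_mul, ← Matrix.mul_kronecker_mul,
          one_mul, mul_one]
        ext ⟨i, i'⟩ ⟨j, j'⟩
        simp [Matrix.kroneckerMap_apply, sub_mul, mul_sub]
        ring }

/-- The index set of `halfTensor X` as a product. -/
def halfEquiv (X : FinRep) : Fin 2 × Fin X.dim ≃ Fin (halfTensor X).dim := finProdFinEquiv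

/-- The operator `1 ⊗ T` between tensor products with the defining representation. -/
def oneTensor {X Y : FinRep} (T : Matrix (Fin Y.dim) (Fin X.dim) ℂ) :
    Matrix (Fin (halfTensor Y).dim) (Fin (halfTensor X).dim) ℂ :=
  (Matrix.kroneckerMap (· * ·) (1 : Matrix (Fin 2) (Fin 2) ℂ) T).submatrix
    (halfEquiv Y).symm (halfEquiv X).symm

theorem halfTensor_hom (X : FinRep) (y : Lsu2) : (halfTensor X).hom y =
    (Matrix.kroneckerMap (· * ·) y.1 1 + Matrix.kroneckerMap (· * ·) 1 (X.hom y)).submatrix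
      (halfEquiv X).symm (halfEquiv X).symm := rfl

theorem oneTensor_intertwines {X Y : FinRep} {T : Matrix (Fin Y.dim) (Fin X.dim) ℂ}
    (hT : Intertwines X Y T) : Intertwines (halfTensor X) (halfTensor Y) (oneTensor T) := by
  intro y
  rw [halfTensor_hom, halfTensor_hom, oneTensor,
    Matrix.submatrix_mul_equiv, Matrix.submatrix_mul_equiv, Matrix.mul_add, Matrix.add_mul,
    ← Matrix.mul_kronecker_mul, ← Matrix.mul_kronecker_mul, ← Matrix.mul_kronecker_mul,
    ← Matrix.mul_kronecker_mul, hT y]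
  simp

/-- The partial trace over the defining representation against the matrix `A`. -/
def partialTrace (A : Matrix (Fin 2) (Fin 2) ℂ) (X : FinRep) :
    Matrix (Fin (halfTensor X).dim) (Fin (halfTensor X).dim) ℂ →ₗ[ℂ]
      Matrix (Fin X.dim) (Fin X.dim) ℂ where
  toFun M := Matrix.of fun i j => ∑ k, ∑ l, A k l * M (halfEquiv X (l, i)) (halfEquiv X (k, j))
  map_add' M N := by
    ext i j
    simp only [Matrix.add_apply, Matrix.of_apply, mul_add, Finset.sum_add_distrib]
  map_smul' c M := by
    ext i j
    simp only [Matrix.smul_apply, Matrix.of_apply, smul_eq_mul, RingHom.id_apply,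
      Finset.mul_sum, mul_left_comm]

/-- The action on the completion of the function `u ↦ Tr (A u)` on `SU₂`, which is
`h ↦ ⟨Tr (A ·), h₍₁₎⟩ h₍₂₎`: act with `h` on the tensor product of the defining representation with
`X` and take the partial trace against `A`. -/
def coreg (A : Matrix (Fin 2) (Fin 2) ℂ) : Uhat →ₗ[ℂ] Uhat where
  toFun h := ⟨fun X => partialTrace A X (h.1 (halfTensor X)),
    fun X Y T hT => by
      have hT' := h.2 (halfTensor X) (halfTensor Y) (oneTensor T) (oneTensor_intertwines hT)
      ext i j
      have key : ∀ k l : Fin 2,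
          ∑ r, T i r * h.1 (halfTensor X) (halfEquiv X (l, r)) (halfEquiv X (k, j)) =
          ∑ r, h.1 (halfTensor Y) (halfEquiv Y (l, i)) (halfEquiv Y (k, r)) * T r j := by
        intro k l
        have h1 := congrFun (congrFun hT' (halfEquiv Y (l, i))) (halfEquiv X (k, j))
        rw [Matrix.mul_apply, Matrix.mul_apply, ← (halfEquiv X).sum_comp,
          ← (halfEquiv Y).sum_comp, Fintype.sum_prod_type, Fintype.sum_prod_type] at h1
        simp only [oneTensor, Matrix.submatrix_apply, Equiv.symm_apply_apply,
          Matrix.kroneckerMap_apply, Matrix.one_apply, ite_mul, mul_ite, one_mul, zero_mul,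
          mul_zero] at h1
        rw [Finset.sum_comm] at h1
        conv_rhs at h1 => rw [Finset.sum_comm]
        simpa only [Finset.sum_ite_eq, Finset.sum_ite_eq', Finset.mem_univ, if_true] using h1
      simp only [partialTrace, LinearMap.coe_mk, AddHom.coe_mk, Matrix.mul_apply, Matrix.of_apply,
        Finset.mul_sum, Finset.sum_mul]
      rw [Finset.sum_comm]
      conv_rhs => rw [Finset.sum_comm]
      refine Finset.sum_congr rfl fun k _ => ?_
      rw [Finset.sum_comm]
      conv_rhs => rw [Finset.sum_comm]
      refine Finset.sum_congr rfl fun l _ => ?_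
      have h2 := congrArg (fun z => A k l * z) (key k l)
      simp only [Finset.mul_sum] at h2
      simpa only [mul_assoc, mul_left_comm] using h2⟩
  map_add' h k := Subtype.ext (funext fun X =>
    (partialTrace A X).map_add (h.1 (halfTensor X)) (k.1 (halfTensor X)))
  map_smul' c h := Subtype.ext (funext fun X =>
    (partialTrace A X).map_smul c (h.1 (halfTensor X)))

/-- The operator `P₀` on the noncommutative spacetime. -/
def P0op : Uhat →ₗ[ℂ] Uhat := coreg ((1 / 2 : ℂ) • 1)

/-- The operators `P_a` on the noncommutative spacetime, `a = 1, 2, 3`. -/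
def Pop (lam : ℝ) (a : Fin 3) : Uhat →ₗ[ℂ] Uhat := coreg ((Complex.I * lam)⁻¹ • pauli a)

/-- The noncommutative partial derivatives `∂_a = i P_a`. -/
def pd (lam : ℝ) (a : Fin 3) : Uhat →ₗ[ℂ] Uhat := Complex.I • Pop lam a

/-- The noncommutative Laplace operator. -/
def lapl (lam : ℝ) (h : Uhat) : Uhat := ∑ a, pd lam a (pd lam a h)

/-- The operator `∂ · σ` on two-component fields. -/
def dirac (lam : ℝ) (φ : Fin 2 → Uhat) : Fin 2 → Uhat :=
  fun i => ∑ a, ∑ j, pauli a i j • pd lam a (φ j)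

/-- The divergence. -/
def divg (lam : ℝ) (φ : Fin 3 → Uhat) : Uhat := ∑ a, pd lam a (φ a)

/-- The curl. -/
def curl (lam : ℝ) (φ : Fin 3 → Uhat) : Fin 3 → Uhat :=
  ![pd lam 1 (φ 2) - pd lam 2 (φ 1), pd lam 2 (φ 0) - pd lam 0 (φ 2),
    pd lam 0 (φ 1) - pd lam 1 (φ 0)]

open Classical in
/-- The quantum group Fourier transform `∫ f(u) ψ_{p(u)}(x) dν(u)` of a function on momentum space
with respect to a measure `ν`. -/
def qFourier (lam : ℝ) (ν : Measure S3NS) (f : S3NS → ℂ) : Uhat :=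
  if hf : ∀ X i j, Integrable (fun u => f u * (planeWave lam (lieCoord lam u.1)).1 X i j) ν then
    ⟨fun X => Matrix.of fun i j => ∫ u, f u * (planeWave lam (lieCoord lam u.1)).1 X i j ∂ν,
      fun X Y T hT => by
        ext i j
        simp only [Matrix.mul_apply, Matrix.of_apply, ← integral_const_mul, ← integral_mul_const]
        rw [← integral_finsetSum _ fun r _ => (hf X r j).const_mul (T i r),
          ← integral_finsetSum _ fun r _ => (hf Y i r).mul_const (T r j)]
        refine integral_congr_ae (Filter.Eventually.of_forall fun u => ?_)
        have h1 := congrFun (congrFun ((planeWave lam (lieCoord lam u.1)).2 X Y T hT) i) j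
        rw [Matrix.mul_apply, Matrix.mul_apply] at h1
        have h2 := congrArg (fun z => f u * z) h1
        simp only [Finset.mul_sum] at h2
        simpa only [mul_assoc, mul_left_comm] using h2⟩
  else 0

/-- The Fourier transform of a vector-valued field, componentwise. -/
def qFourierVec {k : ℕ} (lam : ℝ) (ν : Measure S3NS) (φ : S3NS → Fin k → ℂ) : Fin k → Uhat :=
  fun c => qFourier lam ν fun u => φ u c

/-- The effective mass. -/
def effMass (lam m : ℝ) : ℝ := Real.sin (m * lam / 2) / (lam / 2)

end

end SpinModel

open SpinModel

namespace SpinModel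

noncomputable section

attribute [local instance 100] LieRing.ofAssociativeRing

/-! ### Entries, coordinates and diagonalisation -/

/-! Three mechanisms carry the result: diagonalisation in `SU₂`, integral operators with
torus-invariant kernels, and the group-like nature of plane waves.

Geometry. Every `u` is conjugate to a diagonal element with angle determined by `P0 u`
(`exists_eq_conj_torus`), so conjugacy classes are the level sets of `P0`, and the exponential
formula is checked on the torus. The matrices `rho n` act on `coherent` vectors, the `n`-th powers
of linear forms, through the linear form alone, and a matrix is determined by its values on them
(`ext_coherent`); multiplicativity, unitarity and the weights follow.

Momentum space. For spin 1/2 the constraint says that a phase is an eigenvalue of `u`, and the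
characteristic polynomial then fixes `P0`. For spin 1 it says that `z · σ` commutes with `u` up to a
phase: the trace gives `P · z = 0`, the rest is a linear relation between `z` and `P × z`, and a
further cross product with `P` fixes `P0 ^ 2`. Only the square is fixed; restriction to `patch`
resolves the sign.

Representations. In the variables `v` and `w = g⁻¹ v` an element of the double acts on sections by a
continuous kernel; its product and involution become composition and adjunction of kernels. A
continuous kernel arises in this way as soon as it is invariant under simultaneous right translation
by the torus (`exists_doubleKernel_eq`), so rank-one operators built from continuous sections are
available. Torus averaging shows that these sections are total, and irreducibility follows.
Genericity makes the eigenvalue in the constraint simple on the orbit, so a constrained field at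
`orbitPt lam m v` is a multiple of `spin n v (lowest n)`. The coefficient is a monopole section, and
the representation is transported along the resulting isometry.

Position space. On the tensor product of the defining representation with `X`, a plane wave is `u`
tensored with its value on `X` (`planeWave_halfTensor`), so it is a joint eigenvector of the
coregular action and the Fourier transform turns multiplication into operators. Products of matrix
entries are matrix coefficients of plane waves, so Stone-Weierstrass gives injectivity
(`qFourier_injective`). Each wave equation thereby becomes a pointwise almost-everywhere equation,
decided by the momentum space lemmas. -/

theorem coe_inv_eq_star (u : SU2) : ((u⁻¹ : SU2) : Matrix (Fin 2) (Fin 2) ℂ) = star u.1 := rfl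

theorem coe_inv_eq_adjugate (u : SU2) :
    ((u⁻¹ : SU2) : Matrix (Fin 2) (Fin 2) ℂ) = u.1.adjugate := by
  have h1 : u.1 * u.1.adjugate = 1 := by
    rw [Matrix.mul_adjugate, (Matrix.mem_specialUnitaryGroup_iff.1 u.2).2, one_smul]
  have h2 : ((u⁻¹ : SU2) : Matrix (Fin 2) (Fin 2) ℂ) * u.1 = 1 := by
    rw [← Submonoid.coe_mul, inv_mul_cancel]; rfl
  exact left_inv_eq_right_inv h2 h1

theorem coe_mul_inv (u : SU2) : u.1 * ((u⁻¹ : SU2) : Matrix (Fin 2) (Fin 2) ℂ) = 1 := by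
  rw [← Submonoid.coe_mul, mul_inv_cancel]; rfl

theorem coe_inv_mul (u : SU2) : ((u⁻¹ : SU2) : Matrix (Fin 2) (Fin 2) ℂ) * u.1 = 1 := by
  rw [← Submonoid.coe_mul, inv_mul_cancel]; rfl

/-- The conjugate transpose and the adjugate are both the inverse of `u`; comparing entries gives
the quaternionic shape of `SU₂` matrices. -/
theorem entry_one_one (u : SU2) : u.1 1 1 = (starRingEnd ℂ) (u.1 0 0) := by
  have h := (coe_inv_eq_adjugate u).symm.trans (coe_inv_eq_star u)
  simpa [Matrix.adjugate_fin_two] using congrFun (congrFun h 0) 0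

theorem entry_one_zero (u : SU2) : u.1 1 0 = -(starRingEnd ℂ) (u.1 0 1) := by
  have h := (coe_inv_eq_adjugate u).symm.trans (coe_inv_eq_star u)
  have := congrFun (congrFun h 1) 0
  simp [Matrix.adjugate_fin_two] at this
  rw [← this, neg_neg]

theorem det_coe (u : SU2) : u.1.det = 1 := (Matrix.mem_specialUnitaryGroup_iff.1 u.2).2

theorem P0_eq_re (u : SU2) : P0 u = (u.1 0 0).re := by
  simp [P0, Matrix.trace_fin_two, entry_one_one]

theorem slash_apply (v : Fin 3 → ℂ) :
    slash v = !![v 2, v 0 - Complex.I * v 1; v 0 + Complex.I * v 1, -v 2] := by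
  ext i j
  fin_cases i <;> fin_cases j <;> simp [slash, pauli, Fin.sum_univ_three] <;> ring

theorem normSq_entries (u : SU2) :
    (u.1 0 0).re ^ 2 + (u.1 0 0).im ^ 2 + (u.1 0 1).re ^ 2 + (u.1 0 1).im ^ 2 = 1 := by
  have h := congrArg Complex.re (det_coe u)
  rw [Matrix.det_fin_two, entry_one_one, entry_one_zero] at h
  simp at h
  linarith

theorem P_entries (lam : ℝ) (u : SU2) :
    P lam u 0 = 2 * (u.1 0 1).im / lam ∧ P lam u 1 = 2 * (u.1 0 1).re / lam ∧
      P lam u 2 = 2 * (u.1 0 0).im / lam := by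
  refine ⟨?_, ?_, ?_⟩ <;>
    simp [P, pauli, Matrix.trace_fin_two, Matrix.vecMul, dotProduct, Fin.sum_univ_two,
      entry_one_one, entry_one_zero] <;> ring

theorem coe_eq_coord {lam : ℝ} (hlam : lam ≠ 0) (u : SU2) :
    u.1 = (P0 u : ℂ) • 1 + (Complex.I * lam / 2) • slash (Pvec lam u) := by
  obtain ⟨h0, h1, h2⟩ := P_entries lam u
  have hl : (lam : ℂ) ≠ 0 := by exact_mod_cast hlam
  have e0 : (lam : ℂ) * P lam u 0 = 2 * (u.1 0 1).im := by rw [h0]; push_cast; field_simp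
  have e1 : (lam : ℂ) * P lam u 1 = 2 * (u.1 0 1).re := by rw [h1]; push_cast; field_simp
  have e2 : (lam : ℂ) * P lam u 2 = 2 * (u.1 0 0).im := by rw [h2]; push_cast; field_simp
  have hI : Complex.I * Complex.I = -1 := Complex.I_mul_I
  have hA := Complex.re_add_im (u.1 0 0)
  have hB := Complex.re_add_im (u.1 0 1)
  have hA' : (starRingEnd ℂ) (u.1 0 0) = (u.1 0 0).re - (u.1 0 0).im * Complex.I := by
    apply Complex.ext <;> simp
  have hB' : (starRingEnd ℂ) (u.1 0 1) = (u.1 0 1).re - (u.1 0 1).im * Complex.I := by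
    apply Complex.ext <;> simp
  rw [slash_apply, P0_eq_re]
  ext i j
  fin_cases i <;> fin_cases j <;> simp [Pvec, entry_one_one, entry_one_zero, hA', hB']
  · linear_combination -hA - Complex.I / 2 * e2
  · linear_combination -hB - Complex.I / 2 * e0 + Complex.I * Complex.I / 2 * e1 + (u.1 0 1).re * hI
  · linear_combination - Complex.I / 2 * e0 - Complex.I * Complex.I / 2 * e1 - (u.1 0 1).re * hI
  · linear_combination Complex.I / 2 * e2

theorem coord_sphere {lam : ℝ} (hlam : lam ≠ 0) (u : SU2) :
    P0 u ^ 2 + lam ^ 2 / 4 * ∑ a, P lam u a ^ 2 = 1 := by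
  obtain ⟨h0, h1, h2⟩ := P_entries lam u
  rw [Fin.sum_univ_three, h0, h1, h2, P0_eq_re, ← normSq_entries u]
  field_simp
  ring

theorem P0_sq_le_one (u : SU2) : P0 u ^ 2 ≤ 1 := by
  rw [P0_eq_re, ← normSq_entries u]
  nlinarith [sq_nonneg (u.1 0 0).im, sq_nonneg (u.1 0 1).re, sq_nonneg (u.1 0 1).im]

theorem trace_eq_two_P0 (u : SU2) : u.1.trace = 2 * P0 u := by
  rw [Matrix.trace_fin_two, entry_one_one, P0_eq_re]
  apply Complex.ext <;> simp
  ring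

theorem P0_conj (v u : SU2) : P0 (v * u * v⁻¹) = P0 u := by
  unfold P0
  rw [Submonoid.coe_mul, Matrix.trace_mul_comm, Submonoid.coe_mul, ← Matrix.mul_assoc, coe_inv_mul,
    Matrix.one_mul]

theorem torus_coe (α : ℝ) : (torus α).1 = Matrix.diagonal
    ![Complex.exp (Complex.I * α / 2), Complex.exp (-(Complex.I * α / 2))] := rfl

theorem P0_torus (α : ℝ) : P0 (torus α) = Real.cos (α / 2) := by
  rw [P0_eq_re, torus_coe]
  have : Complex.I * (α : ℂ) / 2 = ((α / 2 : ℝ) : ℂ) * Complex.I := by push_cast; ring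
  rw [this]
  exact Complex.exp_ofReal_mul_I_re _

theorem torus_add (α β : ℝ) : torus (α + β) = torus α * torus β := by
  apply Subtype.ext
  rw [Submonoid.coe_mul, torus_coe, torus_coe, torus_coe, Matrix.diagonal_mul_diagonal]
  congr 1
  ext i
  fin_cases i <;> simp [← Complex.exp_add] <;> ring_nf

theorem torus_zero : torus 0 = 1 := by
  apply Subtype.ext
  rw [torus_coe]
  simp [← Matrix.diagonal_one]

theorem continuous_torus : Continuous torus := by
  refine Continuous.subtype_mk ?_ _
  refine Continuous.matrix_diagonal ?_
  refine continuous_pi fun i => ?_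
  fin_cases i <;> simp <;> fun_prop

/-- The element of `SU₂` whose first column is a given unit vector. -/
def ofColumn (x y : ℂ) (h : Complex.normSq x + Complex.normSq y = 1) : SU2 :=
  ⟨!![x, -(starRingEnd ℂ) y; y, (starRingEnd ℂ) x], by
    have h' : x * (starRingEnd ℂ) x + y * (starRingEnd ℂ) y = 1 := by
      rw [Complex.mul_conj, Complex.mul_conj]; exact_mod_cast h
    rw [Matrix.mem_specialUnitaryGroup_iff, Matrix.mem_unitaryGroup_iff]
    constructor
    · ext i j
      fin_cases i <;> fin_cases j <;> simp [Matrix.mul_apply, Fin.sum_univ_two]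
      · linear_combination h'
      · ring
      · ring
      · linear_combination h'
    · rw [Matrix.det_fin_two_of]
      linear_combination h'⟩

/-- Every element of `SU₂` is conjugate to an element of the maximal torus. -/
theorem exists_eq_conj_torus (u : SU2) :
    ∃ v : SU2, u = v * torus (2 * Real.arccos (P0 u)) * v⁻¹ := by
  set θ := Real.arccos (P0 u) with hθ
  set μ : ℂ := Complex.exp (Complex.I * θ) with hμ
  have hsq := P0_sq_le_one u
  have hcos : Real.cos θ = P0 u := Real.cos_arccos (by nlinarith) (by nlinarith)
  have hμ' : μ * (starRingEnd ℂ) μ = 1 := by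
    rw [hμ, ← Complex.exp_conj, ← Complex.exp_add]; simp
  have hμs : μ + (starRingEnd ℂ) μ = 2 * P0 u := by
    rw [Complex.add_conj, hμ, mul_comm Complex.I, Complex.exp_ofReal_mul_I_re, hcos]; simp
  -- The characteristic polynomial is `x² - 2 P₀ x + 1`, and `μ` and its conjugate have product 1
  -- and sum `2 P₀`.
  have hdet : (u.1 - μ • 1).det = 0 := by
    have h1 := det_coe u
    have h2 := trace_eq_two_P0 u
    rw [Matrix.det_fin_two] at h1 ⊢
    rw [Matrix.trace_fin_two] at h2
    simp
    linear_combination h1 - μ * h2 + μ * hμs - hμ'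
  obtain ⟨w, hw0, hw⟩ := Matrix.exists_mulVec_eq_zero_iff.2 hdet
  have hN : 0 < Complex.normSq (w 0) + Complex.normSq (w 1) := by
    rcases (add_nonneg (Complex.normSq_nonneg (w 0)) (Complex.normSq_nonneg (w 1))).lt_or_eq with h | h
    · exact h
    · exfalso
      apply hw0
      have h0 : Complex.normSq (w 0) = 0 := by
        linarith [Complex.normSq_nonneg (w 0), Complex.normSq_nonneg (w 1)]
      have h1 : Complex.normSq (w 1) = 0 := by
        linarith [Complex.normSq_nonneg (w 0), Complex.normSq_nonneg (w 1)]
      ext i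
      fin_cases i
      · exact Complex.normSq_eq_zero.1 h0
      · exact Complex.normSq_eq_zero.1 h1
  set r : ℝ := √(Complex.normSq (w 0) + Complex.normSq (w 1)) with hr
  have hr0 : 0 < r := Real.sqrt_pos.2 hN
  have hr2 : r * r = Complex.normSq (w 0) + Complex.normSq (w 1) := Real.mul_self_sqrt hN.le
  have hunit : Complex.normSq (w 0 / r) + Complex.normSq (w 1 / r) = 1 := by
    rw [Complex.normSq_div, Complex.normSq_div, Complex.normSq_ofReal, hr2]
    field_simp
  -- The normalised eigenvector for `μ` is the first column. The second column of an `SU₂` matrix is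
  -- determined by the first and is automatically an eigenvector for the conjugate eigenvalue.
  refine ⟨ofColumn (w 0 / r) (w 1 / r) hunit, ?_⟩
  rw [eq_mul_inv_iff_mul_eq]
  apply Subtype.ext
  have ha := congrFun hw 0
  have hb := congrFun hw 1
  have hrc : (r : ℂ) ≠ 0 := by exact_mod_cast hr0.ne'
  simp [Matrix.mulVec, dotProduct, Fin.sum_univ_two] at ha hb
  have e1 : Complex.exp (Complex.I * ((2 * θ : ℝ) : ℂ) / 2) = μ := by
    rw [hμ]; congr 1; push_cast; ring
  have e2 : Complex.exp (-(Complex.I * ((2 * θ : ℝ) : ℂ) / 2)) = (starRingEnd ℂ) μ := by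
    rw [hμ, ← Complex.exp_conj]; congr 1; simp; ring
  have ha' : u.1 0 0 * w 0 + u.1 0 1 * w 1 = μ * w 0 := by linear_combination ha
  have hb' : u.1 1 0 * w 0 + u.1 1 1 * w 1 = μ * w 1 := by linear_combination hb
  have ha'' := congrArg (starRingEnd ℂ) ha'
  have hb'' := congrArg (starRingEnd ℂ) hb'
  simp [entry_one_one, entry_one_zero] at ha'' hb''
  rw [Submonoid.coe_mul, Submonoid.coe_mul, torus_coe, e1, e2]
  ext i j
  fin_cases i <;> fin_cases j <;> simp [ofColumn, Matrix.mul_apply, Fin.sum_univ_two, Matrix.diagonal]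
  · field_simp; linear_combination ha'
  · field_simp; linear_combination -hb''
  · field_simp; linear_combination hb'
  · field_simp; rw [entry_one_one, entry_one_zero]; linear_combination ha''

theorem P0_orbitPt (lam m : ℝ) (v : SU2) : P0 (orbitPt lam m v) = Real.cos (m * lam / 2) := by
  rw [orbitPt, P0_conj, P0_torus]

theorem half_angle_mem {lam m : ℝ} (hlam : 0 < lam) (hm : 0 < m) (hm' : m < 2 * Real.pi / lam) :
    0 < m * lam / 2 ∧ m * lam / 2 < Real.pi := by
  rw [lt_div_iff₀ hlam] at hm'
  constructor
  · positivity
  · linarith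

/-- The trace determines the diagonal form up to conjugation; since `m * lam / 2` lies strictly
between 0 and π, `arccos` recovers it from its cosine. -/
theorem mem_conjClass_iff {lam m : ℝ} (hlam : 0 < lam) (hm : 0 < m) (hm' : m < 2 * Real.pi / lam)
    (u : SU2) : u ∈ conjClass lam m ↔ P0 u = Real.cos (m * lam / 2) := by
  obtain ⟨h1, h2⟩ := half_angle_mem hlam hm hm'
  constructor
  · rintro ⟨v, rfl⟩
    exact P0_orbitPt lam m v
  · intro h
    obtain ⟨v, hv⟩ := exists_eq_conj_torus u
    refine ⟨v, ?_⟩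
    rw [h, Real.arccos_cos h1.le h2.le] at hv
    rw [hv, orbitPt]
    congr 3
    ring

/-- At an extreme value of `P0` the diagonal form is `1` or `-1`; these are central, so `u` itself
would be a pole. -/
theorem P0_lt_one (u : S3NS) : -1 < P0 u.1 ∧ P0 u.1 < 1 := by
  have h := P0_sq_le_one u.1
  obtain ⟨v, hv⟩ := exists_eq_conj_torus u.1
  constructor
  · refine lt_of_le_of_ne (by nlinarith) fun h1 => u.2.2 ?_
    rw [← h1, Real.arccos_neg_one] at hv
    have : (torus (2 * Real.pi)).1 = -1 := by
      rw [torus_coe]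
      ext i j
      fin_cases i <;> fin_cases j <;>
        simp [mul_comm Complex.I, mul_div_right_comm, Complex.exp_neg]
    rw [hv, Submonoid.coe_mul, Submonoid.coe_mul, this, Matrix.mul_neg, Matrix.mul_one,
      Matrix.neg_mul, coe_mul_inv]
  · refine lt_of_le_of_ne (by nlinarith) fun h1 => u.2.1 ?_
    rw [h1, Real.arccos_one, mul_zero, torus_zero, mul_one, mul_inv_cancel] at hv
    rw [hv]; rfl

theorem arccos_P0_mem (u : S3NS) : 0 < Real.arccos (P0 u.1) ∧ Real.arccos (P0 u.1) < Real.pi := by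
  obtain ⟨h1, h2⟩ := P0_lt_one u
  exact ⟨Real.arccos_pos.2 h2, (Real.arccos_lt_pi).2 h1⟩

theorem sqrt_P0_pos (u : S3NS) : 0 < √(1 - P0 u.1 ^ 2) := by
  obtain ⟨h1, h2⟩ := P0_lt_one u
  exact Real.sqrt_pos.2 (by nlinarith)

theorem existsUnique_conjClass {lam : ℝ} (hlam : 0 < lam) (u : S3NS) :
    ∃! m' : ℝ, 0 < m' ∧ m' < 2 * Real.pi / lam ∧ u.1 ∈ conjClass lam m' := by
  obtain ⟨h1, h2⟩ := arccos_P0_mem u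
  have hsq := P0_sq_le_one u.1
  have hcos : Real.cos (Real.arccos (P0 u.1)) = P0 u.1 :=
    Real.cos_arccos (by nlinarith) (by nlinarith)
  -- The half angle `m' * lam / 2` has to equal `arccos (P0 u)`.
  refine ⟨2 * Real.arccos (P0 u.1) / lam, ⟨by positivity, by gcongr, ?_⟩, ?_⟩
  · rw [mem_conjClass_iff hlam (by positivity) (by gcongr), ← hcos]
    congr 1
    rw [hcos]
    field_simp
  · rintro y ⟨hy1, hy2, hy⟩
    obtain ⟨h3, h4⟩ := half_angle_mem hlam hy1 hy2
    rw [mem_conjClass_iff hlam hy1 hy2] at hy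
    rw [hy, Real.arccos_cos h3.le h4.le]
    field_simp

theorem sum_sq_P {lam : ℝ} (hlam : lam ≠ 0) (u : SU2) :
    ∑ a, P lam u a ^ 2 = 4 / lam ^ 2 * (1 - P0 u ^ 2) := by
  have h := coord_sphere hlam u
  field_simp
  linarith

theorem sum_sq_lieCoord {lam : ℝ} (hlam : 0 < lam) (u : S3NS) :
    ∑ a, lieCoord lam u.1 a ^ 2 = (2 * Real.arccos (P0 u.1) / lam) ^ 2 := by
  have hs := sqrt_P0_pos u
  have hs2 : √(1 - P0 u.1 ^ 2) ^ 2 = 1 - P0 u.1 ^ 2 :=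
    Real.sq_sqrt (by have := P0_sq_le_one u.1; linarith)
  simp only [lieCoord, mul_pow, ← Finset.mul_sum]
  rw [sum_sq_P hlam.ne', div_pow, hs2]
  have : 1 - P0 u.1 ^ 2 ≠ 0 := by rw [← hs2]; positivity
  field_simp
  ring

theorem sum_sq_lieCoord_lt {lam : ℝ} (hlam : 0 < lam) (u : S3NS) :
    ∑ a, lieCoord lam u.1 a ^ 2 < (2 * Real.pi / lam) ^ 2 := by
  obtain ⟨h1, h2⟩ := arccos_P0_mem u
  rw [sum_sq_lieCoord hlam]
  gcongr

theorem mem_conjClass_iff_lieCoord {lam m : ℝ} (hlam : 0 < lam) (hm : 0 < m)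
    (hm' : m < 2 * Real.pi / lam) (u : S3NS) :
    u.1 ∈ conjClass lam m ↔ ∑ a, lieCoord lam u.1 a ^ 2 = m ^ 2 := by
  obtain ⟨h1, h2⟩ := arccos_P0_mem u
  obtain ⟨h3, h4⟩ := half_angle_mem hlam hm hm'
  have hsq := P0_sq_le_one u.1
  rw [mem_conjClass_iff hlam hm hm', sum_sq_lieCoord hlam, sq_eq_sq₀ (by positivity) hm.le]
  constructor
  · intro h
    rw [h, Real.arccos_cos h3.le h4.le]
    field_simp
  · intro h
    rw [← h, ← Real.cos_arccos (x := P0 u.1) (by nlinarith) (by nlinarith)]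
    congr 1
    rw [Real.cos_arccos (by nlinarith) (by nlinarith)]
    field_simp

theorem slash_smul (c : ℂ) (v : Fin 3 → ℂ) : slash (c • v) = c • slash v := by
  simp [slash, Finset.smul_sum, smul_smul]

theorem slash_add (v w : Fin 3 → ℂ) : slash (v + w) = slash v + slash w := by
  simp [slash, add_smul, Finset.sum_add_distrib]

/-- The traceless part of `u` is conjugate to `i sin θ diag(1, -1)`, and the factor `θ / sin θ` in
`lieCoord` rescales it to a logarithm. Conjugation commutes with the exponential, so the identity
reduces to diagonal matrices. -/
theorem coe_eq_exp_lieCoord {lam : ℝ} (hlam : 0 < lam) (u : S3NS) :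
    (u.1 : Matrix (Fin 2) (Fin 2) ℂ) = NormedSpace.exp
        ((Complex.I * lam / 2) • slash fun a => (lieCoord lam u.1 a : ℂ)) := by
  obtain ⟨v, hv⟩ := exists_eq_conj_torus u.1
  have hs := sqrt_P0_pos u
  set θ := Real.arccos (P0 u.1) with hθ
  have hsin : √(1 - P0 u.1 ^ 2) = Real.sin θ := (Real.sin_arccos _).symm
  have hsq := P0_sq_le_one u.1
  have hcos : P0 u.1 = Real.cos θ := (Real.cos_arccos (by nlinarith) (by nlinarith)).symm
  have hsin0 : (Real.sin θ : ℂ) ≠ 0 := by rw [← hsin]; exact_mod_cast hs.ne'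
  set D : Matrix (Fin 2) (Fin 2) ℂ := Matrix.diagonal ![Complex.I * θ, -(Complex.I * θ)] with hD
  have hexp : NormedSpace.exp D = (torus (2 * θ)).1 := by
    rw [hD, Matrix.exp_diagonal, torus_coe]
    congr 1
    ext i
    rw [Pi.coe_exp]
    fin_cases i <;> simp [← Complex.exp_eq_exp_ℂ] <;> congr 1 <;> ring
  have hlie : (fun a => (lieCoord lam u.1 a : ℂ)) = ((θ / Real.sin θ : ℝ) : ℂ) • Pvec lam u.1 := by
    ext a
    simp [lieCoord, Pvec, ← hθ, hsin]
  have hsl : (Complex.I * lam / 2) • slash (fun a => (lieCoord lam u.1 a : ℂ)) =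
      v.1 * D * ((v⁻¹ : SU2) : Matrix _ _ ℂ) := by
    have h1 : (Complex.I * lam / 2) • slash (Pvec lam u.1) =
        v.1 * ((torus (2 * θ)).1 - (P0 u.1 : ℂ) • 1) * ((v⁻¹ : SU2) : Matrix _ _ ℂ) := by
      rw [Matrix.mul_sub, Matrix.sub_mul, ← Submonoid.coe_mul, ← Submonoid.coe_mul, ← hv,
        Matrix.mul_smul, Matrix.mul_one, Matrix.smul_mul, coe_mul_inv]
      exact eq_sub_of_add_eq' (coe_eq_coord hlam.ne' u.1).symm
    have h2 : ((θ / Real.sin θ : ℝ) : ℂ) • ((torus (2 * θ)).1 - (P0 u.1 : ℂ) • 1) = D := by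
      have e1 : Complex.exp (Complex.I * (2 * θ) / 2) =
          Real.cos θ + Real.sin θ * Complex.I := by
        rw [Complex.ofReal_cos, Complex.ofReal_sin, ← Complex.exp_mul_I]; congr 1; ring
      have e2 : Complex.exp (-(Complex.I * (2 * θ) / 2)) =
          Real.cos θ - Real.sin θ * Complex.I := by
        have := Complex.exp_mul_I (-θ)
        rw [Complex.cos_neg, Complex.sin_neg] at this
        rw [Complex.ofReal_cos, Complex.ofReal_sin, sub_eq_add_neg, ← neg_mul, ← this]; congr 1; ring
      rw [torus_coe, hD, hcos]
      ext i j
      fin_cases i <;> fin_cases j <;> simp [-Complex.ofReal_cos, -Complex.ofReal_sin, e1, e2]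
      · field_simp
      · field_simp
    rw [hlie, slash_smul, smul_comm, h1, ← h2, Matrix.mul_smul, Matrix.smul_mul]
  have hinv : ((v⁻¹ : SU2) : Matrix (Fin 2) (Fin 2) ℂ) = (v.1)⁻¹ :=
    (Matrix.inv_eq_right_inv (coe_mul_inv v)).symm
  have hunit : IsUnit v.1 := (Matrix.isUnit_iff_isUnit_det _).2 (by rw [det_coe]; exact isUnit_one)
  rw [hsl, hinv, Matrix.exp_conj _ _ hunit, hexp, ← hinv, ← Submonoid.coe_mul, ← Submonoid.coe_mul,
    ← hv]

/-! ### The spin representations -/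

/-- The coherent vector `(w₀ X + w₁ Y)^n` in the weight basis. -/
def coherent (n : ℕ) (w : Fin 2 → ℂ) : Fin (n + 1) → ℂ :=
  fun k => ((√(n.choose k) : ℝ) : ℂ) * w 0 ^ (n - (k : ℕ)) * w 1 ^ (k : ℕ)

theorem sqrt_choose_ne_zero (n : ℕ) (k : Fin (n + 1)) : ((√(n.choose k) : ℝ) : ℂ) ≠ 0 := by
  have : 0 < n.choose k := Nat.choose_pos (Nat.lt_succ_iff.1 k.2)
  have h : 0 < √((n.choose k : ℕ) : ℝ) := Real.sqrt_pos.2 (by exact_mod_cast this)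
  exact_mod_cast h.ne'

theorem sqrt_choose_mul_self (n : ℕ) (k : ℕ) :
    ((√(n.choose k) : ℝ) : ℂ) * ((√(n.choose k) : ℝ) : ℂ) = n.choose k := by
  rw [← Complex.ofReal_mul, Real.mul_self_sqrt (by positivity)]
  simp

/-- Substitution in a homogeneous polynomial sends the `n`-th power of a linear form to the `n`-th
power of the transformed form. The square roots of binomials are the ones that express such a power
in the orthonormal basis. -/
theorem rho_mulVec_coherent (n : ℕ) (g : SU2) (w : Fin 2 → ℂ) :
    rho n g *ᵥ coherent n w = coherent n (g.1 *ᵥ w) := by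
  ext l
  set p : Polynomial ℂ := Polynomial.C (g.1 0 0) + Polynomial.C (g.1 1 0) * Polynomial.X with hp
  set q : Polynomial ℂ := Polynomial.C (g.1 0 1) + Polynomial.C (g.1 1 1) * Polynomial.X with hq
  have hl : (l : ℕ) ≤ n := Nat.lt_succ_iff.1 l.2
  have key : (Polynomial.C (w 0) * p + Polynomial.C (w 1) * q) ^ n =
      (Polynomial.C ((g.1 *ᵥ w) 1) * Polynomial.X + Polynomial.C ((g.1 *ᵥ w) 0)) ^ n := by
    congr 1
    rw [hp, hq]
    simp [Matrix.mulVec, dotProduct, Fin.sum_univ_two]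
    ring
  have h1 : ((Polynomial.C (w 0) * p + Polynomial.C (w 1) * q) ^ n).coeff l =
      ∑ k ∈ Finset.range (n + 1), (n.choose k : ℂ) * w 0 ^ (n - k) * w 1 ^ k *
        (p ^ (n - k) * q ^ k).coeff l := by
    rw [add_comm, add_pow, Polynomial.finsetSum_coeff]
    refine Finset.sum_congr rfl fun k _ => ?_
    have : (Polynomial.C (w 1) * q) ^ k * (Polynomial.C (w 0) * p) ^ (n - k) * (n.choose k : Polynomial ℂ)
        = Polynomial.C ((n.choose k : ℂ) * w 0 ^ (n - k) * w 1 ^ k) * (p ^ (n - k) * q ^ k) := by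
      simp only [map_mul, map_pow, mul_pow, map_natCast]
      ring
    rw [this, Polynomial.coeff_C_mul]
  have h2 : ((Polynomial.C ((g.1 *ᵥ w) 1) * Polynomial.X + Polynomial.C ((g.1 *ᵥ w) 0)) ^ n).coeff l
      = (n.choose l : ℂ) * (g.1 *ᵥ w) 0 ^ (n - (l : ℕ)) * (g.1 *ᵥ w) 1 ^ (l : ℕ) := by
    rw [add_pow, Polynomial.finsetSum_coeff, Finset.sum_eq_single (l : ℕ)]
    · have : (Polynomial.C ((g.1 *ᵥ w) 1) * Polynomial.X) ^ (l : ℕ) *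
          Polynomial.C ((g.1 *ᵥ w) 0) ^ (n - (l : ℕ)) * (n.choose l : Polynomial ℂ) =
          Polynomial.C ((n.choose l : ℂ) * (g.1 *ᵥ w) 0 ^ (n - (l : ℕ)) * (g.1 *ᵥ w) 1 ^ (l : ℕ)) *
            Polynomial.X ^ (l : ℕ) := by
        simp only [map_mul, map_pow, mul_pow, map_natCast]
        ring
      rw [this, Polynomial.coeff_C_mul_X_pow, if_pos rfl]
    · intro k _ hk
      have : (Polynomial.C ((g.1 *ᵥ w) 1) * Polynomial.X) ^ k *
          Polynomial.C ((g.1 *ᵥ w) 0) ^ (n - k) * (n.choose k : Polynomial ℂ) =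
          Polynomial.C ((n.choose k : ℂ) * (g.1 *ᵥ w) 0 ^ (n - k) * (g.1 *ᵥ w) 1 ^ k) *
            Polynomial.X ^ k := by
        simp only [map_mul, map_pow, mul_pow, map_natCast]
        ring
      rw [this, Polynomial.coeff_C_mul_X_pow, if_neg (Ne.symm hk)]
    · intro h
      exact absurd (Finset.mem_range.2 (Nat.lt_succ_of_le hl)) h
  have h3 := sqrt_choose_mul_self n l
  have h4 := sqrt_choose_ne_zero n l
  simp only [Matrix.mulVec, dotProduct, coherent] at *
  -- Multiplication by the nonzero `√(n choose l)` clears the denominator in `rho`, leaving integral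
  -- binomial coefficients on both sides.
  rw [← mul_right_inj' h4, Finset.mul_sum]
  calc _ = ∑ k : Fin (n + 1), (n.choose k : ℂ) * w 0 ^ (n - (k : ℕ)) * w 1 ^ (k : ℕ) *
        (p ^ (n - (k : ℕ)) * q ^ (k : ℕ)).coeff l := by
        refine Finset.sum_congr rfl fun k _ => ?_
        rw [rho, Matrix.of_apply, ← sqrt_choose_mul_self n k]
        push_cast
        rw [← hp, ← hq]
        field_simp
    _ = _ := by
        rw [Fin.sum_univ_eq_sum_range (fun k => (n.choose k : ℂ) * w 0 ^ (n - k) * w 1 ^ k *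
          (p ^ (n - k) * q ^ k).coeff l), ← h1, key, h2, ← h3]
        ring

/-- The pairing is a polynomial in `b` whose coefficients are nonzero multiples of the entries of
`x`; if it vanishes for all `b`, it is the zero polynomial. -/
theorem eq_zero_of_dotProduct_coherent {n : ℕ} (x : Fin (n + 1) → ℂ)
    (h : ∀ b : ℂ, x ⬝ᵥ coherent n ![1, b] = 0) : x = 0 := by
  have hp : (∑ k : Fin (n + 1), Polynomial.C (x k * ((√(n.choose k) : ℝ) : ℂ)) *
      Polynomial.X ^ (k : ℕ) : Polynomial ℂ) = 0 := by
    refine Polynomial.funext fun b => ?_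
    rw [Polynomial.eval_zero, ← h b, Polynomial.eval_finsetSum]
    refine Finset.sum_congr rfl fun k _ => ?_
    simp [coherent, mul_assoc]
  ext k
  have hk := congrArg (fun r => Polynomial.coeff r (k : ℕ)) hp
  simp only [Polynomial.finsetSum_coeff, Polynomial.coeff_C_mul_X_pow, Polynomial.coeff_zero] at hk
  rw [Finset.sum_eq_single k] at hk
  · simpa [sqrt_choose_ne_zero n k] using hk
  · intro j _ hj
    rw [if_neg fun h => hj (Fin.ext h.symm)]
  · simp

/-- Coherent vectors span, so identities between the matrices `rho n` reduce to identities in the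
defining representation. -/
theorem ext_coherent {n : ℕ} {A B : Matrix (Fin (n + 1)) (Fin (n + 1)) ℂ}
    (h : ∀ w, A *ᵥ coherent n w = B *ᵥ coherent n w) : A = B := by
  rw [← sub_eq_zero]
  ext i j
  refine congrFun (eq_zero_of_dotProduct_coherent ((A - B) i) fun b => ?_) j
  have := congrFun (h ![1, b]) i
  change ((A - B) *ᵥ coherent n ![1, b]) i = 0
  rw [Matrix.sub_mulVec, Pi.sub_apply, this, sub_self]

theorem rho_mul (n : ℕ) (g h : SU2) : rho n (g * h) = rho n g * rho n h := by
  refine ext_coherent fun w => ?_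
  rw [← Matrix.mulVec_mulVec]
  simp only [rho_mulVec_coherent, Matrix.mulVec_mulVec, Submonoid.coe_mul]

theorem rho_one (n : ℕ) : rho n 1 = 1 := by
  refine ext_coherent fun w => ?_
  rw [rho_mulVec_coherent, Submonoid.coe_one, Matrix.one_mulVec, Matrix.one_mulVec]

/-- This is the binomial theorem; the square roots of binomials are the normalisation that makes it
hold. -/
theorem star_coherent_dotProduct (n : ℕ) (w z : Fin 2 → ℂ) :
    star (coherent n w) ⬝ᵥ coherent n z = (star w ⬝ᵥ z) ^ n := by
  rw [dotProduct, dotProduct, Fin.sum_univ_two, add_comm (star w 0 * z 0), add_pow, Finset.sum_range]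
  refine Finset.sum_congr rfl fun k _ => ?_
  simp only [coherent, Pi.star_apply, star_mul', star_pow, RCLike.star_def, Complex.conj_ofReal,
    mul_pow, ← sqrt_choose_mul_self n k]
  ring

theorem star_mulVec_dotProduct {k : ℕ} (A : Matrix (Fin k) (Fin k) ℂ) (x y : Fin k → ℂ) :
    star (A *ᵥ x) ⬝ᵥ y = star x ⬝ᵥ (Aᴴ *ᵥ y) := by
  rw [Matrix.star_mulVec, Matrix.dotProduct_mulVec]

/-- Between coherent vectors, both sides have as matrix element the `n`-th power of the
corresponding matrix element of `g⁻¹`, because `g` is unitary. -/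
theorem rho_conjTranspose (n : ℕ) (g : SU2) : (rho n g)ᴴ = rho n g⁻¹ := by
  refine ext_coherent fun z => ?_
  -- The criterion `eq_zero_of_dotProduct_coherent` uses a bilinear pairing, so it is applied to the
  -- conjugate of the difference in order to meet the sesquilinear identity.
  rw [← sub_eq_zero, ← star_eq_zero]
  refine eq_zero_of_dotProduct_coherent _ fun b => ?_
  set w : Fin 2 → ℂ := ![1, b]
  rw [star_sub, sub_dotProduct, sub_eq_zero, star_mulVec_dotProduct, Matrix.conjTranspose_conjTranspose,
    rho_mulVec_coherent, rho_mulVec_coherent, star_coherent_dotProduct, star_coherent_dotProduct,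
    star_mulVec_dotProduct, coe_inv_eq_star, Matrix.star_eq_conjTranspose,
    Matrix.conjTranspose_conjTranspose]

theorem spin_apply (n : ℕ) (g : SU2) (x : E n) : (spin n g x).ofLp = rho n g *ᵥ x.ofLp := rfl

theorem spin_mul (n : ℕ) (g h : SU2) (x : E n) : spin n (g * h) x = spin n g (spin n h x) := by
  apply WithLp.ofLp_injective
  simp [spin_apply, rho_mul]

theorem spin_one (n : ℕ) (x : E n) : spin n 1 x = x := by
  apply WithLp.ofLp_injective
  simp [spin_apply, rho_one]

theorem spin_inv_spin (n : ℕ) (g : SU2) (x : E n) : spin n g⁻¹ (spin n g x) = x := by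
  rw [← spin_mul, inv_mul_cancel, spin_one]

theorem spin_spin_inv (n : ℕ) (g : SU2) (x : E n) : spin n g (spin n g⁻¹ x) = x := by
  rw [← spin_mul, mul_inv_cancel, spin_one]

theorem inner_spin_left (n : ℕ) (g : SU2) (x y : E n) :
    inner ℂ (spin n g x) y = inner ℂ x (spin n g⁻¹ y) := by
  rw [EuclideanSpace.inner_eq_star_dotProduct, EuclideanSpace.inner_eq_star_dotProduct,
    spin_apply, spin_apply, ← rho_conjTranspose, dotProduct_comm, star_mulVec_dotProduct,
    dotProduct_comm]

theorem inner_spin_spin (n : ℕ) (g : SU2) (x y : E n) :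
    inner ℂ (spin n g x) (spin n g y) = inner ℂ x y := by
  rw [inner_spin_left, spin_inv_spin]

theorem norm_spin (n : ℕ) (g : SU2) (x : E n) : ‖spin n g x‖ = ‖x‖ := by
  rw [@norm_eq_sqrt_re_inner ℂ, inner_spin_spin, ← @norm_eq_sqrt_re_inner ℂ]

theorem norm_lowest (n : ℕ) : ‖lowest n‖ = 1 := by simp [lowest]

theorem inner_lowest (n : ℕ) : inner ℂ (lowest n) (lowest n) = (1 : ℂ) := by
  rw [inner_self_eq_norm_sq_to_K, norm_lowest]; simp

theorem continuous_coeff_mul {X : Type*} [TopologicalSpace X] {p q : X → Polynomial ℂ}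
    (hp : ∀ l, Continuous fun x => (p x).coeff l) (hq : ∀ l, Continuous fun x => (q x).coeff l)
    (l : ℕ) : Continuous fun x => (p x * q x).coeff l := by
  simp only [Polynomial.coeff_mul]
  exact continuous_finsetSum _ fun i _ => (hp i.1).mul (hq i.2)

theorem continuous_coeff_pow {X : Type*} [TopologicalSpace X] {p : X → Polynomial ℂ}
    (hp : ∀ l, Continuous fun x => (p x).coeff l) (k l : ℕ) :
    Continuous fun x => (p x ^ k).coeff l := by
  induction k generalizing l with
  | zero => simp only [pow_zero]; exact continuous_const
  | succ k ih => simp only [pow_succ]; exact continuous_coeff_mul ih hp l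

theorem continuous_entry (i j : Fin 2) : Continuous fun g : SU2 => g.1 i j :=
  (continuous_subtype_val : Continuous fun g : SU2 => g.1).matrix_elem i j

theorem continuous_coeff_linear (i j k l : Fin 2) (d : ℕ) : Continuous fun g : SU2 =>
    (Polynomial.C (g.1 i j) + Polynomial.C (g.1 k l) * Polynomial.X : Polynomial ℂ).coeff d := by
  simp only [Polynomial.coeff_add, Polynomial.coeff_C_mul, Polynomial.coeff_C, Polynomial.coeff_X]
  refine Continuous.add ?_ ((continuous_entry k l).mul continuous_const)
  split_ifs
  · exact continuous_entry i j
  · exact continuous_const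

theorem continuous_rho (n : ℕ) : Continuous (rho n) := by
  refine continuous_matrix fun l k => ?_
  exact continuous_const.mul (continuous_coeff_mul
    (continuous_coeff_pow (continuous_coeff_linear 0 0 1 0) _)
    (continuous_coeff_pow (continuous_coeff_linear 0 1 1 1) _) _)

theorem continuous_spin (n : ℕ) : Continuous fun p : SU2 × E n => spin n p.1 p.2 := by
  refine (PiLp.continuous_toLp 2 _).comp (f := fun p : SU2 × E n => rho n p.1 *ᵥ p.2.ofLp) ?_
  exact Continuous.matrix_mulVec ((continuous_rho n).comp continuous_fst)
    ((PiLp.continuous_ofLp 2 _).comp continuous_snd)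

theorem rho_torus (n : ℕ) (α : ℝ) : rho n (torus α) = Matrix.diagonal fun k : Fin (n + 1) =>
    Complex.exp (Complex.I * α * (n / 2 - (k : ℕ))) := by
  refine ext_coherent fun w => ?_
  rw [rho_mulVec_coherent]
  ext k
  have hk : (k : ℕ) ≤ n := Nat.lt_succ_iff.1 k.2
  rw [Matrix.mulVec_diagonal]
  simp only [coherent, torus_coe, Matrix.mulVec_diagonal, mul_pow, ← Complex.exp_nat_mul,
    Matrix.cons_val_zero, Matrix.cons_val_one]
  have : Complex.exp (Complex.I * α * (n / 2 - (k : ℕ))) =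
      Complex.exp (((n - (k : ℕ) : ℕ) : ℂ) * (Complex.I * α / 2)) *
        Complex.exp (((k : ℕ) : ℂ) * -(Complex.I * α / 2)) := by
    rw [← Complex.exp_add, Nat.cast_sub hk]
    congr 1
    ring
  rw [this]
  ring

theorem spin_torus_apply (n : ℕ) (α : ℝ) (x : E n) (k : Fin (n + 1)) :
    spin n (torus α) x k = Complex.exp (Complex.I * α * (n / 2 - (k : ℕ))) * x k := by
  rw [spin_apply, rho_torus, Matrix.mulVec_diagonal]

/-- The phase is inverse to the one that defines `V n`, so the product of a section with the
translated lowest weight vector is constant on torus cosets. -/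
theorem spin_torus_lowest (n : ℕ) (α : ℝ) :
    spin n (torus α) (lowest n) = Complex.exp (-(Complex.I * (n / 2) * α)) • lowest n := by
  ext k
  rw [spin_torus_apply, PiLp.smul_apply, lowest, smul_eq_mul]
  by_cases hk : k = Fin.last n
  · subst hk
    congr 2
    simp
    ring
  · simp [hk]

theorem rho_one_eq (g : SU2) : rho 1 g = g.1 := by
  ext l k
  fin_cases l <;> fin_cases k <;> simp [rho, Polynomial.coeff_X, Polynomial.coeff_C]

theorem rho_two_eq (g : SU2) : rho 2 g =
    !![g.1 0 0 ^ 2, √2 * (g.1 0 0 * g.1 0 1), g.1 0 1 ^ 2;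
      √2 * (g.1 0 0 * g.1 1 0), g.1 0 0 * g.1 1 1 + g.1 0 1 * g.1 1 0, √2 * (g.1 0 1 * g.1 1 1);
      g.1 1 0 ^ 2, √2 * (g.1 1 0 * g.1 1 1), g.1 1 1 ^ 2] := by
  have hs : ((√2 : ℝ) : ℂ) * ((√2 : ℝ) : ℂ) = 2 := by
    rw [← Complex.ofReal_mul, Real.mul_self_sqrt (by norm_num)]; norm_num
  have hc : ∀ w, coherent 2 w = ![w 0 ^ 2, √2 * (w 0 * w 1), w 1 ^ 2] := by
    intro w
    ext k
    fin_cases k <;> simp [coherent, mul_assoc]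
  refine ext_coherent fun w => ?_
  rw [rho_mulVec_coherent, hc, hc]
  ext k
  fin_cases k <;> simp [Matrix.mulVec, dotProduct, Fin.sum_univ_two, Fin.sum_univ_three]
  · linear_combination -(g.1 0 0 * g.1 0 1 * w 0 * w 1) * hs
  · ring
  · linear_combination -(g.1 1 0 * g.1 1 1 * w 0 * w 1) * hs

/-! ### The constraint in momentum space -/

theorem slash_mul_slash (a b : Fin 3 → ℂ) :
    slash a * slash b = (a ⬝ᵥ b) • 1 + Complex.I • slash (crossProduct a b) := by
  have hI := Complex.I_mul_I
  rw [slash_apply, slash_apply, slash_apply, cross_apply]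
  ext i j
  fin_cases i <;> fin_cases j <;>
    simp [Matrix.mul_apply, Fin.sum_univ_two, dotProduct, Fin.sum_univ_three]
  · linear_combination -(a 1 * b 1) * hI
  · linear_combination (a 2 * b 0 - a 0 * b 2) * hI
  · linear_combination (a 0 * b 2 - a 2 * b 0) * hI
  · linear_combination -(a 1 * b 1) * hI

theorem slash_injective : Function.Injective slash := by
  intro v w h
  rw [slash_apply, slash_apply] at h
  have h2 := congrFun (congrFun h 0) 0
  have h01 := congrFun (congrFun h 0) 1
  have h10 := congrFun (congrFun h 1) 0
  simp at h2 h01 h10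
  have hI := Complex.I_mul_I
  ext a
  fin_cases a
  · change v 0 = w 0
    linear_combination (h01 + h10) / 2
  · change v 1 = w 1
    linear_combination Complex.I / 2 * (h01 - h10) + (v 1 - w 1) * hI
  · exact h2

theorem slash_zero : slash 0 = 0 := by simp [slash]

theorem exists_slash_eq (A : Matrix (Fin 2) (Fin 2) ℂ) (hA : A.trace = 0) : ∃ v, slash v = A := by
  rw [Matrix.trace_fin_two] at hA
  have hI := Complex.I_mul_I
  refine ⟨![(A 0 1 + A 1 0) / 2, Complex.I * (A 0 1 - A 1 0) / 2, A 0 0], ?_⟩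
  rw [slash_apply]
  ext i j
  fin_cases i <;> fin_cases j <;> simp
  · linear_combination -(A 0 1 - A 1 0) / 2 * hI
  · linear_combination (A 0 1 - A 1 0) / 2 * hI
  · linear_combination -hA

theorem trace_slash (v : Fin 3 → ℂ) : (slash v).trace = 0 := by
  rw [slash_apply, Matrix.trace_fin_two]; simp

theorem cartToWeight_mem_unitaryGroup : cartToWeight ∈ Matrix.unitaryGroup (Fin 3) ℂ := by
  have hs : ((√2 : ℝ) : ℂ) * ((√2 : ℝ) : ℂ) = 2 := by
    rw [← Complex.ofReal_mul, Real.mul_self_sqrt (by norm_num)]; norm_num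
  have hs0 : ((√2 : ℝ) : ℂ) ≠ 0 := fun h => by rw [h] at hs; norm_num at hs
  have hI := Complex.I_sq
  rw [Matrix.mem_unitaryGroup_iff]
  ext i j
  fin_cases i <;> fin_cases j <;>
    simp [cartToWeight, Matrix.mul_apply, Fin.sum_univ_three] <;>
    field_simp <;> simp [hI, sq, hs] <;> norm_num

/-- With the adjugate in place of the inverse, conjugation of `z · σ` is quadratic in the entries of
`u` and can be matched row by row with the explicit form of `rho 2 u`. This justifies Cartesian
components for spin 1. -/
theorem rho_two_cartToWeight (u : SU2) (y z : Fin 3 → ℂ)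
    (h : slash y = (u : Matrix (Fin 2) (Fin 2) ℂ) * slash z * ((u⁻¹ : SU2) : Matrix _ _ ℂ)) :
    rho 2 u *ᵥ (cartToWeight *ᵥ z) = cartToWeight *ᵥ y := by
  have hs : ((√2 : ℝ) : ℂ) * ((√2 : ℝ) : ℂ) = 2 := by
    rw [← Complex.ofReal_mul, Real.mul_self_sqrt (by norm_num)]; norm_num
  have hs0 : ((√2 : ℝ) : ℂ) ≠ 0 := fun h => by rw [h] at hs; norm_num at hs
  have hd := det_coe u
  rw [Matrix.det_fin_two] at hd
  rw [coe_inv_eq_adjugate, slash_apply, slash_apply, Matrix.adjugate_fin_two] at h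
  have h2 := congrFun (congrFun h 0) 0
  have h01 := congrFun (congrFun h 0) 1
  have h10 := congrFun (congrFun h 1) 0
  simp [Matrix.mul_apply, Fin.sum_univ_two] at h2 h01 h10
  rw [rho_two_eq]
  ext k
  fin_cases k <;>
    simp [cartToWeight, Matrix.mulVec, dotProduct, Fin.sum_univ_three]
  · field_simp
    linear_combination -h01 - u.1 0 0 * u.1 0 1 * z 2 * hs
  · field_simp
    linear_combination h2
  · field_simp
    linear_combination h10 - u.1 1 0 * u.1 1 1 * z 2 * hs

theorem cartToWeight_mulVec_star (x : Fin 3 → ℂ) :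
    cartToWeight *ᵥ (star cartToWeight *ᵥ x) = x := by
  rw [Matrix.mulVec_mulVec, Matrix.mem_unitaryGroup_iff.1 cartToWeight_mem_unitaryGroup,
    Matrix.one_mulVec]

theorem cartToWeight_injective : Function.Injective fun z => cartToWeight *ᵥ z := by
  intro y z h
  have := congrArg (fun x => star cartToWeight *ᵥ x) h
  simpa only [Matrix.mulVec_mulVec, Matrix.mem_unitaryGroup_iff'.1 cartToWeight_mem_unitaryGroup,
    Matrix.one_mulVec] using this

/-- The phase of the constraint in terms of the half angle. -/
theorem exp_half_angle (lam m : ℝ) : Complex.exp (-(Complex.I * m * lam / 2)) =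
    (Real.cos (m * lam / 2) : ℂ) - Complex.I * (Real.sin (m * lam / 2) : ℂ) := by
  have h := Complex.exp_mul_I (-((m * lam / 2 : ℝ) : ℂ))
  rw [Complex.cos_neg, Complex.sin_neg, ← Complex.ofReal_cos, ← Complex.ofReal_sin] at h
  rw [show -(Complex.I * m * lam / 2) = -((m * lam / 2 : ℝ) : ℂ) * Complex.I by push_cast; ring, h]
  ring

theorem exp_angle (lam m : ℝ) : Complex.exp (-(Complex.I * m * lam)) =
    ((Real.cos (m * lam / 2) : ℂ) - Complex.I * (Real.sin (m * lam / 2) : ℂ)) ^ 2 := by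
  rw [← exp_half_angle, ← Complex.exp_nat_mul]
  congr 1
  push_cast
  ring

theorem cos_sq_add_sin_sq_coe (x : ℝ) : (Real.cos x : ℂ) ^ 2 + (Real.sin x : ℂ) ^ 2 = 1 := by
  exact_mod_cast Real.cos_sq_add_sin_sq x

theorem sin_half_angle_pos {lam m : ℝ} (hlam : 0 < lam) (hm : 0 < m)
    (hm' : m < 2 * Real.pi / lam) : 0 < Real.sin (m * lam / 2) := by
  obtain ⟨h1, h2⟩ := half_angle_mem hlam hm hm'
  exact Real.sin_pos_of_pos_of_lt_pi h1 h2

theorem cos_half_angle_ne_zero {lam m : ℝ} (hlam : 0 < lam) (hm : 0 < m)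
    (hm' : m < 2 * Real.pi / lam) (h : m * lam ≠ Real.pi) : Real.cos (m * lam / 2) ≠ 0 := by
  obtain ⟨h1, h2⟩ := half_angle_mem hlam hm hm'
  intro hc
  rw [← Real.cos_pi_div_two] at hc
  have := Real.injOn_cos ⟨h1.le, h2.le⟩ ⟨by positivity, by linarith [Real.pi_pos]⟩ hc
  exact h (by linarith)

theorem half_mul_effMass {lam : ℝ} (hlam : lam ≠ 0) (m : ℝ) :
    (lam : ℂ) / 2 * effMass lam m = Real.sin (m * lam / 2) := by
  have : lam / 2 * effMass lam m = Real.sin (m * lam / 2) := by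
    rw [effMass]; field_simp
  exact_mod_cast this

theorem effMass_ne_zero {lam m : ℝ} (hlam : 0 < lam) (hm : 0 < m)
    (hm' : m < 2 * Real.pi / lam) : effMass lam m ≠ 0 := by
  have := sin_half_angle_pos hlam hm hm'
  rw [effMass]
  positivity

theorem sum_sq_sub_effMass {lam : ℝ} (hlam : lam ≠ 0) (m : ℝ) (u : SU2) :
    ∑ a, P lam u a ^ 2 - effMass lam m ^ 2 =
      4 / lam ^ 2 * (Real.cos (m * lam / 2) ^ 2 - P0 u ^ 2) := by
  rw [sum_sq_P hlam, effMass, Real.cos_sq']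
  field_simp
  ring

theorem shell_iff {lam : ℝ} (hlam : lam ≠ 0) (m : ℝ) (u : SU2) :
    ∑ a, P lam u a ^ 2 - effMass lam m ^ 2 = 0 ↔ P0 u ^ 2 = Real.cos (m * lam / 2) ^ 2 := by
  rw [sum_sq_sub_effMass hlam, mul_eq_zero, or_iff_right (by positivity), sub_eq_zero, eq_comm]

/-- The mass shell only gives `P₀ = ± cos`. In the hemisphere, the minus sign forces the cosine to
vanish, and then both signs agree. -/
theorem P0_eq_of_mem_patch {lam m : ℝ} {u : SU2} (hu : u ∈ patch lam m)
    (h : P0 u ^ 2 = Real.cos (m * lam / 2) ^ 2) : P0 u = Real.cos (m * lam / 2) := by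
  have hu' : 0 ≤ P0 u * Real.cos (m * lam / 2) := hu
  rcases sq_eq_sq_iff_eq_or_eq_neg.1 h with h | h
  · exact h
  · rw [h] at hu' ⊢
    have : Real.cos (m * lam / 2) = 0 := by nlinarith
    rw [this, neg_zero]

theorem scalar_constraint_imp {lam : ℝ} (hlam : lam ≠ 0) (m : ℝ) (u : SU2) (z : ℂ)
    (h : P0 u * z = Real.cos (m * lam / 2) * z) :
    ((∑ a, P lam u a ^ 2 - effMass lam m ^ 2 : ℝ) : ℂ) * z = 0 := by
  rw [sum_sq_sub_effMass hlam]
  push_cast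
  push_cast at h
  linear_combination -4 / (lam : ℂ) ^ 2 * (P0 u + Complex.cos (m * lam / 2)) * h

theorem scalar_constraint_iff {lam : ℝ} (hlam : lam ≠ 0) {m : ℝ} {u : SU2} (hu : u ∈ patch lam m)
    (z : ℂ) : P0 u * z = Real.cos (m * lam / 2) * z ↔
      ((∑ a, P lam u a ^ 2 - effMass lam m ^ 2 : ℝ) : ℂ) * z = 0 := by
  refine ⟨scalar_constraint_imp hlam m u z, fun h => ?_⟩
  rcases mul_eq_zero.1 h with h | h
  · rw [P0_eq_of_mem_patch hu ((shell_iff hlam m u).1 (by exact_mod_cast h))]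
  · simp [h]

theorem constraint_one_iff (lam m : ℝ) (u : SU2) (z : E 1) : Constraint lam m 1 u z ↔
    u.1 *ᵥ z.ofLp = ((Real.cos (m * lam / 2) : ℂ) - Complex.I * (Real.sin (m * lam / 2) : ℂ)) •
      z.ofLp := by
  rw [Constraint, ← exp_half_angle, ← (WithLp.ofLp_injective 2).eq_iff, spin_apply, rho_one_eq,
    WithLp.ofLp_smul]
  simp only [Nat.cast_one, mul_one_div]

theorem det_sub_smul_one (u : SU2) (x : ℂ) : (u.1 - x • 1).det = 1 - 2 * P0 u * x + x ^ 2 := by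
  have h1 := det_coe u
  have h2 := trace_eq_two_P0 u
  rw [Matrix.det_fin_two] at h1 ⊢
  rw [Matrix.trace_fin_two] at h2
  simp
  linear_combination h1 - x * h2

/-- A nonzero solution is an eigenvector of `u`, so the phase is a root of `x² - 2 P₀ x + 1`. The
other root is its conjugate, and the sum of the two is `2 cos`. -/
theorem P0_eq_cos_of_constraint_one {lam m : ℝ} {u : SU2} {z : E 1}
    (h : Constraint lam m 1 u z) (hz : z ≠ 0) : P0 u = Real.cos (m * lam / 2) := by
  rw [constraint_one_iff] at h
  set c := Real.cos (m * lam / 2) with hc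
  set s := Real.sin (m * lam / 2) with hs
  have hcs : (c : ℂ) ^ 2 + (s : ℂ) ^ 2 = 1 := cos_sq_add_sin_sq_coe _
  have hz' : z.ofLp ≠ 0 := fun h0 => hz (WithLp.ofLp_injective 2 h0)
  have hdet := Matrix.exists_mulVec_eq_zero_iff.1
    ⟨z.ofLp, hz', show (u.1 - ((c : ℂ) - Complex.I * s) • 1) *ᵥ z.ofLp = 0 by
      rw [Matrix.sub_mulVec, h, Matrix.smul_mulVec, Matrix.one_mulVec, sub_self]⟩
  rw [det_sub_smul_one] at hdet
  have hI := Complex.I_sq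
  -- The coefficients come from multiplying the characteristic equation by `c + i s`, the inverse of
  -- the eigenvalue `c - i s`, and solving for `P₀`.
  have : (P0 u : ℂ) = c := by
    linear_combination (-((c : ℂ) + Complex.I * s) / 2) * hdet +
      (-P0 u + (c - Complex.I * s) / 2) * hcs + (P0 u - (c - Complex.I * s) / 2) * s ^ 2 * hI
  exact_mod_cast this

theorem slash_Pvec_mulVec {lam : ℝ} (hlam : lam ≠ 0) (u : SU2) (w : Fin 2 → ℂ) :
    u.1 *ᵥ w = (P0 u : ℂ) • w + (Complex.I * lam / 2) • (slash (Pvec lam u) *ᵥ w) := by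
  nth_rewrite 1 [coe_eq_coord hlam u]
  rw [Matrix.add_mulVec, Matrix.smul_mulVec, Matrix.smul_mulVec, Matrix.one_mulVec]

/-- Once `P₀` is the cosine, the scalar parts of `u` and of the phase cancel, and `iλ/2` times the
Dirac operator remains. -/
theorem constraint_one_iff_dirac_of_P0 {lam m : ℝ} (hlam : lam ≠ 0) {u : SU2} (z : E 1)
    (h : P0 u = Real.cos (m * lam / 2)) : Constraint lam m 1 u z ↔
      slash (Pvec lam u) *ᵥ z.ofLp + (effMass lam m : ℂ) • z.ofLp = 0 := by
  have hl : (Complex.I * lam / 2 : ℂ) ≠ 0 := by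
    have : (lam : ℂ) ≠ 0 := by exact_mod_cast hlam
    simp [this]
  have key : u.1 *ᵥ z.ofLp -
      ((Real.cos (m * lam / 2) : ℂ) - Complex.I * (Real.sin (m * lam / 2) : ℂ)) • z.ofLp =
      (Complex.I * lam / 2) •
        (slash (Pvec lam u) *ᵥ z.ofLp + (effMass lam m : ℂ) • z.ofLp) := by
    rw [slash_Pvec_mulVec hlam, h, ← half_mul_effMass hlam]
    module
  rw [constraint_one_iff, ← sub_eq_zero, key, smul_eq_zero, or_iff_right hl]

theorem constraint_one_imp_dirac {lam m : ℝ} (hlam : lam ≠ 0) {u : SU2} {z : E 1}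
    (h : Constraint lam m 1 u z) :
    slash (Pvec lam u) *ᵥ z.ofLp + (effMass lam m : ℂ) • z.ofLp = 0 := by
  by_cases hz : z = 0
  · simp [hz]
  · exact (constraint_one_iff_dirac_of_P0 hlam z (P0_eq_cos_of_constraint_one h hz)).1 h

theorem Pvec_dotProduct_self (lam : ℝ) (u : SU2) :
    Pvec lam u ⬝ᵥ Pvec lam u = ((∑ a, P lam u a ^ 2 : ℝ) : ℂ) := by
  simp [Pvec, dotProduct, sq]

/-- The square of `P · σ` is the scalar `P²`, so applying the Dirac equation twice gives the mass
shell. -/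
theorem shell_of_dirac {lam m : ℝ} {u : SU2} {w : Fin 2 → ℂ}
    (h : slash (Pvec lam u) *ᵥ w + (effMass lam m : ℂ) • w = 0) :
    ((∑ a, P lam u a ^ 2 - effMass lam m ^ 2 : ℝ) : ℂ) • w = 0 := by
  have h1 : slash (Pvec lam u) *ᵥ w = -(effMass lam m : ℂ) • w := by
    rw [neg_smul]; exact eq_neg_of_add_eq_zero_left h
  have h2 : (slash (Pvec lam u) * slash (Pvec lam u)) *ᵥ w =
      -(effMass lam m : ℂ) • -(effMass lam m : ℂ) • w := by
    rw [← Matrix.mulVec_mulVec, h1, Matrix.mulVec_smul, h1]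
  rw [slash_mul_slash, cross_self, slash_zero, smul_zero, add_zero, Matrix.smul_mulVec,
    Matrix.one_mulVec, Pvec_dotProduct_self] at h2
  push_cast at h2 ⊢
  rw [sub_smul, h2]
  module

theorem constraint_one_iff_dirac {lam m : ℝ} (hlam : lam ≠ 0) {u : SU2} (hu : u ∈ patch lam m)
    (z : E 1) : Constraint lam m 1 u z ↔
      slash (Pvec lam u) *ᵥ z.ofLp + (effMass lam m : ℂ) • z.ofLp = 0 := by
  refine ⟨constraint_one_imp_dirac hlam, fun h => ?_⟩
  by_cases hz : z.ofLp = 0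
  · rw [constraint_one_iff, hz]; simp
  · have h1 := (smul_eq_zero.1 (shell_of_dirac h)).resolve_right hz
    exact (constraint_one_iff_dirac_of_P0 hlam z (P0_eq_of_mem_patch hu
      ((shell_iff hlam m u).1 (by exact_mod_cast h1)))).2 h

/-- In Cartesian components spin 1 is conjugation of `z · σ`; multiplying by `u` on the right
removes the inverse and leaves a relation to which Pauli algebra applies directly. -/
theorem cartConstraint_iff (lam m : ℝ) (u : SU2) (z : Fin 3 → ℂ) : CartConstraint lam m u z ↔
    u.1 * slash z = Complex.exp (-(Complex.I * m * lam)) • (slash z * u.1) := by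
  set μ := Complex.exp (-(Complex.I * m * lam)) with hμ
  have hphase : Complex.exp (-(Complex.I * m * lam * (((2 : ℕ) : ℂ) / 2))) = μ := by
    rw [hμ]; congr 1; push_cast; ring
  have e1 : CartConstraint lam m u z ↔
      rho 2 u *ᵥ (cartToWeight *ᵥ z) = cartToWeight *ᵥ (μ • z) := by
    rw [CartConstraint, Constraint, hphase, ← (WithLp.ofLp_injective 2).eq_iff, spin_apply,
      WithLp.ofLp_smul, Matrix.mulVec_smul]
  obtain ⟨y, hy⟩ := exists_slash_eq (u.1 * slash z * ((u⁻¹ : SU2) : Matrix (Fin 2) (Fin 2) ℂ)) (by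
    rw [Matrix.trace_mul_comm, ← Matrix.mul_assoc, coe_inv_mul, Matrix.one_mul, trace_slash])
  rw [e1, rho_two_cartToWeight u y z hy, cartToWeight_injective.eq_iff, ← slash_injective.eq_iff,
    slash_smul, hy]
  constructor
  · intro h
    have := congrArg (fun A => A * u.1) h
    simpa only [Matrix.mul_assoc, coe_inv_mul, Matrix.mul_one, Matrix.smul_mul] using this
  · intro h
    rw [h, Matrix.smul_mul, Matrix.mul_assoc, coe_mul_inv, Matrix.mul_one]

theorem exp_angle_ne_one {lam m : ℝ} (hlam : 0 < lam) (hm : 0 < m) (hm' : m < 2 * Real.pi / lam) :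
    Complex.exp (-(Complex.I * m * lam)) ≠ 1 := by
  intro h
  rw [exp_angle] at h
  have hs := sin_half_angle_pos hlam hm hm'
  have h1 := congrArg Complex.re h
  simp [sq, -Complex.ofReal_cos, -Complex.ofReal_sin] at h1
  nlinarith [Real.sin_sq_add_cos_sq (m * lam / 2)]

theorem trace_coe_mul_slash {lam : ℝ} (hlam : lam ≠ 0) (u : SU2) (z : Fin 3 → ℂ) :
    (u.1 * slash z).trace = Complex.I * lam * (Pvec lam u ⬝ᵥ z) := by
  nth_rewrite 1 [coe_eq_coord hlam u]
  rw [Matrix.add_mul, Matrix.trace_add, Matrix.smul_mul, Matrix.one_mul, Matrix.trace_smul,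
    trace_slash, Matrix.smul_mul, slash_mul_slash, Matrix.trace_smul, Matrix.trace_add,
    Matrix.trace_smul, Matrix.trace_smul, trace_slash, Matrix.trace_one]
  simp
  ring

/-- By cyclicity, the trace of the constraint is `(1 - e^{-imλ}) Tr (u (z · σ)) = 0`. The first
factor is nonzero and the trace is proportional to `P · z`. -/
theorem dotProduct_eq_zero_of_cartConstraint {lam m : ℝ} (hlam : 0 < lam) (hm : 0 < m)
    (hm' : m < 2 * Real.pi / lam) {u : SU2} {z : Fin 3 → ℂ} (h : CartConstraint lam m u z) :
    Pvec lam u ⬝ᵥ z = 0 := by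
  rw [cartConstraint_iff] at h
  have h1 := congrArg Matrix.trace h
  rw [Matrix.trace_smul, Matrix.trace_mul_comm (slash z), trace_coe_mul_slash hlam.ne',
    smul_eq_mul] at h1
  have hl : (lam : ℂ) ≠ 0 := by exact_mod_cast hlam.ne'
  have h2 : (1 - Complex.exp (-(Complex.I * m * lam))) * (Complex.I * lam * (Pvec lam u ⬝ᵥ z)) = 0 := by
    linear_combination h1
  have h3 : 1 - Complex.exp (-(Complex.I * m * lam)) ≠ 0 :=
    sub_ne_zero.2 (exp_angle_ne_one hlam hm hm').symm
  simpa [h3, hl] using h2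

theorem slash_mul_slash_of_dot {a b : Fin 3 → ℂ} (h : a ⬝ᵥ b = 0) :
    slash b * slash a = -(Complex.I • slash (crossProduct a b)) := by
  rw [slash_mul_slash, dotProduct_comm, h, ← cross_anticomm, zero_smul, zero_add,
    ← neg_one_smul ℂ (crossProduct a b), slash_smul]
  module

/-- If `P · z = 0`, the matrices `P · σ` and `z · σ` anticommute, so the scalar part of `u` enters
with `1 - μ` and the vector part with `1 + μ`, where `μ = (c - i s)²`. Both contain the factor `2 (c
- i s)`, and what remains is proportional to `s` and `c` respectively. -/
theorem cartConstraint_iff_of_dot {lam : ℝ} (hlam : lam ≠ 0) (m : ℝ) {u : SU2} {z : Fin 3 → ℂ}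
    (h : Pvec lam u ⬝ᵥ z = 0) : CartConstraint lam m u z ↔
      ((P0 u : ℂ) * Real.sin (m * lam / 2)) • z +
        (Complex.I * lam / 2 * Real.cos (m * lam / 2)) • crossProduct (Pvec lam u) z = 0 := by
  set c := Real.cos (m * lam / 2) with hc
  set s := Real.sin (m * lam / 2) with hs
  have hcs : (c : ℂ) ^ 2 + (s : ℂ) ^ 2 = 1 := cos_sq_add_sin_sq_coe _
  have hI := Complex.I_sq
  -- The common factor to be cancelled is a multiple of a phase, with `c + i s` as the inverse of `c
  -- - i s`.
  have hne : 2 * Complex.I * ((c : ℂ) - Complex.I * s) ≠ 0 := by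
    intro h0
    have h1 : (c : ℂ) - Complex.I * s = 0 := by simpa using h0
    have : ((c : ℂ) - Complex.I * s) * (c + Complex.I * s) = 1 := by
      linear_combination hcs - (s : ℂ) ^ 2 * hI
    rw [h1, zero_mul] at this
    exact zero_ne_one this
  rw [cartConstraint_iff, ← sub_eq_zero]
  have key : u.1 * slash z - Complex.exp (-(Complex.I * m * lam)) • (slash z * u.1) =
      slash ((2 * Complex.I * ((c : ℂ) - Complex.I * s)) • (((P0 u : ℂ) * s) • z +
        (Complex.I * lam / 2 * c) • crossProduct (Pvec lam u) z)) := by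
    have e1 : 1 - ((c : ℂ) - Complex.I * s) ^ 2 = 2 * Complex.I * ((c : ℂ) - Complex.I * s) * s := by
      linear_combination -hcs + (s : ℂ) ^ 2 * hI
    have e2 : 1 + ((c : ℂ) - Complex.I * s) ^ 2 = 2 * ((c : ℂ) - Complex.I * s) * c := by
      linear_combination -hcs + (s : ℂ) ^ 2 * hI
    rw [exp_angle]
    nth_rewrite 1 2 [coe_eq_coord hlam u]
    rw [Matrix.add_mul, Matrix.mul_add, Matrix.smul_mul, Matrix.smul_mul, Matrix.mul_smul,
      Matrix.mul_smul, Matrix.one_mul, Matrix.mul_one, slash_mul_slash_of_dot h, slash_mul_slash, h,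
      slash_smul, slash_add, slash_smul, slash_smul]
    have : ∀ (S T : Matrix (Fin 2) (Fin 2) ℂ), (P0 u : ℂ) • S + (Complex.I * lam / 2) •
        ((0 : ℂ) • 1 + Complex.I • T) - ((c : ℂ) - Complex.I * s) ^ 2 •
        ((P0 u : ℂ) • S + (Complex.I * lam / 2) • (-(Complex.I • T))) =
        (P0 u * (1 - ((c : ℂ) - Complex.I * s) ^ 2)) • S + (Complex.I * lam / 2 * Complex.I *
          (1 + ((c : ℂ) - Complex.I * s) ^ 2)) • T := by
      intro S T
      module
    rw [this, e1, e2]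
    module
  rw [key, ← slash_zero, slash_injective.eq_iff, smul_eq_zero, or_iff_right hne]

theorem cross_cross_of_dot {a b : Fin 3 → ℂ} (h : a ⬝ᵥ b = 0) :
    crossProduct a (crossProduct a b) = -(a ⬝ᵥ a) • b := by
  simp only [dotProduct, Fin.sum_univ_three] at h ⊢
  ext i
  fin_cases i <;> simp [cross_apply]
  · linear_combination a 0 * h
  · linear_combination a 1 * h
  · linear_combination a 2 * h

/-- On vectors orthogonal to `P`, the map `P ×` squares to `-P²`. Crossing the linear relation with
`P` and eliminating `P × z` leaves `(P₀² s² - c² (1 - P₀²)) z = 0`, that is, `P₀² = c²` when `z` is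
nonzero. -/
theorem P0_sq_eq_of_cartConstraint {lam m : ℝ} (hlam : 0 < lam) (hm : 0 < m)
    (hm' : m < 2 * Real.pi / lam) {u : SU2} {z : Fin 3 → ℂ} (h : CartConstraint lam m u z)
    (hz : z ≠ 0) : P0 u ^ 2 = Real.cos (m * lam / 2) ^ 2 := by
  have hdot := dotProduct_eq_zero_of_cartConstraint hlam hm hm' h
  rw [cartConstraint_iff_of_dot hlam.ne' m hdot] at h
  set c := Real.cos (m * lam / 2) with hc
  set s := Real.sin (m * lam / 2) with hs
  have hcs : c ^ 2 + s ^ 2 = 1 := Real.cos_sq_add_sin_sq _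
  have hS : lam ^ 2 / 4 * (Pvec lam u ⬝ᵥ Pvec lam u) = 1 - (P0 u : ℂ) ^ 2 := by
    have := coord_sphere hlam.ne' u
    rw [Pvec_dotProduct_self]
    have h4 : lam ^ 2 / 4 * ∑ a, P lam u a ^ 2 = 1 - P0 u ^ 2 := by linarith
    exact_mod_cast h4
  set K := crossProduct (Pvec lam u) z with hK
  have hKK : crossProduct (Pvec lam u) K = -(Pvec lam u ⬝ᵥ Pvec lam u) • z := cross_cross_of_dot hdot
  have h1 := congrArg (fun x => crossProduct (Pvec lam u) x) h
  simp only [map_add, map_smul, map_zero, ← hK, hKK] at h1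
  have h2 : (((P0 u : ℂ) * s) ^ 2 - c ^ 2 * (1 - (P0 u : ℂ) ^ 2)) • z = 0 := by
    have e : (((P0 u : ℂ) * s) ^ 2 - c ^ 2 * (1 - (P0 u : ℂ) ^ 2)) • z =
        ((P0 u : ℂ) * s) • (((P0 u : ℂ) * s) • z + (Complex.I * lam / 2 * c) • K) -
        (Complex.I * lam / 2 * c) • (((P0 u : ℂ) * s) • K +
          (Complex.I * lam / 2 * c) • -(Pvec lam u ⬝ᵥ Pvec lam u) • z) := by
      rw [← hS, ← sub_eq_zero]
      have hI := Complex.I_sq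
      have : ∀ t : ℂ, ((((P0 u : ℂ) * s) ^ 2 - c ^ 2 * (lam ^ 2 / 4 * t)) • z -
        (((P0 u : ℂ) * s) • (((P0 u : ℂ) * s) • z + (Complex.I * lam / 2 * c) • K) -
        (Complex.I * lam / 2 * c) • (((P0 u : ℂ) * s) • K +
          (Complex.I * lam / 2 * c) • -t • z))) =
        (-(c ^ 2 * lam ^ 2 / 4 * t) * (Complex.I ^ 2 + 1)) • z := fun t => by module
      rw [this, hI]
      simp
    rw [e, h, h1]
    simp
  have h3 := (smul_eq_zero.1 h2).resolve_right hz
  have h4 : (P0 u * s) ^ 2 - c ^ 2 * (1 - P0 u ^ 2) = 0 := by exact_mod_cast h3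
  linear_combination h4 - P0 u ^ 2 * hcs

theorem shell_of_cartConstraint {lam m : ℝ} (hlam : 0 < lam) (hm : 0 < m)
    (hm' : m < 2 * Real.pi / lam) {u : SU2} {z : Fin 3 → ℂ} (h : CartConstraint lam m u z) :
    ((∑ a, P lam u a ^ 2 - effMass lam m ^ 2 : ℝ) : ℂ) • z = 0 := by
  by_cases hz : z = 0
  · simp [hz]
  · rw [(shell_iff hlam.ne' m u).2 (P0_sq_eq_of_cartConstraint hlam hm hm' h hz)]
    simp

/-- With `P₀ = c` the linear relation is `(iλ/2) c` times the curl equation. Cancelling `c` is where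
the equatorial mass has to be excluded: there the relation degenerates. -/
theorem cartConstraint_iff_curl {lam m : ℝ} (hlam : 0 < lam) (hm : 0 < m)
    (hm' : m < 2 * Real.pi / lam) (hpi : m * lam ≠ Real.pi) {u : SU2} (hu : u ∈ patch lam m)
    (z : Fin 3 → ℂ) : CartConstraint lam m u z ↔
      crossProduct (Pvec lam u) z - (Complex.I * effMass lam m) • z = 0 := by
  have hc0 := cos_half_angle_ne_zero hlam hm hm' hpi
  have hM0 : (effMass lam m : ℂ) ≠ 0 := by exact_mod_cast effMass_ne_zero hlam hm hm'
  have hl : (Complex.I * lam / 2 : ℂ) ≠ 0 := by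
    have : (lam : ℂ) ≠ 0 := by exact_mod_cast hlam.ne'
    simp [this]
  by_cases hz : z = 0
  · subst hz
    rw [cartConstraint_iff]
    simp [slash_zero]
  have main : ∀ _ : Pvec lam u ⬝ᵥ z = 0, ∀ _ : P0 u ^ 2 = Real.cos (m * lam / 2) ^ 2,
      (CartConstraint lam m u z ↔
        crossProduct (Pvec lam u) z - (Complex.I * effMass lam m) • z = 0) := by
    intro hdot hsq
    have hc0' : (Real.cos (m * lam / 2) : ℂ) ≠ 0 := by exact_mod_cast hc0
    rw [cartConstraint_iff_of_dot hlam.ne' m hdot, P0_eq_of_mem_patch hu hsq,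
      ← half_mul_effMass hlam.ne']
    have : ∀ c K : ℂ, ∀ w : Fin 3 → ℂ, (c * (lam / 2 * effMass lam m)) • z +
        (Complex.I * lam / 2 * c) • w = (Complex.I * lam / 2 * c) • w -
        (-(1 : ℂ) * (c * (lam / 2 * effMass lam m))) • z := fun c K w => by module
    rw [this _ 0]
    rw [show -(1 : ℂ) * ((Real.cos (m * lam / 2) : ℂ) * (lam / 2 * effMass lam m)) =
      Complex.I * lam / 2 * (Real.cos (m * lam / 2) : ℂ) * (Complex.I * effMass lam m) by
        linear_combination (-(Real.cos (m * lam / 2) : ℂ) * (lam / 2 * effMass lam m)) * Complex.I_sq,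
      mul_smul _ (Complex.I * (effMass lam m : ℂ)), ← smul_sub, smul_eq_zero,
      or_iff_right (mul_ne_zero hl hc0')]
  constructor
  · intro h
    exact (main (dotProduct_eq_zero_of_cartConstraint hlam hm hm' h)
      (P0_sq_eq_of_cartConstraint hlam hm hm' h hz)).1 h
  · intro h
    have hK := sub_eq_zero.1 h
    -- The scalar product with `P` kills `P × z` and leaves `i M (P · z)`, with `M` nonzero.
    have hdot : Pvec lam u ⬝ᵥ z = 0 := by
      have h1 := dot_self_cross (Pvec lam u) z
      rw [hK, dotProduct_smul, smul_eq_mul] at h1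
      simpa [hM0] using h1
    -- Applying `P ×` twice gives `(i M)² z = -P² z`, which is the mass shell.
    have h2 := cross_cross_of_dot hdot
    rw [hK, map_smul, hK, smul_smul, Pvec_dotProduct_self, ← sub_eq_zero, ← sub_smul] at h2
    have h3 := (smul_eq_zero.1 h2).resolve_right hz
    have h4 : ((∑ a, P lam u a ^ 2 - effMass lam m ^ 2 : ℝ) : ℂ) = 0 := by
      push_cast at h3 ⊢
      linear_combination h3 - (effMass lam m : ℂ) ^ 2 * Complex.I_sq
    exact (main hdot ((shell_iff hlam.ne' m u).1 (by exact_mod_cast h4))).2 h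

/-! ### Supports of constrained fields -/

theorem W_zero_eq_top (lam m : ℝ) : W lam m 0 = ⊤ := by
  refine eq_top_iff.2 fun φ _ u => ?_
  have h : rho 0 u.1 = 1 := by
    ext i j
    fin_cases i; fin_cases j
    simp [rho]
  apply WithLp.ofLp_injective
  rw [spin_apply, h]
  simp

theorem W_one_eq_Wsupp {lam m : ℝ} (hlam : 0 < lam) (hm : 0 < m) (hm' : m < 2 * Real.pi / lam) :
    W lam m 1 = Wsupp lam m 1 := by
  ext φ
  refine ⟨fun h => ⟨h, fun u hu => ?_⟩, fun h => h.1⟩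
  by_contra h0
  exact hu ((mem_conjClass_iff hlam hm hm' _).2 (P0_eq_cos_of_constraint_one (h u) h0))

theorem P0_sq_eq_of_constraint_two {lam m : ℝ} (hlam : 0 < lam) (hm : 0 < m)
    (hm' : m < 2 * Real.pi / lam) {u : SU2} {x : E 2} (h : Constraint lam m 2 u x)
    (hx : x ≠ 0) : P0 u ^ 2 = Real.cos (m * lam / 2) ^ 2 := by
  refine P0_sq_eq_of_cartConstraint (z := star cartToWeight *ᵥ x.ofLp) hlam hm hm' ?_ ?_
  · rw [CartConstraint, cartToWeight_mulVec_star]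
    exact h
  · intro h0
    apply hx
    apply WithLp.ofLp_injective
    rw [← cartToWeight_mulVec_star x.ofLp, h0, Matrix.mulVec_zero]
    rfl

/-- The sign left open by `P₀² = cos²` gives the second class, since `cos (π - x) = -cos x` sends
the mass `m` to `2π/λ - m`. The hemisphere condition removes the sign. -/
theorem W_two_support {lam m : ℝ} (hlam : 0 < lam) (hm : 0 < m) (hm' : m < 2 * Real.pi / lam)
    {φ : S3NS → E 2} (hφ : φ ∈ W lam m 2) :
    (∀ u : S3NS, u.1 ∉ conjClass lam m → u.1 ∉ conjClass lam (2 * Real.pi / lam - m) → φ u = 0) ∧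
      ((∀ u : S3NS, u.1 ∉ patch lam m → φ u = 0) → φ ∈ Wsupp lam m 2) := by
  constructor
  · intro u h1 h2
    by_contra h0
    have hsq := P0_sq_eq_of_constraint_two hlam hm hm' (hφ u) h0
    rw [mem_conjClass_iff hlam hm hm'] at h1
    rw [mem_conjClass_iff hlam (by linarith) (by linarith)] at h2
    rcases sq_eq_sq_iff_eq_or_eq_neg.1 hsq with h | h
    · exact h1 h
    · apply h2
      rw [h, ← Real.cos_pi_sub]
      congr 1
      field_simp
  · intro hp
    refine ⟨hφ, fun u hu => ?_⟩
    by_contra h0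
    have hpatch : u.1 ∈ patch lam m := by
      by_contra h
      exact h0 (hp u h)
    exact hu ((mem_conjClass_iff hlam hm hm' _).2 (P0_eq_of_mem_patch hpatch
      (P0_sq_eq_of_constraint_two hlam hm hm' (hφ u) h0)))

/-! ### The noncommutative spacetime -/

theorem tgen_coe (a : Fin 3) : (tgen a).1 = (1 / 2 : ℂ) • pauli a := rfl

theorem tgen_lie :
    ⁅tgen 0, tgen 1⁆ = Complex.I • tgen 2 ∧ ⁅tgen 1, tgen 2⁆ = Complex.I • tgen 0 ∧
      ⁅tgen 2, tgen 0⁆ = Complex.I • tgen 1 := by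
  refine ⟨?_, ?_, ?_⟩ <;> apply Subtype.ext <;>
    rw [LieAlgebra.SpecialLinear.sl_bracket] <;>
    change _ = Complex.I • (tgen _).1 <;> simp only [tgen_coe] <;> ext i j <;>
    fin_cases i <;> fin_cases j <;>
    simp [pauli] <;> ring_nf <;> simp [Complex.I_sq] <;> norm_num

theorem pos_commutator (lam : ℝ) {a b c : Fin 3} (h : ⁅tgen a, tgen b⁆ = Complex.I • tgen c) :
    pos lam a * pos lam b - pos lam b * pos lam a = (Complex.I * lam) • pos lam c := by
  have h1 := congrArg (UniversalEnvelopingAlgebra.ι ℂ) h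
  rw [LieHom.map_lie, LieRing.of_associative_ring_bracket, map_smul] at h1
  simp only [pos, smul_mul_smul_comm, ← smul_sub, h1, smul_smul]
  congr 1
  ring

theorem ofU_ι (y : Lsu2) (X : FinRep) :
    (ofU (UniversalEnvelopingAlgebra.ι ℂ y)).1 X = X.hom y := by
  rw [ofU, UniversalEnvelopingAlgebra.lift_ι_apply]
  rfl

theorem ofU_pos (lam : ℝ) (a : Fin 3) (X : FinRep) :
    (ofU (pos lam a)).1 X = (lam : ℂ) • X.hom (tgen a) := by
  rw [pos, map_smul, ← ofU_ι]
  rfl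

/-- The tensor product of operators on the defining representation and on `X`. -/
def tensorOp (X : FinRep) (B : Matrix (Fin 2) (Fin 2) ℂ) (C : Matrix (Fin X.dim) (Fin X.dim) ℂ) :
    Matrix (Fin (halfTensor X).dim) (Fin (halfTensor X).dim) ℂ :=
  (Matrix.kroneckerMap (· * ·) B C).submatrix (halfEquiv X).symm (halfEquiv X).symm

theorem tensorOp_apply (X : FinRep) (B : Matrix (Fin 2) (Fin 2) ℂ)
    (C : Matrix (Fin X.dim) (Fin X.dim) ℂ) (i j : Fin 2) (i' j' : Fin X.dim) :
    tensorOp X B C (halfEquiv X (i, i')) (halfEquiv X (j, j')) = B i j * C i' j' := by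
  simp [tensorOp, Matrix.kroneckerMap_apply]

theorem partialTrace_tensorOp (A : Matrix (Fin 2) (Fin 2) ℂ) (X : FinRep)
    (B : Matrix (Fin 2) (Fin 2) ℂ) (C : Matrix (Fin X.dim) (Fin X.dim) ℂ) :
    partialTrace A X (tensorOp X B C) = (A * B).trace • C := by
  ext i j
  simp only [partialTrace, LinearMap.coe_mk, AddHom.coe_mk, Matrix.of_apply, tensorOp_apply,
    Matrix.smul_apply, Matrix.trace, Matrix.diag_apply, Matrix.mul_apply, smul_eq_mul,
    Finset.sum_mul, mul_assoc]

theorem tensorOp_one_one (X : FinRep) : tensorOp X 1 1 = 1 := by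
  simp [tensorOp]

theorem halfTensor_hom_eq (X : FinRep) (y : Lsu2) :
    (halfTensor X).hom y = tensorOp X y.1 1 + tensorOp X 1 (X.hom y) := rfl

theorem coreg_apply (A : Matrix (Fin 2) (Fin 2) ℂ) (h : Uhat) (X : FinRep) :
    (coreg A h).1 X = partialTrace A X (h.1 (halfTensor X)) := rfl

theorem coreg_one (A : Matrix (Fin 2) (Fin 2) ℂ) : coreg A 1 = A.trace • 1 := by
  refine Subtype.ext (funext fun X => ?_)
  rw [coreg_apply]
  change partialTrace A X 1 = A.trace • (1 : Matrix (Fin X.dim) (Fin X.dim) ℂ)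
  rw [← tensorOp_one_one, partialTrace_tensorOp, Matrix.mul_one]

theorem trace_pauli (a : Fin 3) : (pauli a).trace = 0 := by
  fin_cases a <;> simp [pauli, Matrix.trace_fin_two]

theorem trace_pauli_mul (a b : Fin 3) : (pauli a * pauli b).trace = if a = b then 2 else 0 := by
  fin_cases a <;> fin_cases b <;>
    simp [pauli, Matrix.trace_fin_two] <;> norm_num

theorem pd_one (lam : ℝ) (a : Fin 3) : pd lam a 1 = 0 := by
  rw [pd, LinearMap.smul_apply, Pop, coreg_one, Matrix.trace_smul, trace_pauli]
  simp

/-- On the tensor product, `x_b` acts as `x_b ⊗ 1 + 1 ⊗ x_b`. Tracing against `σ_a` kills the second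
term, and the orthogonality of the Pauli matrices evaluates the first. -/
theorem pd_pos {lam : ℝ} (hlam : lam ≠ 0) (a b : Fin 3) :
    pd lam a (ofU (pos lam b)) = if a = b then 1 else 0 := by
  have hl : (lam : ℂ) ≠ 0 := by exact_mod_cast hlam
  refine Subtype.ext (funext fun X => ?_)
  change Complex.I • partialTrace _ X ((ofU (pos lam b)).1 (halfTensor X)) = _
  rw [ofU_pos, halfTensor_hom_eq, map_smul, map_add, partialTrace_tensorOp, partialTrace_tensorOp,
    tgen_coe, Matrix.smul_mul, Matrix.mul_smul, Matrix.trace_smul, Matrix.trace_smul,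
    trace_pauli_mul, Matrix.mul_one, Matrix.trace_smul, trace_pauli, smul_zero, zero_smul, add_zero]
  split_ifs with h
  · change _ = (1 : Matrix (Fin X.dim) (Fin X.dim) ℂ)
    rw [smul_smul, smul_smul]
    have : Complex.I * (lam : ℂ) * ((Complex.I * lam)⁻¹ • (1 / 2 : ℂ) • 2) = 1 := by
      simp only [smul_eq_mul]
      field_simp
    rw [this, one_smul]
  · change _ = (0 : Matrix (Fin X.dim) (Fin X.dim) ℂ)
    simp

/-! ### Plane waves -/

/-- The Lie algebra element whose exponential is the plane wave `exp (i p · x)`. -/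
def planeGen (lam : ℝ) (p : Fin 3 → ℝ) : Lsu2 := ∑ a, (Complex.I * p a * lam) • tgen a

theorem planeWave_apply (lam : ℝ) (p : Fin 3 → ℝ) (X : FinRep) :
    (planeWave lam p).1 X = NormedSpace.exp (X.hom (planeGen lam p)) := by
  rw [planeGen, map_sum]
  change NormedSpace.exp _ = _
  congr 1
  refine Finset.sum_congr rfl fun a _ => ?_
  rw [ofU_pos, map_smul, smul_smul]

theorem planeGen_coe (lam : ℝ) (p : Fin 3 → ℝ) :
    (planeGen lam p).1 = (Complex.I * lam / 2) • slash fun a => (p a : ℂ) := by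
  have : (planeGen lam p).1 = ∑ a, (Complex.I * p a * lam) • (tgen a).1 := by
    rw [planeGen, AddSubmonoidClass.coe_finsetSum]
    rfl
  rw [this, slash, Finset.smul_sum]
  refine Finset.sum_congr rfl fun a _ => ?_
  rw [tgen_coe, smul_smul, smul_smul]
  congr 1
  ring

/-- Exponentials commute with continuous homomorphisms of matrix algebras. -/
theorem map_exp_matrix {m n : Type*} [Fintype m] [DecidableEq m] [Fintype n] [DecidableEq n]
    (f : Matrix m m ℂ →ₐ[ℂ] Matrix n n ℂ) (hf : Continuous f) (A : Matrix m m ℂ) :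
    f (NormedSpace.exp A) = NormedSpace.exp (f A) := by
  let _ := Matrix.linftyOpNormedRing (n := m) (α := ℂ)
  let _ := Matrix.linftyOpNormedAlgebra (n := m) (R := ℂ) (α := ℂ)
  let _ := Matrix.linftyOpNormedRing (n := n) (α := ℂ)
  let _ := Matrix.linftyOpNormedAlgebra (n := n) (R := ℂ) (α := ℂ)
  let _ := NormedAlgebra.restrictScalars ℚ ℂ (Matrix m m ℂ)
  let _ := NormedAlgebra.restrictScalars ℚ ℂ (Matrix n n ℂ)
  exact NormedSpace.map_exp f hf A

theorem tensorOp_mul (X : FinRep) (B B' : Matrix (Fin 2) (Fin 2) ℂ)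
    (C C' : Matrix (Fin X.dim) (Fin X.dim) ℂ) :
    tensorOp X B C * tensorOp X B' C' = tensorOp X (B * B') (C * C') := by
  simp only [tensorOp, Matrix.submatrix_mul_equiv, Matrix.mul_kronecker_mul]

/-- The homomorphism `B ↦ B ⊗ 1`. -/
def tensorLeft (X : FinRep) : Matrix (Fin 2) (Fin 2) ℂ →ₐ[ℂ]
    Matrix (Fin (halfTensor X).dim) (Fin (halfTensor X).dim) ℂ :=
  AlgHom.ofLinearMap
    { toFun := fun B => tensorOp X B 1
      map_add' := fun B B' => by
        ext i j; simp [tensorOp, Matrix.kroneckerMap_apply, add_mul]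
      map_smul' := fun c B => by
        ext i j; simp [tensorOp, Matrix.kroneckerMap_apply, mul_assoc] }
    (tensorOp_one_one X) fun B B' => by
      change tensorOp X (B * B') 1 = tensorOp X B 1 * tensorOp X B' 1
      rw [tensorOp_mul, mul_one]

/-- The homomorphism `C ↦ 1 ⊗ C`. -/
def tensorRight (X : FinRep) : Matrix (Fin X.dim) (Fin X.dim) ℂ →ₐ[ℂ]
    Matrix (Fin (halfTensor X).dim) (Fin (halfTensor X).dim) ℂ :=
  AlgHom.ofLinearMap
    { toFun := fun C => tensorOp X 1 C
      map_add' := fun B B' => by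
        ext i j; simp [tensorOp, Matrix.kroneckerMap_apply, mul_add]
      map_smul' := fun c B => by
        ext i j; simp [tensorOp, Matrix.kroneckerMap_apply, mul_left_comm] }
    (tensorOp_one_one X) fun B B' => by
      change tensorOp X 1 (B * B') = tensorOp X 1 B * tensorOp X 1 B'
      rw [tensorOp_mul, mul_one]

/-- The two summands of the Lie algebra action on a tensor product commute, so the exponential
factors: exponentials are group-like. -/
theorem exp_halfTensor (X : FinRep) (y : Lsu2) : NormedSpace.exp ((halfTensor X).hom y) =
    tensorOp X (NormedSpace.exp y.1) (NormedSpace.exp (X.hom y)) := by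
  have hc : Commute (tensorOp X y.1 1) (tensorOp X 1 (X.hom y)) := by
    rw [Commute, SemiconjBy, tensorOp_mul, tensorOp_mul]
    simp
  have h1 : tensorOp X (NormedSpace.exp y.1) 1 = NormedSpace.exp (tensorOp X y.1 1) := by
    refine map_exp_matrix (tensorLeft X) ?_ y.1
    change Continuous fun B : Matrix (Fin 2) (Fin 2) ℂ => tensorOp X B 1
    refine continuous_matrix fun i j => ?_
    exact (continuous_id.matrix_elem _ _).mul continuous_const
  have h2 : tensorOp X 1 (NormedSpace.exp (X.hom y)) = NormedSpace.exp (tensorOp X 1 (X.hom y)) := by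
    refine map_exp_matrix (tensorRight X) ?_ (X.hom y)
    change Continuous fun B : Matrix (Fin X.dim) (Fin X.dim) ℂ => tensorOp X 1 B
    refine continuous_matrix fun i j => ?_
    exact continuous_const.mul (continuous_id.matrix_elem _ _)
  rw [halfTensor_hom_eq, Matrix.exp_add_of_commute _ _ hc, ← h1, ← h2, tensorOp_mul]
  simp

theorem planeWave_halfTensor {lam : ℝ} (hlam : 0 < lam) (u : S3NS) (X : FinRep) :
    (planeWave lam (lieCoord lam u.1)).1 (halfTensor X) =
      tensorOp X u.1.1 ((planeWave lam (lieCoord lam u.1)).1 X) := by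
  rw [planeWave_apply, planeWave_apply, exp_halfTensor, planeGen_coe, ← coe_eq_exp_lieCoord hlam]

/-- In the factor that is traced out, the plane wave is `u` itself, so the partial trace only
contributes the value of the function at `u`. -/
theorem coreg_planeWave {lam : ℝ} (hlam : 0 < lam) (u : S3NS) (A : Matrix (Fin 2) (Fin 2) ℂ) :
    coreg A (planeWave lam (lieCoord lam u.1)) =
      (A * u.1.1).trace • planeWave lam (lieCoord lam u.1) := by
  refine Subtype.ext (funext fun X => ?_)
  rw [coreg_apply, planeWave_halfTensor hlam, partialTrace_tensorOp]
  rfl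

theorem trace_half_mul (u : SU2) : (((1 / 2 : ℂ) • (1 : Matrix (Fin 2) (Fin 2) ℂ)) * u.1).trace =
    P0 u := by
  rw [Matrix.smul_mul, Matrix.one_mul, Matrix.trace_smul, trace_eq_two_P0, smul_eq_mul]
  ring

theorem slash_eq_sum (v : Fin 3 → ℂ) : slash v = ∑ a, v a • pauli a := rfl

theorem trace_pauli_mul_coe {lam : ℝ} (hlam : lam ≠ 0) (u : SU2) (a : Fin 3) :
    (((Complex.I * lam)⁻¹ • pauli a) * u.1).trace = P lam u a := by
  have hl : (lam : ℂ) ≠ 0 := by exact_mod_cast hlam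
  nth_rewrite 1 [coe_eq_coord hlam u]
  rw [slash_eq_sum, Matrix.smul_mul, Matrix.trace_smul, Matrix.mul_add, Matrix.trace_add, Matrix.mul_smul,
    Matrix.mul_one, Matrix.trace_smul, trace_pauli, Matrix.mul_smul, Matrix.trace_smul,
    Matrix.mul_sum, Matrix.trace_sum]
  simp only [Matrix.mul_smul, Matrix.trace_smul, trace_pauli_mul, smul_eq_mul, mul_ite, mul_zero,
    Finset.sum_ite_eq, Finset.mem_univ, if_true, Pvec]
  field_simp
  ring

theorem P0op_planeWave {lam : ℝ} (hlam : 0 < lam) (u : S3NS) :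
    P0op (planeWave lam (lieCoord lam u.1)) =
      (P0 u.1 : ℂ) • planeWave lam (lieCoord lam u.1) := by
  rw [P0op, coreg_planeWave hlam, trace_half_mul]

theorem pd_planeWave {lam : ℝ} (hlam : 0 < lam) (u : S3NS) (a : Fin 3) :
    pd lam a (planeWave lam (lieCoord lam u.1)) =
      (Complex.I * P lam u.1 a) • planeWave lam (lieCoord lam u.1) := by
  rw [pd, LinearMap.smul_apply, Pop, coreg_planeWave hlam, trace_pauli_mul_coe hlam.ne', smul_smul]

/-! ### The Fourier transform -/

theorem continuous_P0 : Continuous P0 := by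
  have : P0 = fun u : SU2 => (u.1 0 0).re := funext P0_eq_re
  rw [this]
  exact Complex.continuous_re.comp (continuous_entry 0 0)

theorem continuous_P (lam : ℝ) (a : Fin 3) : Continuous fun u => P lam u a := by
  unfold P
  refine (Complex.continuous_im.comp ?_).div_const _
  exact (continuous_const.matrix_mul continuous_subtype_val).matrix_trace

theorem continuous_lieCoord (lam : ℝ) : Continuous fun u : S3NS => lieCoord lam u.1 := by
  refine continuous_pi fun a => ?_
  unfold lieCoord
  have h0 : Continuous fun u : S3NS => P0 u.1 := continuous_P0.comp continuous_subtype_val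
  refine Continuous.mul (Continuous.div (Real.continuous_arccos.comp h0) ?_ fun u =>
    (sqrt_P0_pos u).ne') ((continuous_P lam a).comp continuous_subtype_val)
  fun_prop

theorem continuous_planeWave (lam : ℝ) (X : FinRep) (i j : Fin X.dim) :
    Continuous fun p : Fin 3 → ℝ => (planeWave lam p).1 X i j := by
  have h : Continuous fun p : Fin 3 → ℝ =>
      ∑ a, (Complex.I * (p a : ℂ)) • (ofU (pos lam a)).1 X := by
    fun_prop
  let _ := Matrix.linftyOpNormedRing (n := Fin X.dim) (α := ℂ)
  let _ := Matrix.linftyOpNormedAlgebra (n := Fin X.dim) (R := ℂ) (α := ℂ)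
  let _ := NormedAlgebra.restrictScalars ℚ ℂ (Matrix (Fin X.dim) (Fin X.dim) ℂ)
  have h2 : Continuous fun p : Fin 3 → ℝ =>
      NormedSpace.exp (∑ a, (Complex.I * (p a : ℂ)) • (ofU (pos lam a)).1 X) :=
    NormedSpace.exp_continuous.comp h
  exact h2.matrix_elem i j

/-- The Lie coordinates stay in a compact ball. Compactness of momentum space cannot be used
directly, since the coordinates have direction-dependent limits at `-1`. -/
theorem exists_planeWave_bound {lam : ℝ} (hlam : 0 < lam) (X : FinRep) (i j : Fin X.dim) :
    ∃ C : ℝ, ∀ u : S3NS, ‖(planeWave lam (lieCoord lam u.1)).1 X i j‖ ≤ C := by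
  obtain ⟨C, hC⟩ := (isCompact_closedBall (0 : Fin 3 → ℝ) (2 * Real.pi / lam)).exists_bound_of_continuousOn
    (continuous_planeWave lam X i j).continuousOn
  refine ⟨C, fun u => hC _ ?_⟩
  have hp : 0 ≤ 2 * Real.pi / lam := by positivity
  rw [mem_closedBall_zero_iff, pi_norm_le_iff_of_nonneg hp]
  intro a
  refine abs_le_of_sq_le_sq (le_trans ?_ (sum_sq_lieCoord_lt hlam u).le) hp
  exact Finset.single_le_sum (f := fun a => lieCoord lam u.1 a ^ 2) (fun b _ => sq_nonneg _)
    (Finset.mem_univ a)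

theorem integrable_mul_of_continuous_bound {ν : Measure S3NS} {f g : S3NS → ℂ}
    (hf : Integrable f ν) (hg : Continuous g) {C : ℝ} (hC : ∀ u, ‖g u‖ ≤ C) :
    Integrable (fun u => f u * g u) ν := by
  have := hf.bdd_mul hg.aestronglyMeasurable (c := C) (Filter.Eventually.of_forall hC)
  simpa only [mul_comm] using this

theorem integrable_mul_planeWave {lam : ℝ} (hlam : 0 < lam) {ν : Measure S3NS} {f : S3NS → ℂ}
    (hf : Integrable f ν) (X : FinRep) (i j : Fin X.dim) :
    Integrable (fun u => f u * (planeWave lam (lieCoord lam u.1)).1 X i j) ν := by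
  obtain ⟨C, hC⟩ := exists_planeWave_bound hlam X i j
  exact integrable_mul_of_continuous_bound hf
    ((continuous_planeWave lam X i j).comp (continuous_lieCoord lam)) hC

theorem qFourier_apply {lam : ℝ} (hlam : 0 < lam) {ν : Measure S3NS} {f : S3NS → ℂ}
    (hf : Integrable f ν) (X : FinRep) (i j : Fin X.dim) :
    (qFourier lam ν f).1 X i j = ∫ u, f u * (planeWave lam (lieCoord lam u.1)).1 X i j ∂ν := by
  rw [qFourier, dif_pos (integrable_mul_planeWave hlam hf)]
  rfl

theorem Uhat_ext {h k : Uhat} (H : ∀ X i j, h.1 X i j = k.1 X i j) : h = k :=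
  Subtype.ext (funext fun X => Matrix.ext (H X))

theorem integrable_continuous_mul {ν : Measure S3NS} {f : S3NS → ℂ} (hf : Integrable f ν)
    {g : SU2 → ℂ} (hg : Continuous g) : Integrable (fun u => g u.1 * f u) ν := by
  obtain ⟨C, hC⟩ := isCompact_univ.exists_bound_of_continuousOn hg.continuousOn
  simp only [mul_comm]
  exact integrable_mul_of_continuous_bound hf (hg.comp continuous_subtype_val)
    fun u => hC u.1 trivial

theorem continuous_trace_mul (A : Matrix (Fin 2) (Fin 2) ℂ) :
    Continuous fun u : SU2 => (A * u.1).trace :=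
  (continuous_const.matrix_mul continuous_subtype_val).matrix_trace

/-- Under the integral this is the eigenvalue property of plane waves; the partial trace is a finite
sum and therefore commutes with the integral. -/
theorem qFourier_trace_mul {lam : ℝ} (hlam : 0 < lam) {ν : Measure S3NS} {f : S3NS → ℂ}
    (hf : Integrable f ν) (A : Matrix (Fin 2) (Fin 2) ℂ) :
    qFourier lam ν (fun u => (A * u.1.1).trace * f u) = coreg A (qFourier lam ν f) := by
  refine Uhat_ext fun X i j => ?_
  rw [qFourier_apply hlam (integrable_continuous_mul hf (continuous_trace_mul A)), coreg_apply]
  simp only [partialTrace, LinearMap.coe_mk, AddHom.coe_mk, Matrix.of_apply]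
  have hi : ∀ k l : Fin 2, Integrable (fun u => A k l * (f u * (planeWave lam (lieCoord lam u.1)).1
      (halfTensor X) (halfEquiv X (l, i)) (halfEquiv X (k, j)))) ν := fun k l =>
    (integrable_mul_planeWave hlam hf (halfTensor X) _ _).const_mul _
  have hs : ∀ u : S3NS, (A * u.1.1).trace * f u * (planeWave lam (lieCoord lam u.1)).1 X i j =
      ∑ k, ∑ l, A k l * (f u * (planeWave lam (lieCoord lam u.1)).1
        (halfTensor X) (halfEquiv X (l, i)) (halfEquiv X (k, j))) := by
    intro u
    simp only [planeWave_halfTensor hlam, tensorOp_apply, Matrix.trace, Matrix.diag_apply,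
      Matrix.mul_apply, Finset.sum_mul]
    refine Finset.sum_congr rfl fun k _ => Finset.sum_congr rfl fun l _ => ?_
    ring
  simp only [hs]
  rw [integral_finsetSum _ fun k _ => integrable_finsetSum _ fun l _ => hi k l]
  refine Finset.sum_congr rfl fun k _ => ?_
  rw [integral_finsetSum _ fun l _ => hi k l]
  refine Finset.sum_congr rfl fun l _ => ?_
  rw [integral_const_mul, qFourier_apply hlam hf]

/-! ### Injectivity of the Fourier transform -/

/-- An integrable function on a subspace of a compact metrizable space that is orthogonal to all
continuous functions vanishes almost everywhere. -/
theorem ae_eq_zero_of_forall_integral_continuous_mul {Y K : Type*} [TopologicalSpace K]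
    [CompactSpace K] [TopologicalSpace.PseudoMetrizableSpace K]
    [TopologicalSpace Y] [MeasurableSpace Y] [BorelSpace Y]
    {q : Y → K} (hq : Topology.IsInducing q) {ν : Measure Y} {f : Y → ℂ} (hf : Integrable f ν)
    (h : ∀ g : C(K, ℂ), ∫ y, f y * g (q y) ∂ν = 0) : f =ᵐ[ν] 0 := by
  refine ae_eq_zero_of_forall_setIntegral_isClosed_eq_zero hf fun s hs => ?_
  obtain ⟨t, ht, rfl⟩ := hq.isClosed_iff.1 hs
  -- The indicator of the closed set `t` is a pointwise limit of continuous functions bounded by 1,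
  -- so dominated convergence with bound `‖f‖` passes from continuous test functions to closed sets.
  have hlim : Filter.Tendsto (fun n => ∫ y, f y * ((ht.apprSeq n (q y) : ℝ) : ℂ) ∂ν) Filter.atTop
      (nhds (∫ y, (q ⁻¹' t).indicator f y ∂ν)) := by
    refine tendsto_integral_of_dominated_convergence (fun y => ‖f y‖) (fun n => ?_) hf.norm
      (fun n => Filter.Eventually.of_forall fun y => ?_) (Filter.Eventually.of_forall fun y => ?_)
    · refine hf.aestronglyMeasurable.mul (Continuous.aestronglyMeasurable ?_)
      exact Complex.continuous_ofReal.comp (NNReal.continuous_coe.comp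
        ((ht.apprSeq n).continuous.comp hq.continuous))
    · rw [norm_mul, Complex.norm_real, Real.norm_of_nonneg NNReal.zero_le_coe]
      have : ((ht.apprSeq n (q y) : NNReal) : ℝ) ≤ 1 := by
        exact_mod_cast HasOuterApproxClosed.apprSeq_apply_le_one ht n (q y)
      exact mul_le_of_le_one_right (norm_nonneg _) this
    · have h1 := (tendsto_pi_nhds.1 (HasOuterApproxClosed.tendsto_apprSeq ht)) (q y)
      have h2 := ((Complex.continuous_ofReal.comp NNReal.continuous_coe).tendsto _).comp h1
      have h3 := h2.const_mul (f y)
      have e : (q ⁻¹' t).indicator f y =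
          f y * (((t.indicator (fun _ => (1 : NNReal)) (q y) : NNReal) : ℝ) : ℂ) := by
        by_cases hy : q y ∈ t <;> simp [Set.indicator, hy]
      rw [e]
      exact h3
  rw [integral_indicator hs.measurableSet] at hlim
  refine tendsto_nhds_unique hlim ?_
  have : ∀ n, ∫ y, f y * ((ht.apprSeq n (q y) : ℝ) : ℂ) ∂ν = 0 := fun n =>
    h ⟨fun k => ((ht.apprSeq n k : ℝ) : ℂ), Complex.continuous_ofReal.comp
      (NNReal.continuous_coe.comp (ht.apprSeq n).continuous)⟩
  simp only [this]
  exact tendsto_const_nhds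

/-- The matrix entries as continuous functions on the group. -/
def entryFun (i j : Fin 2) : C(SU2, ℂ) := ⟨fun u => u.1 i j, continuous_entry i j⟩

/-- By the quaternionic form, conjugate entries are entries up to sign, so generating a star algebra
requires no functions beyond the entries. -/
theorem star_entryFun (i j : Fin 2) : ∃ (c : ℂ) (k l : Fin 2), star (entryFun i j) =
    c • entryFun k l := by
  have h0 := entry_one_one
  have h1 := entry_one_zero
  fin_cases i <;> fin_cases j
  · exact ⟨1, 1, 1, by ext u; simp [entryFun, h0]⟩
  · exact ⟨-1, 1, 0, by ext u; simp [entryFun, h1]⟩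
  · exact ⟨-1, 0, 1, by ext u; simp [entryFun, h1]⟩
  · exact ⟨1, 0, 0, by ext u; simp [entryFun, h0]⟩

/-- The star algebra of polynomial functions on the group. -/
def polyFun : StarSubalgebra ℂ C(SU2, ℂ) :=
  StarAlgebra.adjoin ℂ (Set.range fun p : Fin 2 × Fin 2 => entryFun p.1 p.2)

theorem polyFun_separatesPoints : polyFun.SeparatesPoints := by
  intro u v huv
  by_contra! h
  apply huv
  apply Subtype.ext
  ext i j
  exact h _ ⟨entryFun i j, StarAlgebra.subset_adjoin _ _ ⟨(i, j), rfl⟩, rfl⟩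

/-- The trivial one-dimensional representation. -/
def trivialRep : FinRep where
  dim := 1
  hom := 0

/-- Products of matrix entries are matrix coefficients of plane waves. -/
theorem exists_planeWave_eq_of_mem_closure {lam : ℝ} (hlam : 0 < lam) {g : C(SU2, ℂ)}
    (hg : g ∈ Submonoid.closure ((Set.range fun p : Fin 2 × Fin 2 => entryFun p.1 p.2) ∪
      star (Set.range fun p : Fin 2 × Fin 2 => entryFun p.1 p.2))) :
    ∃ (c : ℂ) (X : FinRep) (i j : Fin X.dim), ∀ u : S3NS,
      g u.1 = c * (planeWave lam (lieCoord lam u.1)).1 X i j := by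
  have hgen : ∀ x ∈ (Set.range fun p : Fin 2 × Fin 2 => entryFun p.1 p.2) ∪
      star (Set.range fun p : Fin 2 × Fin 2 => entryFun p.1 p.2),
      ∃ (c : ℂ) (k l : Fin 2), x = c • entryFun k l := by
    rintro x (⟨p, rfl⟩ | ⟨p, hp⟩)
    · exact ⟨1, p.1, p.2, (one_smul _ _).symm⟩
    · have : x = star (entryFun p.1 p.2) := by
        rw [show entryFun p.1 p.2 = star x from hp, star_star]
      rw [this]
      exact star_entryFun p.1 p.2
  induction hg using Submonoid.closure_induction_left with
  | one =>
    refine ⟨1, trivialRep, (0 : Fin 1), (0 : Fin 1), fun u => ?_⟩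
    have h0 : trivialRep.hom (planeGen lam (lieCoord lam u.1)) = 0 := rfl
    rw [planeWave_apply, h0, NormedSpace.exp_zero]
    exact (one_mul (1 : ℂ)).symm
  | mul_left x hx y hy ih =>
    obtain ⟨c, X, i, j, h⟩ := ih
    obtain ⟨d, k, l, rfl⟩ := hgen x hx
    -- Multiplication by a matrix entry of `u` tensors the representation with the defining one, by
    -- the group-like property.
    refine ⟨d * c, halfTensor X, halfEquiv X (k, i), halfEquiv X (l, j), fun u => ?_⟩
    rw [planeWave_halfTensor hlam, tensorOp_apply, ContinuousMap.mul_apply, h u]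
    simp [entryFun]
    ring

/-- Integration against an integrable function as a functional on continuous functions. -/
def integralFunctional {ν : Measure S3NS} {f : S3NS → ℂ} (hf : Integrable f ν) : C(SU2, ℂ) →L[ℂ] ℂ :=
  LinearMap.mkContinuous
    { toFun := fun g => ∫ u, g u.1 * f u ∂ν
      map_add' := fun g h => by
        simp only [ContinuousMap.add_apply, add_mul]
        exact integral_add (integrable_continuous_mul hf g.continuous)
          (integrable_continuous_mul hf h.continuous)
      map_smul' := fun c g => by
        simp only [ContinuousMap.smul_apply, smul_eq_mul, mul_assoc, integral_const_mul,
          RingHom.id_apply] } (∫ u, ‖f u‖ ∂ν) fun g => by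
    change ‖∫ u, g u.1 * f u ∂ν‖ ≤ _
    refine (norm_integral_le_integral_norm _).trans ?_
    rw [← integral_mul_const]
    refine integral_mono (integrable_continuous_mul hf g.continuous).norm (hf.norm.mul_const _)
      fun u => ?_
    rw [norm_mul, mul_comm]
    exact mul_le_mul_of_nonneg_left (g.norm_coe_le_norm u.1) (norm_nonneg _)

/-- Passes to `SU₂`, where it supplies the continuous approximations of closed sets needed for
injectivity. -/
instance : TopologicalSpace.PseudoMetrizableSpace (Matrix (Fin 2) (Fin 2) ℂ) :=
  inferInstanceAs (TopologicalSpace.PseudoMetrizableSpace (Fin 2 → Fin 2 → ℂ))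

/-- A vanishing transform makes `f` orthogonal to all matrix coefficients of plane waves, hence to
the polynomial functions, and by Stone-Weierstrass to all continuous functions on the compact group.
Such an integrable `f` is null. -/
theorem qFourier_injective {lam : ℝ} (hlam : 0 < lam) {ν : Measure S3NS} {f : S3NS → ℂ}
    (hf : Integrable f ν) (h : qFourier lam ν f = 0) : f =ᵐ[ν] 0 := by
  refine ae_eq_zero_of_forall_integral_continuous_mul (K := SU2) Topology.IsInducing.subtypeVal hf
    fun g => ?_
  have hclosed : IsClosed {g : C(SU2, ℂ) | integralFunctional hf g = 0} :=
    isClosed_eq (integralFunctional hf).continuous continuous_const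
  have hsub : (polyFun : Set C(SU2, ℂ)) ⊆ {g : C(SU2, ℂ) | integralFunctional hf g = 0} := by
    intro g hg
    have hg' : g ∈ Submodule.span ℂ (Submonoid.closure
        ((Set.range fun p : Fin 2 × Fin 2 => entryFun p.1 p.2) ∪
          star (Set.range fun p : Fin 2 × Fin 2 => entryFun p.1 p.2)) : Set C(SU2, ℂ)) := by
      rw [← Algebra.adjoin_eq_span]
      rw [polyFun, SetLike.mem_coe, ← StarSubalgebra.mem_toSubalgebra,
        StarAlgebra.adjoin_toSubalgebra] at hg
      exact hg
    change g ∈ LinearMap.ker (integralFunctional hf).toLinearMap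
    refine (Submodule.span_le.2 fun x hx => ?_) hg'
    obtain ⟨c, X, i, j, hx⟩ := exists_planeWave_eq_of_mem_closure hlam hx
    change ∫ u, x u.1 * f u ∂ν = 0
    have h1 := qFourier_apply hlam hf X i j
    rw [h] at h1
    have : ∀ u : S3NS, x u.1 * f u = c * (f u * (planeWave lam (lieCoord lam u.1)).1 X i j) :=
      fun u => by rw [hx u]; ring
    simp only [this, integral_const_mul, ← h1]
    change c * (0 : ℂ) = 0
    simp
  have hdense := ContinuousMap.starSubalgebra_topologicalClosure_eq_top_of_separatesPoints polyFun
    polyFun_separatesPoints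
  have hg : g ∈ polyFun.topologicalClosure := by rw [hdense]; trivial
  have h2 : g ∈ {g : C(SU2, ℂ) | integralFunctional hf g = 0} :=
    closure_minimal hsub hclosed hg
  have h3 : ∫ u, g u.1 * f u ∂ν = 0 := h2
  rw [← h3]
  exact integral_congr_ae (Filter.Eventually.of_forall fun u => mul_comm _ _)

/-! ### Wave equations -/

theorem qFourier_eq_zero_iff {lam : ℝ} (hlam : 0 < lam) {ν : Measure S3NS} {f : S3NS → ℂ}
    (hf : Integrable f ν) : qFourier lam ν f = 0 ↔ f =ᵐ[ν] 0 := by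
  refine ⟨qFourier_injective hlam hf, fun h => Uhat_ext fun X i j => ?_⟩
  rw [qFourier_apply hlam hf]
  change _ = (0 : ℂ)
  refine integral_eq_zero_of_ae ?_
  filter_upwards [h] with u hu
  rw [hu]
  exact zero_mul _

theorem qFourier_add {lam : ℝ} (hlam : 0 < lam) {ν : Measure S3NS} {f g : S3NS → ℂ}
    (hf : Integrable f ν) (hg : Integrable g ν) :
    qFourier lam ν (fun u => f u + g u) = qFourier lam ν f + qFourier lam ν g := by
  refine Uhat_ext fun X i j => ?_
  have hfg : Integrable (fun u => f u + g u) ν := hf.add hg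
  rw [qFourier_apply hlam hfg]
  change _ = (qFourier lam ν f).1 X i j + (qFourier lam ν g).1 X i j
  rw [qFourier_apply hlam hf, qFourier_apply hlam hg,
    ← integral_add (integrable_mul_planeWave hlam hf X i j) (integrable_mul_planeWave hlam hg X i j)]
  simp only [add_mul]

theorem qFourier_const_mul {lam : ℝ} (hlam : 0 < lam) {ν : Measure S3NS} {f : S3NS → ℂ}
    (hf : Integrable f ν) (c : ℂ) :
    qFourier lam ν (fun u => c * f u) = c • qFourier lam ν f := by
  refine Uhat_ext fun X i j => ?_
  rw [qFourier_apply hlam (hf.const_mul c)]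
  change _ = c * (qFourier lam ν f).1 X i j
  rw [qFourier_apply hlam hf, ← integral_const_mul]
  simp only [mul_assoc]

theorem qFourier_sum {lam : ℝ} (hlam : 0 < lam) {ν : Measure S3NS} {ι : Type*} (s : Finset ι)
    {f : ι → S3NS → ℂ} (hf : ∀ i ∈ s, Integrable (f i) ν) :
    qFourier lam ν (fun u => ∑ i ∈ s, f i u) = ∑ i ∈ s, qFourier lam ν (f i) := by
  classical
  induction s using Finset.induction_on with
  | empty =>
    simp only [Finset.sum_empty]
    exact (qFourier_eq_zero_iff hlam (integrable_zero _ _ _)).2 (Filter.EventuallyEq.refl _ _)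
  | insert a s ha ih =>
    simp only [Finset.sum_insert ha]
    rw [qFourier_add hlam (hf a (Finset.mem_insert_self a s))
      (integrable_finsetSum _ fun i hi => hf i (Finset.mem_insert_of_mem hi)),
      ih fun i hi => hf i (Finset.mem_insert_of_mem hi)]

theorem qFourier_P0_mul {lam : ℝ} (hlam : 0 < lam) {ν : Measure S3NS} {f : S3NS → ℂ}
    (hf : Integrable f ν) :
    qFourier lam ν (fun u => P0 u.1 * f u) = P0op (qFourier lam ν f) := by
  rw [P0op, ← qFourier_trace_mul hlam hf]
  simp only [trace_half_mul]

theorem integrable_P_mul {lam : ℝ} {ν : Measure S3NS} {f : S3NS → ℂ}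
    (hf : Integrable f ν) (a : Fin 3) : Integrable (fun u => (P lam u.1 a : ℂ) * f u) ν :=
  integrable_continuous_mul (g := fun u => (P lam u a : ℂ)) hf
    (Complex.continuous_ofReal.comp (continuous_P lam a))

theorem qFourier_P_mul {lam : ℝ} (hlam : 0 < lam) {ν : Measure S3NS} {f : S3NS → ℂ}
    (hf : Integrable f ν) (a : Fin 3) :
    qFourier lam ν (fun u => P lam u.1 a * f u) = Pop lam a (qFourier lam ν f) := by
  rw [Pop, ← qFourier_trace_mul hlam hf]
  simp only [trace_pauli_mul_coe hlam.ne']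

theorem Pop_eq_neg_I_smul_pd (lam : ℝ) (a : Fin 3) (h : Uhat) :
    Pop lam a h = -(Complex.I • pd lam a h) := by
  rw [pd, LinearMap.smul_apply, smul_smul, Complex.I_mul_I, neg_one_smul, neg_neg]

theorem pd_qFourier {lam : ℝ} (hlam : 0 < lam) {ν : Measure S3NS} {f : S3NS → ℂ}
    (hf : Integrable f ν) (a : Fin 3) :
    pd lam a (qFourier lam ν f) = Complex.I • qFourier lam ν (fun u => P lam u.1 a * f u) := by
  rw [qFourier_P_mul hlam hf, pd, LinearMap.smul_apply]

theorem integrable_shell_mul {lam : ℝ} (m : ℝ) {ν : Measure S3NS} {f : S3NS → ℂ}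
    (hf : Integrable f ν) : Integrable (fun u =>
      ((∑ a, P lam u.1 a ^ 2 - effMass lam m ^ 2 : ℝ) : ℂ) * f u) ν := by
  refine integrable_continuous_mul
    (g := fun u => ((∑ a, P lam u a ^ 2 - effMass lam m ^ 2 : ℝ) : ℂ)) hf
    (Complex.continuous_ofReal.comp ?_)
  exact (continuous_finsetSum _ fun a _ => (continuous_P lam a).pow 2).sub continuous_const

theorem lapl_add_mass_qFourier {lam : ℝ} (hlam : 0 < lam) (m : ℝ) {ν : Measure S3NS} {f : S3NS → ℂ}
    (hf : Integrable f ν) :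
    lapl lam (qFourier lam ν f) + ((effMass lam m : ℂ) ^ 2) • qFourier lam ν f =
      -qFourier lam ν (fun u => ((∑ a, P lam u.1 a ^ 2 - effMass lam m ^ 2 : ℝ) : ℂ) * f u) := by
  have h1 : ∀ a, pd lam a (pd lam a (qFourier lam ν f)) =
      -qFourier lam ν (fun u => (P lam u.1 a : ℂ) * (P lam u.1 a * f u)) := by
    intro a
    rw [pd_qFourier hlam hf, map_smul, pd_qFourier hlam (integrable_P_mul hf a), smul_smul,
      Complex.I_mul_I, neg_one_smul]
  have h2 : (fun u : S3NS => ((∑ a, P lam u.1 a ^ 2 - effMass lam m ^ 2 : ℝ) : ℂ) * f u) =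
      fun u => (∑ a, (P lam u.1 a : ℂ) * (P lam u.1 a * f u)) +
        -(effMass lam m : ℂ) ^ 2 * f u := by
    ext u
    push_cast
    rw [sub_mul, Finset.sum_mul, neg_mul, ← sub_eq_add_neg]
    congr 1
    exact Finset.sum_congr rfl fun a _ => by ring
  have hi : ∀ a ∈ (Finset.univ : Finset (Fin 3)),
      Integrable (fun u : S3NS => (P lam u.1 a : ℂ) * (P lam u.1 a * f u)) ν :=
    fun a _ => integrable_P_mul (integrable_P_mul hf a) a
  rw [h2, qFourier_add hlam (integrable_finsetSum _ hi) (hf.const_mul _), qFourier_sum hlam _ hi,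
    qFourier_const_mul hlam hf, lapl, neg_add, ← neg_smul, neg_neg, ← Finset.sum_neg_distrib]
  simp only [h1]

/-- Injectivity makes this an equivalence for any integrable function; relating it to the constraint
is then a pointwise matter. -/
theorem kleinGordon_iff_shell {lam : ℝ} (hlam : 0 < lam) (m : ℝ) {ν : Measure S3NS} {f : S3NS → ℂ}
    (hf : Integrable f ν) :
    lapl lam (qFourier lam ν f) + ((effMass lam m : ℂ) ^ 2) • qFourier lam ν f = 0 ↔
      ∀ᵐ u ∂ν, ((∑ a, P lam u.1 a ^ 2 - effMass lam m ^ 2 : ℝ) : ℂ) * f u = 0 := by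
  rw [lapl_add_mass_qFourier hlam m hf, neg_eq_zero,
    qFourier_eq_zero_iff hlam (integrable_shell_mul m hf)]
  rfl

theorem kleinGordon_spin_zero {lam : ℝ} (hlam : 0 < lam) (m : ℝ) {ν : Measure S3NS} {f : S3NS → ℂ}
    (hf : Integrable f ν) :
      ((∀ᵐ u ∂ν, P0 u.1 * f u = Real.cos (m * lam / 2) * f u) →
        lapl lam (qFourier lam ν f) + ((effMass lam m : ℂ) ^ 2) • qFourier lam ν f = 0) ∧
      ((∀ᵐ u ∂ν, u.1 ∉ patch lam m → f u = 0) →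
        ((∀ᵐ u ∂ν, P0 u.1 * f u = Real.cos (m * lam / 2) * f u) ↔
          lapl lam (qFourier lam ν f) + ((effMass lam m : ℂ) ^ 2) • qFourier lam ν f = 0)) := by
  rw [kleinGordon_iff_shell hlam m hf]
  refine ⟨fun h => ?_, fun hp => ?_⟩
  · filter_upwards [h] with u hu using scalar_constraint_imp hlam.ne' m u.1 _ hu
  · refine Filter.eventually_congr ?_
    filter_upwards [hp] with u hu
    -- Off the hemisphere the field is zero, and both conditions hold trivially.
    by_cases hu' : u.1 ∈ patch lam m
    · exact scalar_constraint_iff hlam.ne' hu' _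
    · simp [hu hu']

/-- The overall sign comes from `i ∂_a = -P_a`, which turns the position space Dirac operator into
minus the momentum space one. -/
theorem dirac_apply_qFourierVec {lam : ℝ} (hlam : 0 < lam) (m : ℝ) {ν : Measure S3NS}
    {φ : S3NS → Fin 2 → ℂ} (hφ : ∀ i, Integrable (fun u => φ u i) ν) (i : Fin 2) :
    (Complex.I • dirac lam (qFourierVec lam ν φ) -
      (effMass lam m : ℂ) • qFourierVec lam ν φ) i =
      -qFourier lam ν (fun u => (slash (Pvec lam u.1) *ᵥ φ u + (effMass lam m : ℂ) • φ u) i) := by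
  have h1 : (fun u : S3NS => (slash (Pvec lam u.1) *ᵥ φ u + (effMass lam m : ℂ) • φ u) i) =
      fun u => (∑ a, ∑ j, pauli a i j * (P lam u.1 a * φ u j)) + effMass lam m * φ u i := by
    ext u
    rw [Pi.add_apply, Pi.smul_apply, smul_eq_mul, slash_eq_sum, Matrix.sum_mulVec, Finset.sum_apply]
    congr 1
    refine Finset.sum_congr rfl fun a _ => ?_
    rw [Matrix.smul_mulVec, Pi.smul_apply, smul_eq_mul, Matrix.mulVec, dotProduct, Finset.mul_sum]
    exact Finset.sum_congr rfl fun j _ => by rw [Pvec]; ring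
  have hi : ∀ a j, Integrable (fun u : S3NS => pauli a i j * (P lam u.1 a * φ u j)) ν :=
    fun a j => (integrable_P_mul (hφ j) a).const_mul _
  rw [h1, qFourier_add hlam (integrable_finsetSum _ fun a _ => integrable_finsetSum _ fun j _ => hi a j)
    ((hφ i).const_mul _), qFourier_sum hlam _ fun a _ => integrable_finsetSum _ fun j _ => hi a j,
    qFourier_const_mul hlam (hφ i), neg_add, ← sub_eq_add_neg]
  change Complex.I • (∑ a, ∑ j, pauli a i j • pd lam a (qFourier lam ν fun u => φ u j)) -
    (effMass lam m : ℂ) • qFourier lam ν (fun u => φ u i) = _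
  congr 1
  rw [Finset.smul_sum, ← Finset.sum_neg_distrib]
  refine Finset.sum_congr rfl fun a _ => ?_
  rw [qFourier_sum hlam _ fun j _ => hi a j, Finset.smul_sum, ← Finset.sum_neg_distrib]
  refine Finset.sum_congr rfl fun j _ => ?_
  rw [qFourier_const_mul hlam (integrable_P_mul (hφ j) a), pd_qFourier hlam (hφ j), smul_smul,
    smul_smul, mul_right_comm, Complex.I_mul_I, neg_one_mul, neg_smul]

theorem forall_ae_eq_zero_iff {Y : Type*} [MeasurableSpace Y] {ν : Measure Y} {k : ℕ}
    (v : Y → Fin k → ℂ) : (∀ i, (fun u => v u i) =ᵐ[ν] 0) ↔ ∀ᵐ u ∂ν, v u = 0 := by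
  simp only [funext_iff, ae_all_iff]
  rfl

theorem dirac_iff {lam : ℝ} (hlam : 0 < lam) (m : ℝ) {ν : Measure S3NS}
    {φ : S3NS → Fin 2 → ℂ} (hφ : ∀ i, Integrable (fun u => φ u i) ν) :
    Complex.I • dirac lam (qFourierVec lam ν φ) - (effMass lam m : ℂ) • qFourierVec lam ν φ = 0 ↔
      ∀ᵐ u ∂ν, slash (Pvec lam u.1) *ᵥ φ u + (effMass lam m : ℂ) • φ u = 0 := by
  have hint : ∀ i, Integrable (fun u : S3NS =>
      (slash (Pvec lam u.1) *ᵥ φ u + (effMass lam m : ℂ) • φ u) i) ν := by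
    intro i
    have h1 : Integrable (fun u : S3NS => ∑ j, slash (Pvec lam u.1) i j * φ u j) ν := ?_
    · exact h1.add ((hφ i).const_mul (effMass lam m : ℂ))
    refine integrable_finsetSum _ fun j _ => ?_
    refine integrable_continuous_mul (g := fun u => slash (Pvec lam u) i j) (hφ j) ?_
    have hcont : Continuous fun u : SU2 => slash (Pvec lam u) := by
      simp only [slash_eq_sum]
      exact continuous_finsetSum _ fun a _ => Continuous.smul
        (Complex.continuous_ofReal.comp (continuous_P lam a)) continuous_const
    exact hcont.matrix_elem i j
  rw [funext_iff]
  simp only [dirac_apply_qFourierVec hlam m hφ]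
  change (∀ i, -qFourier lam ν _ = 0) ↔ _
  simp only [neg_eq_zero, qFourier_eq_zero_iff hlam (hint _)]
  exact forall_ae_eq_zero_iff _

theorem dirac_spin_half {lam : ℝ} (hlam : 0 < lam) (m : ℝ) {ν : Measure S3NS} {φ : S3NS → E 1}
    {Φ : Fin 2 → Uhat} (hφ : Integrable φ ν)
    (hΦ : Φ = qFourierVec lam ν (fun u => (φ u).ofLp)) :
      ((∀ᵐ u ∂ν, Constraint lam m 1 u.1 (φ u)) →
        Complex.I • dirac lam Φ - (effMass lam m : ℂ) • Φ = 0 ∧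
        ∀ c, lapl lam (Φ c) + ((effMass lam m : ℂ) ^ 2) • Φ c = 0) ∧
      ((∀ᵐ u ∂ν, u.1 ∉ patch lam m → φ u = 0) →
        ((∀ᵐ u ∂ν, Constraint lam m 1 u.1 (φ u)) ↔
          Complex.I • dirac lam Φ - (effMass lam m : ℂ) • Φ = 0)) := by
  have hc : ∀ i, Integrable (fun u => (φ u).ofLp i) ν := fun i =>
    (EuclideanSpace.proj (𝕜 := ℂ) i).integrable_comp hφ
  subst hΦ
  rw [dirac_iff hlam m hc]
  refine ⟨fun h => ?_, fun hp => ?_⟩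
  · have h1 : ∀ᵐ u ∂ν, slash (Pvec lam u.1) *ᵥ (φ u).ofLp + (effMass lam m : ℂ) • (φ u).ofLp = 0 := by
      filter_upwards [h] with u hu using constraint_one_imp_dirac hlam.ne' hu
    refine ⟨h1, fun c => (kleinGordon_iff_shell hlam m (hc c)).2 ?_⟩
    filter_upwards [h1] with u hu using congrFun (shell_of_dirac hu) c
  · refine Filter.eventually_congr ?_
    filter_upwards [hp] with u hu
    by_cases hu' : u.1 ∈ patch lam m
    · exact constraint_one_iff_dirac hlam.ne' hu' _
    · rw [constraint_one_iff, hu hu']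
      simp

theorem pd_qFourier_sub {lam : ℝ} (hlam : 0 < lam) {ν : Measure S3NS} {f g : S3NS → ℂ}
    (hf : Integrable f ν) (hg : Integrable g ν) (a b : Fin 3) :
    pd lam a (qFourier lam ν f) - pd lam b (qFourier lam ν g) =
      Complex.I • qFourier lam ν (fun u => P lam u.1 a * f u - P lam u.1 b * g u) := by
  have h : (fun u : S3NS => (P lam u.1 a : ℂ) * f u - P lam u.1 b * g u) =
      fun u => P lam u.1 a * f u + (-1) * (P lam u.1 b * g u) := by
    ext u; ring
  rw [h, qFourier_add hlam (integrable_P_mul hf a) ((integrable_P_mul hg b).const_mul _),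
    qFourier_const_mul hlam (integrable_P_mul hg b), pd_qFourier hlam hf, pd_qFourier hlam hg,
    neg_one_smul, smul_add, smul_neg, sub_eq_add_neg]

theorem curl_apply_qFourierVec {lam : ℝ} (hlam : 0 < lam) {ν : Measure S3NS}
    {φ : S3NS → Fin 3 → ℂ} (hφ : ∀ i, Integrable (fun u => φ u i) ν) (i : Fin 3) :
    curl lam (qFourierVec lam ν φ) i =
      Complex.I • qFourier lam ν (fun u => crossProduct (Pvec lam u.1) (φ u) i) := by
  fin_cases i
  · exact pd_qFourier_sub hlam (hφ 2) (hφ 1) 1 2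
  · exact pd_qFourier_sub hlam (hφ 0) (hφ 2) 2 0
  · exact pd_qFourier_sub hlam (hφ 1) (hφ 0) 0 1

/-- Since `∂_a = i P_a`, the left side is the transform of `i (P × φ - i M φ)`, and the factor `i`
is invertible. -/
theorem curl_iff {lam : ℝ} (hlam : 0 < lam) (m : ℝ) {ν : Measure S3NS}
    {φ : S3NS → Fin 3 → ℂ} (hφ : ∀ i, Integrable (fun u => φ u i) ν) :
    curl lam (qFourierVec lam ν φ) + (effMass lam m : ℂ) • qFourierVec lam ν φ = 0 ↔
      ∀ᵐ u ∂ν, crossProduct (Pvec lam u.1) (φ u) - (Complex.I * effMass lam m) • φ u = 0 := by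
  have hcr : ∀ i, Integrable (fun u : S3NS => crossProduct (Pvec lam u.1) (φ u) i) ν := by
    intro i
    fin_cases i
    · exact (integrable_P_mul (hφ 2) 1).sub (integrable_P_mul (hφ 1) 2)
    · exact (integrable_P_mul (hφ 0) 2).sub (integrable_P_mul (hφ 2) 0)
    · exact (integrable_P_mul (hφ 1) 0).sub (integrable_P_mul (hφ 0) 1)
  have key : ∀ i, (curl lam (qFourierVec lam ν φ) +
      (effMass lam m : ℂ) • qFourierVec lam ν φ) i = Complex.I • qFourier lam ν (fun u =>
        (crossProduct (Pvec lam u.1) (φ u) - (Complex.I * effMass lam m) • φ u) i) := by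
    intro i
    have h : (fun u : S3NS => (crossProduct (Pvec lam u.1) (φ u) -
        (Complex.I * effMass lam m) • φ u) i) = fun u => crossProduct (Pvec lam u.1) (φ u) i +
          -(Complex.I * effMass lam m) * φ u i := by
      ext u
      simp [sub_eq_add_neg]
    rw [h, qFourier_add hlam (hcr i) ((hφ i).const_mul _), qFourier_const_mul hlam (hφ i),
      smul_add, smul_smul, Pi.add_apply, curl_apply_qFourierVec hlam hφ]
    have : Complex.I * -(Complex.I * (effMass lam m : ℂ)) = effMass lam m := by
      linear_combination -(effMass lam m : ℂ) * Complex.I_sq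
    rw [this]
    rfl
  have hint : ∀ i, Integrable (fun u : S3NS => (crossProduct (Pvec lam u.1) (φ u) -
        (Complex.I * effMass lam m) • φ u) i) ν := fun i => (hcr i).sub ((hφ i).const_mul _)
  rw [funext_iff]
  simp only [key]
  change (∀ i, Complex.I • qFourier lam ν _ = 0) ↔ _
  simp only [smul_eq_zero, Complex.I_ne_zero, false_or, qFourier_eq_zero_iff hlam (hint _)]
  exact forall_ae_eq_zero_iff _

theorem divg_qFourierVec {lam : ℝ} (hlam : 0 < lam) {ν : Measure S3NS}
    {φ : S3NS → Fin 3 → ℂ} (hφ : ∀ i, Integrable (fun u => φ u i) ν) :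
    divg lam (qFourierVec lam ν φ) =
      Complex.I • qFourier lam ν (fun u => Pvec lam u.1 ⬝ᵥ φ u) := by
  simp only [dotProduct, Pvec]
  rw [qFourier_sum hlam _ fun a _ => integrable_P_mul (hφ a) a, Finset.smul_sum]
  exact Finset.sum_congr rfl fun a _ => pd_qFourier hlam (hφ a) a

theorem curl_spin_one {lam m : ℝ} (hlam : 0 < lam) (hm : 0 < m) (hm' : m < 2 * Real.pi / lam)
    {ν : Measure S3NS} {φ : S3NS → Fin 3 → ℂ}
    {Φ : Fin 3 → Uhat} (hφ : Integrable φ ν) (hΦ : Φ = qFourierVec lam ν φ) :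
      ((∀ᵐ u ∂ν, CartConstraint lam m u.1 (φ u)) →
        divg lam Φ = 0 ∧ ∀ c, lapl lam (Φ c) + ((effMass lam m : ℂ) ^ 2) • Φ c = 0) ∧
      (m * lam ≠ Real.pi → (∀ᵐ u ∂ν, u.1 ∉ patch lam m → φ u = 0) →
        ((∀ᵐ u ∂ν, CartConstraint lam m u.1 (φ u)) ↔
          curl lam Φ + (effMass lam m : ℂ) • Φ = 0)) := by
  have hc : ∀ i, Integrable (fun u => φ u i) ν := fun i =>
    (ContinuousLinearMap.proj (R := ℂ) (φ := fun _ : Fin 3 => ℂ) i).integrable_comp hφ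
  subst hΦ
  rw [curl_iff hlam m hc]
  refine ⟨fun h => ⟨?_, fun c => (kleinGordon_iff_shell hlam m (hc c)).2 ?_⟩, fun hpi hp => ?_⟩
  · have hint : Integrable (fun u : S3NS => Pvec lam u.1 ⬝ᵥ φ u) ν :=
      integrable_finsetSum _ fun a _ => integrable_P_mul (hc a) a
    rw [divg_qFourierVec hlam hc, (qFourier_eq_zero_iff hlam hint).2, smul_zero]
    filter_upwards [h] with u hu using dotProduct_eq_zero_of_cartConstraint hlam hm hm' hu
  · filter_upwards [h] with u hu using congrFun (shell_of_cartConstraint hlam hm hm' hu) c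
  · refine Filter.eventually_congr ?_
    filter_upwards [hp] with u hu
    by_cases hu' : u.1 ∈ patch lam m
    · exact cartConstraint_iff_curl hlam hm hm' hpi hu' _
    · rw [cartConstraint_iff, hu hu']
      simp [slash_zero]

/-! ### The orbit map -/

theorem orbitPt_inv_mul (lam m : ℝ) (g v : SU2) :
    orbitPt lam m (g⁻¹ * v) = g⁻¹ * orbitPt lam m v * g := by
  simp only [orbitPt]; group

theorem torus_mul_comm (α β : ℝ) : torus α * torus β = torus β * torus α := by
  rw [← torus_add, add_comm, torus_add]

theorem orbitPt_mul_torus (lam m : ℝ) (v : SU2) (α : ℝ) :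
    orbitPt lam m (v * torus α) = orbitPt lam m v := by
  rw [orbitPt, orbitPt, mul_inv_rev, mul_assoc v, torus_mul_comm]
  group

theorem continuous_orbitPt (lam m : ℝ) : Continuous (orbitPt lam m) :=
  (continuous_id.mul continuous_const).mul continuous_inv

theorem orbitPt_ne {lam m : ℝ} (hlam : 0 < lam) (hm : 0 < m) (hm' : m < 2 * Real.pi / lam)
    (v : SU2) : (orbitPt lam m v).1 ≠ 1 ∧ (orbitPt lam m v).1 ≠ -1 := by
  obtain ⟨h1, h2⟩ := half_angle_mem hlam hm hm'
  have h := P0_orbitPt lam m v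
  have hs := sin_half_angle_pos hlam hm hm'
  have hsc := Real.sin_sq_add_cos_sq (m * lam / 2)
  constructor <;> intro h0 <;> rw [P0_eq_re, h0] at h <;> simp at h <;> nlinarith

/-- The orbit map with values in the sphere without poles. -/
def orbitNS {lam m : ℝ} (hlam : 0 < lam) (hm : 0 < m) (hm' : m < 2 * Real.pi / lam)
    (v : SU2) : S3NS := ⟨orbitPt lam m v, orbitPt_ne hlam hm hm' v⟩

/-- The torus element has distinct eigenvalues because the sine of the half angle is nonzero.
Commuting with it forces the off-diagonal entry to vanish, and unitarity makes the diagonal entry a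
phase. -/
theorem exists_torus_of_commute {lam m : ℝ} (hlam : 0 < lam) (hm : 0 < m)
    (hm' : m < 2 * Real.pi / lam) {w : SU2} (h : w * torus (m * lam) = torus (m * lam) * w) :
    ∃ α, w = torus α := by
  have hs := sin_half_angle_pos hlam hm hm'
  have h01 := congrFun (congrFun (congrArg Subtype.val h) 0) 1
  simp only [Submonoid.coe_mul, torus_coe, Matrix.mul_diagonal, Matrix.diagonal_mul,
    Matrix.cons_val_zero, Matrix.cons_val_one] at h01
  have e1 : Complex.exp (-(Complex.I * ((m * lam : ℝ) : ℂ) / 2)) =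
      (Real.cos (m * lam / 2) : ℂ) - Complex.I * (Real.sin (m * lam / 2) : ℂ) := by
    rw [← exp_half_angle]; congr 1; push_cast; ring
  have e2 : Complex.exp (Complex.I * ((m * lam : ℝ) : ℂ) / 2) =
      (Real.cos (m * lam / 2) : ℂ) + Complex.I * (Real.sin (m * lam / 2) : ℂ) := by
    rw [Complex.ofReal_cos, Complex.ofReal_sin, mul_comm Complex.I (Complex.sin _),
      ← Complex.exp_mul_I]
    congr 1; push_cast; ring
  have hs' : (Real.sin (m * lam / 2) : ℂ) ≠ 0 := by exact_mod_cast hs.ne'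
  have hb : w.1 0 1 = 0 := by
    rw [e1, e2] at h01
    have : (Complex.I * (Real.sin (m * lam / 2) : ℂ)) * w.1 0 1 = 0 := by
      linear_combination -h01 / 2
    simpa [hs', -Complex.ofReal_sin] using this
  have hn : ‖w.1 0 0‖ = 1 := by
    have := normSq_entries w
    rw [hb] at this
    rw [← sq_eq_sq₀ (norm_nonneg _) zero_le_one, ← Complex.normSq_eq_norm_sq, Complex.normSq_apply]
    simp at this
    linarith
  -- The factor 2 compensates for the half angles in `torus`.
  refine ⟨2 * (w.1 0 0).arg, ?_⟩
  have ha : Complex.exp (Complex.I * ((2 * (w.1 0 0).arg : ℝ) : ℂ) / 2) = w.1 0 0 := by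
    have := Complex.norm_mul_exp_arg_mul_I (w.1 0 0)
    rw [hn] at this
    rw [Complex.ofReal_one, one_mul] at this
    refine Eq.trans ?_ this
    congr 1
    push_cast
    ring
  have hd : Complex.exp (-(Complex.I * ((2 * (w.1 0 0).arg : ℝ) : ℂ) / 2)) =
      (starRingEnd ℂ) (w.1 0 0) := by
    rw [← ha, ← Complex.exp_conj, ha]
    congr 1
    simp [Complex.conj_ofNat, neg_div]
  apply Subtype.ext
  rw [torus_coe, ha, hd]
  ext i j
  fin_cases i <;> fin_cases j <;> simp [hb, entry_one_one, entry_one_zero]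

/-- Two elements over the same orbit point differ by the centraliser of the base point, which is the
torus. -/
theorem exists_torus_of_orbitPt_eq {lam m : ℝ} (hlam : 0 < lam) (hm : 0 < m)
    (hm' : m < 2 * Real.pi / lam) {v w : SU2} (h : orbitPt lam m v = orbitPt lam m w) :
    ∃ α, w = v * torus α := by
  obtain ⟨α, hα⟩ := exists_torus_of_commute hlam hm hm' (w := v⁻¹ * w) (by
    have h1 : v⁻¹ * (v * torus (m * lam) * v⁻¹) * w = v⁻¹ * (w * torus (m * lam) * w⁻¹) * w := by
      simp only [orbitPt] at h
      rw [h]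
    calc v⁻¹ * w * torus (m * lam) = v⁻¹ * (w * torus (m * lam) * w⁻¹) * w := by group
      _ = v⁻¹ * (v * torus (m * lam) * v⁻¹) * w := h1.symm
      _ = torus (m * lam) * (v⁻¹ * w) := by group)
  exact ⟨α, by rw [← hα, mul_inv_cancel_left]⟩

/-! ### Monopole sections and fields on the orbit -/

theorem constraint_orbitPt (lam m : ℝ) (n : ℕ) (v : SU2) (c : ℂ) :
    Constraint lam m n (orbitPt lam m v) (c • spin n v (lowest n)) := by
  rw [Constraint, map_smul, smul_comm, orbitPt, mul_assoc, spin_mul, spin_mul, spin_inv_spin,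
    spin_torus_lowest, map_smul]
  congr 2
  push_cast
  ring_nf

/-- Translation back by `v` gives an eigenvector of a diagonal matrix. Genericity says that no other
weight has the phase of the lowest one, so only the last coordinate survives; the inner product
recovers it because the lowest weight vector is normalised. -/
theorem eq_smul_of_constraint_orbitPt {lam m : ℝ} {n : ℕ} (hgen : Generic lam m n) {v : SU2}
    {x : E n} (h : Constraint lam m n (orbitPt lam m v) x) :
    x = inner ℂ (spin n v (lowest n)) x • spin n v (lowest n) := by
  set y := spin n v⁻¹ x with hy
  have hx : x = spin n v y := (spin_spin_inv n v x).symm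
  have h1 : spin n (torus (m * lam)) y = Complex.exp (-(Complex.I * m * lam * (n / 2))) • y := by
    rw [Constraint, orbitPt, spin_mul, spin_mul, ← hy] at h
    have h2 := congrArg (spin n v⁻¹) h
    rwa [spin_inv_spin, map_smul] at h2
  have h2 : ∀ k : Fin (n + 1), k ≠ Fin.last n → y k = 0 := by
    intro k hk
    have hk1 : (k : ℕ) < n := lt_of_le_of_ne (Nat.lt_succ_iff.1 k.2) fun h => hk (Fin.ext h)
    have h3 : spin n (torus (m * lam)) y k =
      (Complex.exp (-(Complex.I * m * lam * (n / 2))) • y) k := by rw [h1]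
    rw [spin_torus_apply, PiLp.smul_apply, smul_eq_mul] at h3
    by_contra h0
    have h4 := mul_right_cancel₀ h0 h3
    rw [Complex.exp_eq_exp_iff_exists_int] at h4
    obtain ⟨j, hj⟩ := h4
    -- The `k`-th weight lies `n - k` steps above the lowest, so equal phases would make `(n - k) m
    -- λ` a multiple of `2π`.
    refine hgen (n - k) (by omega) (by omega) j ?_
    have h5 : (((n - (k : ℕ) : ℕ) : ℝ) * (m * lam) : ℂ) = 2 * Real.pi * j := by
      rw [Nat.cast_sub hk1.le]
      have hI : Complex.I ≠ 0 := Complex.I_ne_zero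
      apply mul_left_cancel₀ hI
      push_cast at hj ⊢
      linear_combination hj
    exact_mod_cast h5
  have h3 : y = y (Fin.last n) • lowest n := by
    ext k
    rw [PiLp.smul_apply, lowest, smul_eq_mul]
    by_cases hk : k = Fin.last n
    · subst hk; simp
    · simp [hk, h2 k hk]
  have h4 : x = y (Fin.last n) • spin n v (lowest n) := by
    nth_rewrite 1 [hx]
    nth_rewrite 1 [h3]
    rw [map_smul]
  nth_rewrite 2 [h4]
  rw [inner_smul_right, inner_spin_spin, inner_lowest, mul_one]
  exact h4

/-- The phase of the section and that of the lowest weight vector cancel along the torus; this makes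
the choice of preimage in `toField` immaterial. -/
theorem smul_spin_lowest_eq {lam m : ℝ} (hlam : 0 < lam) (hm : 0 < m)
    (hm' : m < 2 * Real.pi / lam) {n : ℕ} {ψ : SU2 → ℂ} (hψ : ψ ∈ V n) {v w : SU2}
    (h : orbitPt lam m v = orbitPt lam m w) :
    ψ v • spin n v (lowest n) = ψ w • spin n w (lowest n) := by
  obtain ⟨α, rfl⟩ := exists_torus_of_orbitPt_eq hlam hm hm' h
  rw [hψ α v, spin_mul, spin_torus_lowest, map_smul, smul_smul, mul_right_comm, ← Complex.exp_add,
    add_neg_cancel, Complex.exp_zero, one_mul]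

open Classical in
/-- The field on the orbit that corresponds to a monopole section. -/
def toField (lam m : ℝ) (n : ℕ) (ψ : SU2 → ℂ) : S3NS → E n := fun u =>
  if h : u.1 ∈ conjClass lam m then ψ h.choose • spin n h.choose (lowest n) else 0

theorem toField_apply {lam m : ℝ} (hlam : 0 < lam) (hm : 0 < m)
    (hm' : m < 2 * Real.pi / lam) {n : ℕ} {ψ : SU2 → ℂ} (hψ : ψ ∈ V n) {v : SU2} {u : S3NS}
    (h : u.1 = orbitPt lam m v) : toField lam m n ψ u = ψ v • spin n v (lowest n) := by
  have hu : u.1 ∈ conjClass lam m := ⟨v, h.symm⟩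
  rw [toField, dif_pos hu]
  exact smul_spin_lowest_eq hlam hm hm' hψ (hu.choose_spec.trans h)

theorem toField_of_notMem {lam m : ℝ} {n : ℕ} {ψ : SU2 → ℂ} {u : S3NS}
    (hu : u.1 ∉ conjClass lam m) : toField lam m n ψ u = 0 := dif_neg hu

theorem toField_mem {lam m : ℝ} {n : ℕ} {ψ : SU2 → ℂ} : toField lam m n ψ ∈ Wsupp lam m n := by
  refine ⟨fun u => ?_, fun u hu => toField_of_notMem hu⟩
  by_cases hu : u.1 ∈ conjClass lam m
  · have := constraint_orbitPt lam m n hu.choose (ψ hu.choose)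
    rw [hu.choose_spec] at this
    rw [toField, dif_pos hu]
    exact this
  · rw [toField_of_notMem hu, Constraint, map_zero, smul_zero]

/-- The section that corresponds to a field on the orbit. -/
def toSection {lam m : ℝ} (hlam : 0 < lam) (hm : 0 < m) (hm' : m < 2 * Real.pi / lam) (n : ℕ)
    (φ : S3NS → E n) : SU2 → ℂ :=
  fun v => inner ℂ (spin n v (lowest n)) (φ (orbitNS hlam hm hm' v))

/-- The inner product is conjugate linear in its first argument, which turns the lowest weight phase
into the phase required by `V n`. -/
theorem toSection_mem {lam m : ℝ} (hlam : 0 < lam) (hm : 0 < m) (hm' : m < 2 * Real.pi / lam)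
    (n : ℕ) (φ : S3NS → E n) : toSection hlam hm hm' n φ ∈ V n := by
  intro α v
  have : orbitNS hlam hm hm' (v * torus α) = orbitNS hlam hm hm' v :=
    Subtype.ext (orbitPt_mul_torus lam m v α)
  rw [toSection, toSection, this, spin_mul, spin_torus_lowest, map_smul, inner_smul_left,
    ← Complex.exp_conj]
  congr 2
  simp [Complex.conj_ofNat]

theorem toSection_toField {lam m : ℝ} (hlam : 0 < lam) (hm : 0 < m)
    (hm' : m < 2 * Real.pi / lam) {n : ℕ} {ψ : SU2 → ℂ} (hψ : ψ ∈ V n) :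
    toSection hlam hm hm' n (toField lam m n ψ) = ψ := by
  ext v
  rw [toSection, toField_apply hlam hm hm' hψ (u := orbitNS hlam hm hm' v) rfl, inner_smul_right,
    inner_spin_spin, inner_lowest, mul_one]

theorem apply_orbitNS_eq {lam m : ℝ} (hlam : 0 < lam) (hm : 0 < m)
    (hm' : m < 2 * Real.pi / lam) {n : ℕ} (hgen : Generic lam m n) {φ : S3NS → E n}
    (hφ : φ ∈ W lam m n) (v : SU2) : φ (orbitNS hlam hm hm' v) =
      toSection hlam hm hm' n φ v • spin n v (lowest n) :=
  eq_smul_of_constraint_orbitPt hgen (hφ (orbitNS hlam hm hm' v))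

/-- The other composite is the identity without genericity. Here genericity is essential, because a
field could otherwise have components orthogonal to the translated lowest weight vector. -/
theorem toField_toSection {lam m : ℝ} (hlam : 0 < lam) (hm : 0 < m)
    (hm' : m < 2 * Real.pi / lam) {n : ℕ} (hgen : Generic lam m n) {φ : S3NS → E n}
    (hφ : φ ∈ Wsupp lam m n) : toField lam m n (toSection hlam hm hm' n φ) = φ := by
  ext1 u
  by_cases hu : u.1 ∈ conjClass lam m
  · obtain ⟨v, hv⟩ := hu
    rw [toField_apply hlam hm hm' (toSection_mem hlam hm hm' n φ) hv.symm,
      ← apply_orbitNS_eq hlam hm hm' hgen hφ.1]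
    congr 1
    exact Subtype.ext hv
  · rw [toField_of_notMem hu, hφ.2 u hu]

/-- The isomorphism of monopole sections with constrained fields on the orbit. -/
def sectionEquiv {lam m : ℝ} (hlam : 0 < lam) (hm : 0 < m)
    (hm' : m < 2 * Real.pi / lam) {n : ℕ} (hgen : Generic lam m n) : V n ≃ₗ[ℂ] Wsupp lam m n where
  toFun ψ := ⟨toField lam m n ψ.1, toField_mem⟩
  map_add' ψ χ := by
    apply Subtype.ext
    ext1 u
    by_cases hu : u.1 ∈ conjClass lam m
    · simp [toField, hu, add_smul]
    · simp [toField, hu]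
  map_smul' c ψ := by
    apply Subtype.ext
    ext1 u
    by_cases hu : u.1 ∈ conjClass lam m
    · simp [toField, hu, mul_smul]
    · simp [toField, hu]
  invFun φ := ⟨toSection hlam hm hm' n φ.1, toSection_mem hlam hm hm' n φ.1⟩
  left_inv ψ := Subtype.ext (toSection_toField hlam hm hm' ψ.2)
  right_inv φ := Subtype.ext (toField_toSection hlam hm hm' hgen φ.2)

/-! ### Singular elements of the double -/

theorem singV_mem (lam m : ℝ) {n : ℕ} (g : SU2) (f : C(SU2, ℂ)) {ψ : SU2 → ℂ} (hψ : ψ ∈ V n) :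
    singV lam m g f ψ ∈ V n := by
  intro α v
  rw [singV, singV, orbitPt_mul_torus, ← mul_assoc, hψ α, mul_left_comm]

theorem mem_conjClass_conj_iff {lam m : ℝ} (g u : SU2) :
    g⁻¹ * u * g ∈ conjClass lam m ↔ u ∈ conjClass lam m := by
  constructor
  · rintro ⟨w, hw⟩
    refine ⟨g * w, ?_⟩
    rw [← inv_inv g, orbitPt_inv_mul, hw]
    group
  · rintro ⟨w, rfl⟩
    exact ⟨g⁻¹ * w, orbitPt_inv_mul lam m g w⟩

/-- This rests on `ρ(u) ρ(g) = ρ(g) ρ(g⁻¹ u g)`. -/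
theorem constraint_conj {lam m : ℝ} {n : ℕ} {g u : SU2} {x : E n}
    (h : Constraint lam m n (g⁻¹ * u * g) x) (c : ℂ) : Constraint lam m n u (c • spin n g x) := by
  rw [Constraint] at h ⊢
  rw [map_smul, smul_comm, ← map_smul (spin n g), ← h, ← spin_mul, ← spin_mul]
  congr 3
  group

theorem singW_mem_W {lam m : ℝ} {n : ℕ} (g : SU2) (f : C(SU2, ℂ)) {φ : S3NS → E n}
    (hφ : φ ∈ W lam m n) : singW n g f φ ∈ W lam m n :=
  fun u => constraint_conj (hφ (u.conj g)) _

theorem singW_mem_Wsupp {lam m : ℝ} {n : ℕ} (g : SU2) (f : C(SU2, ℂ)) {φ : S3NS → E n}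
    (hφ : φ ∈ Wsupp lam m n) : singW n g f φ ∈ Wsupp lam m n := by
  refine ⟨singW_mem_W g f hφ.1, fun u hu => ?_⟩
  rw [singW, hφ.2 (u.conj g) fun h => hu ((mem_conjClass_conj_iff g u.1).1 h), map_zero, smul_zero]

theorem conj_one (u : S3NS) : u.conj 1 = u := by
  apply Subtype.ext
  simp [S3NS.conj]

theorem conj_mul (g h : SU2) (u : S3NS) : u.conj (g * h) = (u.conj g).conj h := by
  apply Subtype.ext
  simp only [S3NS.conj]
  group

theorem singV_one (lam m : ℝ) (ψ : SU2 → ℂ) : singV lam m 1 1 ψ = ψ := by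
  ext v; simp [singV]

theorem singW_one {n : ℕ} (φ : S3NS → E n) : singW n 1 1 φ = φ := by
  ext1 u; simp [singW, conj_one, spin_one]

theorem singV_singV (lam m : ℝ) (g₁ : SU2) (f₁ : C(SU2, ℂ)) (g₂ : SU2) (f₂ : C(SU2, ℂ))
    (ψ : SU2 → ℂ) : singV lam m g₁ f₁ (singV lam m g₂ f₂ ψ) =
      singV lam m (g₁ * g₂) (singMul f₁ g₂ f₂) ψ := by
  ext v
  have h1 : g₂ * ((g₁ * g₂)⁻¹ * orbitPt lam m v * (g₁ * g₂)) * g₂⁻¹ =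
      g₁⁻¹ * orbitPt lam m v * g₁ := by group
  have h2 : (g₁ * g₂)⁻¹ * orbitPt lam m v * (g₁ * g₂) =
      g₂⁻¹ * orbitPt lam m (g₁⁻¹ * v) * g₂ := by rw [orbitPt_inv_mul]; group
  have h3 : (g₁ * g₂)⁻¹ * v = g₂⁻¹ * (g₁⁻¹ * v) := by group
  simp only [singV, singMul, ContinuousMap.coe_mk]
  rw [h1, h2, h3, ← mul_assoc (f₁ _)]

theorem singW_singW {n : ℕ} (g₁ : SU2) (f₁ : C(SU2, ℂ)) (g₂ : SU2) (f₂ : C(SU2, ℂ))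
    (φ : S3NS → E n) : singW n g₁ f₁ (singW n g₂ f₂ φ) =
      singW n (g₁ * g₂) (singMul f₁ g₂ f₂) φ := by
  ext1 u
  have h1 : g₂ * ((g₁ * g₂)⁻¹ * u.1 * (g₁ * g₂)) * g₂⁻¹ = g₁⁻¹ * u.1 * g₁ := by group
  have h2 : (g₁ * g₂)⁻¹ * u.1 * (g₁ * g₂) = g₂⁻¹ * (u.conj g₁).1 * g₂ := by
    simp only [S3NS.conj]; group
  simp only [singW, singMul, ContinuousMap.coe_mk, conj_mul, spin_mul, map_smul, smul_smul]
  rw [h1, h2]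

theorem conj_orbitNS {lam m : ℝ} (hlam : 0 < lam) (hm : 0 < m) (hm' : m < 2 * Real.pi / lam)
    (g v : SU2) : (orbitNS hlam hm hm' v).conj g = orbitNS hlam hm hm' (g⁻¹ * v) :=
  Subtype.ext (orbitPt_inv_mul lam m g v).symm

theorem toField_singV {lam m : ℝ} (hlam : 0 < lam) (hm : 0 < m)
    (hm' : m < 2 * Real.pi / lam) {n : ℕ} (g : SU2) (f : C(SU2, ℂ)) {ψ : SU2 → ℂ} (hψ : ψ ∈ V n) :
    toField lam m n (singV lam m g f ψ) = singW n g f (toField lam m n ψ) := by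
  ext1 u
  by_cases hu : u.1 ∈ conjClass lam m
  · obtain ⟨v, hv⟩ := hu
    have hc : (u.conj g).1 = orbitPt lam m (g⁻¹ * v) := by
      rw [orbitPt_inv_mul, hv]; rfl
    rw [toField_apply hlam hm hm' (singV_mem lam m g f hψ) hv.symm, singW,
      toField_apply hlam hm hm' hψ hc, map_smul, ← spin_mul, mul_inv_cancel_left, smul_smul, singV, hv]
  · rw [toField_of_notMem hu, (singW_mem_Wsupp g f toField_mem).2 u hu]

/-! ### Haar measure -/

instance : haar.IsHaarMeasure := inferInstanceAs (Measure.haarMeasure ⊤).IsHaarMeasure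

theorem haar_univ : haar (Set.univ : Set SU2) = 1 := by
  simpa [haar] using Measure.haarMeasure_self (K₀ := (⊤ : TopologicalSpace.PositiveCompacts SU2))

instance : IsProbabilityMeasure haar := ⟨haar_univ⟩

/-- Conjugation is a continuous surjective endomorphism of a compact group and so preserves Haar
probability; right translation is a conjugation followed by a left translation. -/
instance : haar.IsMulRightInvariant where
  map_mul_right_eq_self g := by
    have h1 : MeasurePreserving (MulAut.conj g⁻¹).toMonoidHom haar haar := by
      refine MonoidHom.measurePreserving ?_ (MulAut.conj g⁻¹).surjective rfl
      change Continuous fun x : SU2 => g⁻¹ * x * g⁻¹⁻¹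
      fun_prop
    have h2 := (measurePreserving_mul_left haar g).comp h1
    convert! h2.map_eq using 2
    ext1 x
    change x * g = g * (g⁻¹ * x * g⁻¹⁻¹)
    group

/-- The inverted measure is again left invariant, so by uniqueness it is a multiple of Haar measure,
and the total mass fixes the factor. -/
instance : haar.IsInvInvariant where
  inv_eq_self := by
    have h := Measure.isMulInvariant_eq_smul_of_compactSpace haar.inv haar
    have h1 := congrArg (fun μ : Measure SU2 => μ Set.univ) h
    simp only [Measure.smul_apply, haar_univ] at h1
    rw [Measure.inv_apply, Set.inv_univ, haar_univ, ENNReal.smul_def, smul_eq_mul, mul_one] at h1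
    have h2 : Measure.haarScalarFactor haar.inv haar = 1 := by exact_mod_cast h1.symm
    rw [h2, one_smul] at h
    exact h

theorem ae_haar_mul_right {p : SU2 → Prop} (h : ∀ᵐ v ∂haar, p v) (g : SU2) :
    ∀ᵐ v ∂haar, p (v * g) :=
  (measurePreserving_mul_right haar g).quasiMeasurePreserving.ae h

theorem ae_haar_inv_mul {p : SU2 → Prop} (h : ∀ᵐ v ∂haar, p v) (v : SU2) :
    ∀ᵐ g ∂haar, p (g⁻¹ * v) :=
  ((measurePreserving_mul_right haar v).comp
    (Measure.measurePreserving_inv haar)).quasiMeasurePreserving.ae h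

theorem integral_inv_mul_eq (f : SU2 → ℂ) (v : SU2) :
    ∫ g, f (g⁻¹ * v) ∂haar = ∫ w, f w ∂haar := by
  rw [integral_inv_eq_self (fun g => f (g * v)) haar, integral_mul_right_eq_self]

instance : PolishSpace SU2 := by
  let _ := TopologicalSpace.metrizableSpaceMetric SU2
  infer_instance

/-! ### Averaging over the torus -/

/-- The projection of functions on the group to monopole sections. -/
def torusAvg (n : ℕ) (ψ : SU2 → ℂ) : SU2 → ℂ := fun v =>
  (4 * Real.pi : ℂ)⁻¹ * ∫ α in (0 : ℝ)..(4 * Real.pi),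
    Complex.exp (-(Complex.I * (n / 2) * α)) * ψ (v * torus α)

/-- The period is `4π` because of the half angles; it is also a period of the half-integral
characters used in `torusAvg`. -/
theorem torus_four_pi : torus (4 * Real.pi) = 1 := by
  apply Subtype.ext
  rw [torus_coe]
  have h1 : Complex.I * ((4 * Real.pi : ℝ) : ℂ) / 2 = 2 * Real.pi * Complex.I := by
    push_cast; ring
  rw [h1, Complex.exp_neg, Complex.exp_two_pi_mul_I, inv_one]
  ext i j
  fin_cases i <;> fin_cases j <;> simp

/-- Translation by a torus element shifts the integrand, up to a phase, and the integral of a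
periodic function over a period is unchanged by the shift. -/
theorem torusAvg_mem (n : ℕ) (ψ : SU2 → ℂ) : torusAvg n ψ ∈ V n := by
  intro β v
  have hper : Function.Periodic (fun α : ℝ => Complex.exp (-(Complex.I * (n / 2) * α)) *
      ψ (v * torus α)) (4 * Real.pi) := by
    intro α
    have h : Complex.exp (-(Complex.I * (n / 2) * ((α + 4 * Real.pi : ℝ) : ℂ))) =
        Complex.exp (-(Complex.I * (n / 2) * α)) := by
      rw [Complex.exp_eq_exp_iff_exists_int]
      refine ⟨-(n : ℤ), ?_⟩
      push_cast
      ring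
    simp only [torus_add, torus_four_pi, mul_one, h]
  have h1 : ∀ α : ℝ, Complex.exp (-(Complex.I * (n / 2) * α)) * ψ (v * torus β * torus α) =
      Complex.exp (Complex.I * (n / 2) * β) * (Complex.exp (-(Complex.I * (n / 2) *
        ((β + α : ℝ) : ℂ))) * ψ (v * torus (β + α))) := by
    intro α
    rw [torus_add, ← mul_assoc, ← mul_assoc, ← Complex.exp_add]
    congr 2
    push_cast
    ring
  simp only [torusAvg, h1]
  rw [intervalIntegral.integral_const_mul]
  have h2 := intervalIntegral.integral_comp_add_left (a := 0) (b := 4 * Real.pi)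
    (fun α : ℝ => Complex.exp (-(Complex.I * (n / 2) * α)) * ψ (v * torus α)) β
  rw [h2, add_zero, hper.intervalIntegral_add_eq β 0, zero_add]
  ring

theorem continuous_torusAvg (n : ℕ) {ψ : SU2 → ℂ} (hψ : Continuous ψ) :
    Continuous (torusAvg n ψ) := by
  refine continuous_const.mul ?_
  refine intervalIntegral.continuous_parametric_intervalIntegral_of_continuous' ?_ _ _
  have := continuous_torus
  simp only [Function.uncurry_def]
  fun_prop

theorem stronglyMeasurable_torusAvg (n : ℕ) {ψ : SU2 → ℂ} (hψ : StronglyMeasurable ψ) :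
    StronglyMeasurable (torusAvg n ψ) := by
  have h4 : (0 : ℝ) ≤ 4 * Real.pi := by positivity
  have := continuous_torus
  have h2 : Measurable fun p : SU2 × ℝ => p.1 * torus p.2 :=
    Continuous.measurable (by fun_prop)
  have h1 : StronglyMeasurable fun p : SU2 × ℝ =>
      Complex.exp (-(Complex.I * (n / 2) * p.2)) * ψ (p.1 * torus p.2) :=
    (Continuous.stronglyMeasurable (by fun_prop)).mul (hψ.comp_measurable h2)
  unfold torusAvg
  simp only [intervalIntegral.integral_of_le h4]
  exact stronglyMeasurable_const.mul h1.integral_prod_right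

/-- The exceptional null set depends on `α`. Fubini exchanges the quantifiers: for almost every `v`
equivariance holds for almost every `α`, so the averaged integrand is almost everywhere constant. -/
theorem torusAvg_ae_eq (n : ℕ) {ψ : SU2 → ℂ} (hψ : StronglyMeasurable ψ)
    (h : ∀ α : ℝ, ∀ᵐ v ∂haar, ψ (v * torus α) = Complex.exp (Complex.I * (n / 2) * α) * ψ v) :
    torusAvg n ψ =ᵐ[haar] ψ := by
  have h4 : (0 : ℝ) ≤ 4 * Real.pi := by positivity
  have hc := continuous_torus
  have h2 : Measurable fun p : ℝ × SU2 => p.2 * torus p.1 :=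
    Continuous.measurable (by fun_prop)
  have hms : MeasurableSet {p : ℝ × SU2 | ψ (p.2 * torus p.1) =
      Complex.exp (Complex.I * (n / 2) * p.1) * ψ p.2} := by
    refine StronglyMeasurable.measurableSet_eq_fun (hψ.comp_measurable h2) ?_
    exact (Continuous.stronglyMeasurable (by fun_prop)).mul (hψ.comp_measurable measurable_snd)
  have h3 : ∀ᵐ v ∂haar, ∀ᵐ α ∂(volume.restrict (Set.Ioc 0 (4 * Real.pi))),
      ψ (v * torus α) = Complex.exp (Complex.I * (n / 2) * α) * ψ v :=
    (Measure.ae_ae_comm hms).1 (Filter.Eventually.of_forall h)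
  filter_upwards [h3] with v hv
  rw [torusAvg, intervalIntegral.integral_of_le h4]
  have h5 : ∫ α in Set.Ioc 0 (4 * Real.pi), Complex.exp (-(Complex.I * (n / 2) * α)) *
      ψ (v * torus α) = ∫ α in Set.Ioc 0 (4 * Real.pi), ψ v := by
    refine integral_congr_ae ?_
    filter_upwards [hv] with α hα
    rw [hα, ← mul_assoc, ← Complex.exp_add, neg_add_cancel, Complex.exp_zero, one_mul]
  rw [h5, setIntegral_const]
  have hpi : (Real.pi : ℂ) ≠ 0 := by exact_mod_cast Real.pi_ne_zero
  simp [Real.pi_pos.le]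
  field_simp

/-! ### The Hilbert space of monopole sections -/

/-- An everywhere equivariant representative is traded for almost-everywhere conditions, one for
each `α`, which are closed in `L²`. Torus averaging produces the representative. -/
theorem mem_VL2_iff {n : ℕ} {ψ : Lp ℂ 2 haar} : ψ ∈ VL2 n ↔ ∀ α : ℝ, ∀ᵐ v ∂haar,
    ψ (v * torus α) = Complex.exp (Complex.I * (n / 2) * α) * ψ v := by
  constructor
  · rintro ⟨ψ', hψ', h⟩ α
    filter_upwards [h, ae_haar_mul_right h (torus α)] with v h1 h2
    rw [h1, h2, hψ' α v]
  · intro h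
    exact ⟨torusAvg n ψ, torusAvg_mem n ψ, (torusAvg_ae_eq n (Lp.stronglyMeasurable ψ) h).symm⟩

theorem exists_stronglyMeasurable_rep {n : ℕ} {ψ : Lp ℂ 2 haar} (hψ : ψ ∈ VL2 n) :
    ∃ ψ' ∈ V n, StronglyMeasurable ψ' ∧ ψ =ᵐ[haar] ψ' :=
  ⟨torusAvg n ψ, torusAvg_mem n ψ, stronglyMeasurable_torusAvg n (Lp.stronglyMeasurable ψ),
    (torusAvg_ae_eq n (Lp.stronglyMeasurable ψ) (mem_VL2_iff.1 hψ)).symm⟩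

/-- The space is an intersection of equalisers of right translations, which are isometries, with
multiplications by scalars. -/
theorem isClosed_VL2 (n : ℕ) : IsClosed (VL2 n : Set (Lp ℂ 2 haar)) := by
  let R : ℝ → (Lp ℂ 2 haar →ₗᵢ[ℂ] Lp ℂ 2 haar) := fun α =>
    Lp.compMeasurePreservingₗᵢ ℂ (fun v => v * torus α)
      (measurePreserving_mul_right haar (torus α))
  have h : (VL2 n : Set (Lp ℂ 2 haar)) =
      ⋂ α : ℝ, {ψ | R α ψ = Complex.exp (Complex.I * (n / 2) * α) • ψ} := by
    ext ψ
    rw [SetLike.mem_coe, mem_VL2_iff, Set.mem_iInter]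
    refine forall_congr' fun α => ?_
    rw [Set.mem_ofPred_eq, Lp.ext_iff]
    have h1 : R α ψ =ᵐ[haar] fun v => ψ (v * torus α) :=
      Lp.coeFn_compMeasurePreserving ψ (measurePreserving_mul_right haar (torus α))
    have h2 := Lp.coeFn_smul (Complex.exp (Complex.I * (n / 2) * α)) ψ
    refine Filter.eventually_congr ?_
    filter_upwards [h1, h2] with v h1 h2
    rw [h1, h2]
    rfl
  rw [h]
  exact isClosed_iInter fun α => isClosed_eq (R α).continuous (continuous_const_smul _)

instance (n : ℕ) : CompleteSpace (VL2 n) := (isClosed_VL2 n).completeSpace_coe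

/-- The class of a continuous monopole section. -/
def contSection {n : ℕ} (χ : C(SU2, ℂ)) (hχ : ⇑χ ∈ V n) : VL2 n :=
  ⟨ContinuousMap.toLp 2 haar ℂ χ, χ, hχ, ContinuousMap.coeFn_toLp haar χ⟩

theorem inner_contSection {n : ℕ} (χ : C(SU2, ℂ)) (hχ : ⇑χ ∈ V n) (ψ : VL2 n) :
    inner ℂ (contSection χ hχ) ψ = ∫ v, (starRingEnd ℂ) (χ v) * ψ.1 v ∂haar := by
  change inner ℂ (ContinuousMap.toLp 2 haar ℂ χ) ψ.1 = _
  rw [L2.inner_def]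
  refine integral_congr_ae ?_
  filter_upwards [ContinuousMap.coeFn_toLp (p := 2) (𝕜 := ℂ) haar χ] with v hv
  rw [hv, RCLike.inner_apply, mul_comm]

theorem integrable_L2 (ψ : Lp ℂ 2 haar) : Integrable ψ haar :=
  (Lp.memLp ψ).integrable (by norm_num)

/-- Averaging is self-adjoint: Fubini and right invariance move the translation onto `ψ`, which is
equivariant already and absorbs the phase. -/
theorem integral_conj_torusAvg {n : ℕ} (c : C(SU2, ℂ)) (ψ : VL2 n) :
    ∫ v, (starRingEnd ℂ) (torusAvg n c v) * ψ.1 v ∂haar =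
      ∫ v, (starRingEnd ℂ) (c v) * ψ.1 v ∂haar := by
  have h4 : (0 : ℝ) ≤ 4 * Real.pi := by positivity
  have hc := continuous_torus
  have hpi : (Real.pi : ℂ) ≠ 0 := by exact_mod_cast Real.pi_ne_zero
  set μ : Measure ℝ := volume.restrict (Set.Ioc 0 (4 * Real.pi)) with hμ
  set f : SU2 → ℝ → ℂ := fun v α => Complex.exp (Complex.I * (n / 2) * α) *
    (starRingEnd ℂ) (c (v * torus α)) * ψ.1 v with hf
  have h1 : ∀ v, (starRingEnd ℂ) (torusAvg n c v) * ψ.1 v =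
      (4 * Real.pi : ℂ)⁻¹ * ∫ α, f v α ∂μ := by
    intro v
    rw [torusAvg, intervalIntegral.integral_of_le h4, map_mul, ← integral_conj, mul_assoc,
      ← integral_mul_const]
    have : (starRingEnd ℂ) (4 * Real.pi : ℂ)⁻¹ = (4 * Real.pi : ℂ)⁻¹ := by
      simp [Complex.conj_ofNat]
    rw [this]
    congr 2
    ext α
    simp only [hf, map_mul, ← Complex.exp_conj]
    congr 3
    simp [Complex.conj_ofNat]
  have hint : Integrable (Function.uncurry f) (haar.prod μ) := by
    have hb : ∃ C, ∀ v, ‖c v‖ ≤ C := ⟨‖c‖, c.norm_coe_le_norm⟩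
    obtain ⟨C, hC⟩ := hb
    have i1 : Integrable (fun p : SU2 × ℝ => ψ.1 p.1) (haar.prod μ) :=
      (integrable_L2 ψ.1).comp_fst μ
    refine i1.bdd_mul (c := C) ?_ (Filter.Eventually.of_forall fun p => ?_)
    · refine Continuous.aestronglyMeasurable ?_
      refine Continuous.mul (by fun_prop) ?_
      exact Complex.continuous_conj.comp (c.continuous.comp (by fun_prop))
    · rw [norm_mul, RCLike.norm_conj]
      have : ‖Complex.exp (Complex.I * (n / 2) * p.2)‖ = 1 := by
        rw [show Complex.I * (n / 2) * (p.2 : ℂ) = ((n / 2 * p.2 : ℝ) : ℂ) * Complex.I by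
          push_cast; ring, Complex.norm_exp_ofReal_mul_I]
      rw [this, one_mul]
      exact hC _
  have h2 : ∀ α, ∫ v, f v α ∂haar = ∫ v, (starRingEnd ℂ) (c v) * ψ.1 v ∂haar := by
    intro α
    have hψ := mem_VL2_iff.1 ψ.2 α
    rw [← integral_mul_right_eq_self (fun v => (starRingEnd ℂ) (c v) * ψ.1 v) (torus α)]
    refine integral_congr_ae ?_
    filter_upwards [hψ] with v hv
    rw [hv]
    simp only [hf]
    ring
  simp only [h1]
  rw [integral_const_mul, integral_integral_swap hint]
  simp only [h2]
  rw [integral_const, hμ]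
  simp [Real.pi_pos.le]
  field_simp

/-- Averaging an arbitrary continuous function gives a continuous section with the same pairing
against `ψ`, so orthogonality to the continuous sections is orthogonality to all continuous
functions. -/
theorem eq_zero_of_forall_inner_contSection {n : ℕ} (ψ : VL2 n)
    (h : ∀ (χ : C(SU2, ℂ)) (hχ : ⇑χ ∈ V n), inner ℂ (contSection χ hχ) ψ = 0) : ψ = 0 := by
  apply Subtype.ext
  rw [Lp.ext_iff]
  refine Filter.EventuallyEq.trans ?_ (Lp.coeFn_zero _ _ _).symm
  refine ae_eq_zero_of_forall_integral_continuous_mul (K := SU2) Topology.IsInducing.id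
    (integrable_L2 ψ.1) fun g => ?_
  have h1 := h ⟨torusAvg n ⇑(star g), continuous_torusAvg n (star g).continuous⟩ (torusAvg_mem n _)
  rw [inner_contSection] at h1
  have h2 := integral_conj_torusAvg (star g) ψ
  have h3 : ∫ v, (starRingEnd ℂ) (torusAvg n ⇑(star g) v) * ψ.1 v ∂haar = 0 := h1
  rw [h3] at h2
  rw [h2]
  refine integral_congr_ae (Filter.Eventually.of_forall fun v => ?_)
  simp [mul_comm]

/-! ### Integral operators with continuous kernels -/

/-- The function `v ↦ ∫ k (v, w) ψ (w) dw`. -/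
def kernelInt (k : C(SU2 × SU2, ℂ)) (ψ : SU2 → ℂ) : SU2 → ℂ := fun v => ∫ w, k (v, w) * ψ w ∂haar

theorem integrable_kernel_mul (k : C(SU2 × SU2, ℂ)) {ψ : SU2 → ℂ} (hψ : Integrable ψ haar) (v : SU2) :
    Integrable (fun w => k (v, w) * ψ w) haar := by
  refine hψ.bdd_mul (c := ‖k‖) (Continuous.aestronglyMeasurable (by fun_prop))
    (Filter.Eventually.of_forall fun w => k.norm_coe_le_norm _)

theorem kernelInt_congr (k : C(SU2 × SU2, ℂ)) {ψ χ : SU2 → ℂ} (h : ψ =ᵐ[haar] χ) :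
    kernelInt k ψ = kernelInt k χ := by
  ext v
  refine integral_congr_ae ?_
  filter_upwards [h] with w hw
  rw [hw]

/-- The conjugate sections of a kernel as a continuous curve of square-integrable functions. -/
def kernelSection (k : C(SU2 × SU2, ℂ)) : C(SU2, Lp ℂ 2 haar) where
  toFun v := ContinuousMap.toLp 2 haar ℂ ((star k).curry v)
  continuous_toFun := (ContinuousMap.toLp 2 haar ℂ).continuous.comp (star k).curry.continuous

theorem inner_kernelSection (k : C(SU2 × SU2, ℂ)) (ψ : Lp ℂ 2 haar) (v : SU2) :
    inner ℂ (kernelSection k v) ψ = kernelInt k ψ v := by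
  change inner ℂ (ContinuousMap.toLp 2 haar ℂ ((star k).curry v)) ψ = _
  rw [L2.inner_def]
  refine integral_congr_ae ?_
  filter_upwards [ContinuousMap.coeFn_toLp (p := 2) (𝕜 := ℂ) haar ((star k).curry v)] with w hw
  rw [hw, RCLike.inner_apply, mul_comm]
  simp

/-- The integral operator with values in continuous functions. -/
def kernelOpCont (k : C(SU2 × SU2, ℂ)) : Lp ℂ 2 haar →L[ℂ] C(SU2, ℂ) :=
  LinearMap.mkContinuous
    { toFun := fun ψ => ⟨fun v => inner ℂ (kernelSection k v) ψ, by fun_prop⟩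
      map_add' := fun ψ χ => by ext v; simp [inner_add_right]
      map_smul' := fun c ψ => by ext v; simp [inner_smul_right] } ‖kernelSection k‖ fun ψ => by
    refine (ContinuousMap.norm_le _ (by positivity)).2 fun v => ?_
    refine (norm_inner_le_norm (𝕜 := ℂ) (kernelSection k v) ψ).trans ?_
    gcongr
    exact (kernelSection k).norm_coe_le_norm v

theorem kernelOpCont_apply (k : C(SU2 × SU2, ℂ)) (ψ : Lp ℂ 2 haar) :
    ⇑(kernelOpCont k ψ) = kernelInt k ψ := by
  ext v
  exact inner_kernelSection k ψ v

/-- The integral operator with a continuous kernel on square-integrable functions. -/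
def kernelOp (k : C(SU2 × SU2, ℂ)) : Lp ℂ 2 haar →L[ℂ] Lp ℂ 2 haar :=
  (ContinuousMap.toLp 2 haar ℂ).comp (kernelOpCont k)

theorem kernelOp_ae_eq (k : C(SU2 × SU2, ℂ)) (ψ : Lp ℂ 2 haar) :
    kernelOp k ψ =ᵐ[haar] kernelInt k ψ := by
  rw [← kernelOpCont_apply]
  exact ContinuousMap.coeFn_toLp haar (kernelOpCont k ψ)

/-- Kernels that are invariant under simultaneous right translation by the torus. -/
def TorusInvariant (k : C(SU2 × SU2, ℂ)) : Prop :=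
  ∀ v w α, k (v * torus α, w * torus α) = k (v, w)

theorem kernelInt_mem {n : ℕ} {k : C(SU2 × SU2, ℂ)} (hk : TorusInvariant k) {ψ : Lp ℂ 2 haar}
    (hψ : ψ ∈ VL2 n) : kernelInt k ψ ∈ V n := by
  intro α v
  rw [kernelInt, ← integral_mul_right_eq_self _ (torus α), kernelInt, ← integral_const_mul]
  refine integral_congr_ae ?_
  filter_upwards [mem_VL2_iff.1 hψ α] with w hw
  rw [hk v w α, hw]
  ring

theorem kernelOp_mem {n : ℕ} {k : C(SU2 × SU2, ℂ)} (hk : TorusInvariant k) {ψ : Lp ℂ 2 haar}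
    (hψ : ψ ∈ VL2 n) : kernelOp k ψ ∈ VL2 n :=
  ⟨_, kernelInt_mem hk hψ, kernelOp_ae_eq k ψ⟩

/-- The coordinates in which elements of the double act by integral operators. -/
def doubleCoord (lam m : ℝ) : C(SU2 × SU2, SU2 × SU2) where
  toFun p := (p.1 * p.2⁻¹, orbitPt lam m p.2)
  continuous_toFun := by
    have := continuous_orbitPt lam m
    fun_prop

/-- The integral kernel of an element of the double. -/
def doubleKernel (lam m : ℝ) (F : DSU2) : C(SU2 × SU2, ℂ) := F.comp (doubleCoord lam m)

theorem doubleKernel_apply (lam m : ℝ) (F : DSU2) (v w : SU2) :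
    doubleKernel lam m F (v, w) = F (v * w⁻¹, orbitPt lam m w) := rfl

theorem torusInvariant_doubleKernel (lam m : ℝ) (F : DSU2) :
    TorusInvariant (doubleKernel lam m F) := by
  intro v w α
  rw [doubleKernel_apply, doubleKernel_apply, orbitPt_mul_torus]
  congr 2
  group

/-- This is the substitution `w = g⁻¹ v`, under which Haar measure is preserved. -/
theorem convV_eq_kernelInt (lam m : ℝ) (F : DSU2) (ψ : SU2 → ℂ) :
    convV lam m F ψ = kernelInt (doubleKernel lam m F) ψ := by
  ext v
  rw [convV, kernelInt, ← integral_inv_mul_eq (fun w => doubleKernel lam m F (v, w) * ψ w) v]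
  congr 1
  ext g
  rw [doubleKernel_apply, orbitPt_inv_mul]
  congr 3
  group

/-- The representation of the double on square-integrable monopole sections. -/
def repV (lam m : ℝ) (n : ℕ) : DSU2 →ₗ[ℂ] (VL2 n →L[ℂ] VL2 n) where
  toFun F := ((kernelOp (doubleKernel lam m F)).comp (VL2 n).subtypeL).codRestrict (VL2 n)
    fun ψ => kernelOp_mem (torusInvariant_doubleKernel lam m F) ψ.2
  map_add' F G := by
    ext1 ψ
    apply Subtype.ext
    change kernelOp (doubleKernel lam m (F + G)) ψ.1 = kernelOp (doubleKernel lam m F) ψ.1 +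
      kernelOp (doubleKernel lam m G) ψ.1
    rw [kernelOp, kernelOp, kernelOp, ContinuousLinearMap.comp_apply,
      ContinuousLinearMap.comp_apply, ContinuousLinearMap.comp_apply, ← map_add]
    congr 1
    ext v
    rw [ContinuousMap.add_apply, kernelOpCont_apply, kernelOpCont_apply, kernelOpCont_apply,
      kernelInt, kernelInt, kernelInt, ← integral_add (integrable_kernel_mul _ (integrable_L2 ψ.1) v)
        (integrable_kernel_mul _ (integrable_L2 ψ.1) v)]
    congr 1
    ext w
    exact add_mul _ _ _
  map_smul' c F := by
    ext1 ψ
    apply Subtype.ext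
    change kernelOp (doubleKernel lam m (c • F)) ψ.1 = c • kernelOp (doubleKernel lam m F) ψ.1
    rw [kernelOp, kernelOp, ContinuousLinearMap.comp_apply, ContinuousLinearMap.comp_apply,
      ← map_smul]
    congr 1
    ext v
    rw [ContinuousMap.smul_apply, kernelOpCont_apply, kernelOpCont_apply, kernelInt, kernelInt,
      smul_eq_mul, ← integral_const_mul]
    congr 1
    ext w
    exact mul_assoc _ _ _

theorem repV_apply (lam m : ℝ) (n : ℕ) (F : DSU2) (ψ : VL2 n) :
    (repV lam m n F ψ).1 = kernelOp (doubleKernel lam m F) ψ.1 := rfl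

theorem repV_ae_eq (lam m : ℝ) (n : ℕ) (F : DSU2) (ψ : VL2 n) :
    ⇑(repV lam m n F ψ).1 =ᵐ[haar] convV lam m F ⇑ψ.1 := by
  rw [convV_eq_kernelInt]
  exact kernelOp_ae_eq _ _

/-- Under `x = z⁻¹ v` the convolution variable of the double becomes the intermediate variable of a
composition of kernels, and the twist by conjugation carries the orbit point of `w` to that of `x`.
-/
theorem doubleKernel_dmul (lam m : ℝ) (F G : DSU2) (v w : SU2) :
    doubleKernel lam m (dmul F G) (v, w) =
      ∫ x, doubleKernel lam m F (v, x) * doubleKernel lam m G (x, w) ∂haar := by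
  rw [← integral_inv_mul_eq _ v, doubleKernel_apply]
  change ∫ z, F (z, (z⁻¹ * (v * w⁻¹)) * orbitPt lam m w * (z⁻¹ * (v * w⁻¹))⁻¹) *
    G (z⁻¹ * (v * w⁻¹), orbitPt lam m w) ∂haar = _
  congr 1
  ext z
  rw [doubleKernel_apply, doubleKernel_apply]
  have h1 : v * (z⁻¹ * v)⁻¹ = z := by group
  have h2 : z⁻¹ * (v * w⁻¹) * orbitPt lam m w * (z⁻¹ * (v * w⁻¹))⁻¹ = orbitPt lam m (z⁻¹ * v) := by
    simp only [orbitPt]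
    group
  have h3 : z⁻¹ * v * w⁻¹ = z⁻¹ * (v * w⁻¹) := by group
  rw [h1, h2, h3]

theorem kernelInt_dmul (lam m : ℝ) (F G : DSU2) {ψ : SU2 → ℂ} (hψ : Integrable ψ haar) :
    kernelInt (doubleKernel lam m (dmul F G)) ψ =
      kernelInt (doubleKernel lam m F) (kernelInt (doubleKernel lam m G) ψ) := by
  ext v
  simp only [kernelInt, doubleKernel_dmul, ← integral_mul_const, ← integral_const_mul]
  rw [integral_integral_swap]
  · simp only [mul_assoc]
  · have i1 : Integrable (fun p : SU2 × SU2 => ψ p.1) (haar.prod haar) := hψ.comp_fst haar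
    refine i1.bdd_mul (c := ‖doubleKernel lam m F‖ * ‖doubleKernel lam m G‖)
      (f := fun p : SU2 × SU2 => doubleKernel lam m F (v, p.2) * doubleKernel lam m G (p.2, p.1))
      (Continuous.aestronglyMeasurable (by fun_prop)) (Filter.Eventually.of_forall fun p => ?_)
    rw [norm_mul]
    gcongr <;> exact ContinuousMap.norm_coe_le_norm _ _

theorem repV_mul (lam m : ℝ) (n : ℕ) (F G : DSU2) :
    repV lam m n (dmul F G) = (repV lam m n F).comp (repV lam m n G) := by
  ext1 ψ
  apply Subtype.ext
  rw [ContinuousLinearMap.comp_apply, repV_apply, repV_apply, repV_apply, Lp.ext_iff]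
  refine (kernelOp_ae_eq _ _).trans ?_
  rw [kernelInt_dmul lam m F G (integrable_L2 ψ.1), ← kernelInt_congr _ (kernelOp_ae_eq _ ψ.1)]
  exact (kernelOp_ae_eq _ _).symm

/-- Conjugating the orbit point of `w` by `v w⁻¹` gives that of `v`, so the involution becomes the
Hermitian adjoint of kernels. -/
theorem doubleKernel_dstar (lam m : ℝ) (F : DSU2) (v w : SU2) :
    doubleKernel lam m (dstar F) (v, w) = (starRingEnd ℂ) (doubleKernel lam m F (w, v)) := by
  rw [doubleKernel_apply, doubleKernel_apply]
  change (starRingEnd ℂ) (F ((v * w⁻¹)⁻¹, v * w⁻¹ * orbitPt lam m w * (v * w⁻¹)⁻¹)) = _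
  congr 3
  · group
  · simp only [orbitPt]
    group

theorem inner_kernelOp (k : C(SU2 × SU2, ℂ)) (x y : Lp ℂ 2 haar) :
    inner ℂ x (kernelOp k y) =
      ∫ v, ∫ w, (starRingEnd ℂ) (x v) * (k (v, w) * y w) ∂haar ∂haar := by
  rw [L2.inner_def]
  refine integral_congr_ae ?_
  filter_upwards [kernelOp_ae_eq k y] with v hv
  rw [hv, RCLike.inner_apply, mul_comm, kernelInt, integral_const_mul]

theorem integrable_conj_kernel_mul (k : C(SU2 × SU2, ℂ)) (x y : Lp ℂ 2 haar) :
    Integrable (fun p : SU2 × SU2 => (starRingEnd ℂ) (x p.1) * (k (p.1, p.2) * y p.2))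
      (haar.prod haar) := by
  have i1 : Integrable (fun v => (starRingEnd ℂ) (x v)) haar :=
    (Complex.conjCLE.toContinuousLinearMap).integrable_comp (integrable_L2 x)
  have i2 := (i1.mul_prod (integrable_L2 y)).bdd_mul (c := ‖k‖) (f := k)
    k.continuous.aestronglyMeasurable (Filter.Eventually.of_forall fun p => k.norm_coe_le_norm _)
  refine i2.congr (Filter.Eventually.of_forall fun p => ?_)
  simp only
  ring

theorem repV_star (lam m : ℝ) (n : ℕ) (F : DSU2) (x y : VL2 n) :
    inner ℂ (repV lam m n (dstar F) x) y = inner ℂ x (repV lam m n F y) := by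
  change inner ℂ (kernelOp (doubleKernel lam m (dstar F)) x.1) y.1 =
    inner ℂ x.1 (kernelOp (doubleKernel lam m F) y.1)
  rw [← inner_conj_symm, inner_kernelOp, inner_kernelOp,
    integral_integral_swap (integrable_conj_kernel_mul _ y.1 x.1), ← integral_conj]
  congr 1
  ext v
  rw [← integral_conj]
  congr 1
  ext w
  rw [doubleKernel_dstar]
  simp
  ring

/-- The fibres of `doubleCoord` are the orbits of simultaneous right translation by the torus, so an
invariant kernel descends to the image. The image is compact, hence closed, and Tietze extends the
function to all of `SU₂ × SU₂`. -/
theorem exists_doubleKernel_eq {lam m : ℝ} (hlam : 0 < lam) (hm : 0 < m)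
    (hm' : m < 2 * Real.pi / lam) {k : C(SU2 × SU2, ℂ)} (hk : TorusInvariant k) :
    ∃ F : DSU2, doubleKernel lam m F = k := by
  set q := doubleCoord lam m with hq
  have hfib : ∀ p p', q p = q p' → k p = k p' := by
    rintro ⟨v, w⟩ ⟨v', w'⟩ h
    obtain ⟨h1, h2⟩ := Prod.ext_iff.1 h
    obtain ⟨α, rfl⟩ := exists_torus_of_orbitPt_eq hlam hm hm' (v := w) (w := w') h2
    have h3 : v * w⁻¹ = v' * (w * torus α)⁻¹ := h1
    have h4 : v' = v * torus α := by
      calc v' = v' * (w * torus α)⁻¹ * (w * torus α) := by group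
        _ = v * w⁻¹ * (w * torus α) := by rw [h3]
        _ = v * torus α := by group
    rw [h4, hk v w α]
  have hclosed : IsClosed (Set.range q) := (isCompact_range q.continuous).isClosed
  -- Continuity of the descended function is automatic: a continuous surjection from a compact space
  -- to a Hausdorff one is closed, hence a quotient map.
  have hquot : Topology.IsQuotientMap (Set.rangeFactorization q) := by
    exact (q.continuous.subtype_mk _).isClosedMap.isQuotientMap (q.continuous.subtype_mk _)
      Set.rangeFactorization_surjective
  have hfac : Function.FactorsThrough k (Set.rangeFactorization q) := by
    intro p p' h
    exact hfib p p' (congrArg (fun x : Set.range q => x.1) h)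
  let k' : C(Set.range q, ℂ) := Topology.IsQuotientMap.lift
    (f := ⟨Set.rangeFactorization q, q.continuous.subtype_mk _⟩) hquot k hfac
  obtain ⟨F, hF⟩ := k'.exists_restrict_eq hclosed
  refine ⟨F, ?_⟩
  ext p
  have h1 := congrArg (fun r : C(Set.range q, ℂ) => r (Set.rangeFactorization q p)) hF
  have h2 : k' (Set.rangeFactorization q p) = k p :=
    congrArg (fun r : C(SU2 × SU2, ℂ) => r p) (Topology.IsQuotientMap.lift_comp
      (f := ⟨Set.rangeFactorization q, q.continuous.subtype_mk _⟩) hquot k hfac)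
  exact h1.trans h2

/-- The phases of `χ v` and of the conjugate of `η w` cancel, so the product kernel is torus
invariant and comes from the double. -/
theorem exists_repV_rank_one {lam m : ℝ} (hlam : 0 < lam) (hm : 0 < m)
    (hm' : m < 2 * Real.pi / lam) {n : ℕ} (χ η : C(SU2, ℂ)) (hχ : ⇑χ ∈ V n) (hη : ⇑η ∈ V n) :
    ∃ F : DSU2, ∀ ψ : VL2 n,
      repV lam m n F ψ = inner ℂ (contSection η hη) ψ • contSection χ hχ := by
  let k : C(SU2 × SU2, ℂ) := ⟨fun p => χ p.1 * (starRingEnd ℂ) (η p.2), by fun_prop⟩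
  have hk : TorusInvariant k := by
    intro v w α
    change χ (v * torus α) * (starRingEnd ℂ) (η (w * torus α)) = χ v * (starRingEnd ℂ) (η w)
    rw [hχ α v, hη α w, map_mul, ← Complex.exp_conj]
    have : (starRingEnd ℂ) (Complex.I * (n / 2) * α) = -(Complex.I * (n / 2) * α) := by
      simp [Complex.conj_ofNat]
    rw [this]
    calc _ = (Complex.exp (Complex.I * (n / 2) * α) * Complex.exp (-(Complex.I * (n / 2) * α))) *
          (χ v * (starRingEnd ℂ) (η w)) := by ring
      _ = _ := by rw [← Complex.exp_add, add_neg_cancel, Complex.exp_zero, one_mul]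
  obtain ⟨F, hF⟩ := exists_doubleKernel_eq hlam hm hm' hk
  refine ⟨F, fun ψ => Subtype.ext ?_⟩
  rw [repV_apply, hF]
  change kernelOp k ψ.1 = inner ℂ (contSection η hη) ψ • ContinuousMap.toLp 2 haar ℂ χ
  rw [kernelOp, ContinuousLinearMap.comp_apply, ← map_smul]
  congr 1
  ext v
  rw [kernelOpCont_apply, inner_contSection, kernelInt, ContinuousMap.smul_apply, smul_eq_mul,
    ← integral_mul_const]
  congr 1
  ext w
  change χ v * (starRingEnd ℂ) (η w) * _ = _
  ring

/-- A nonzero continuous monopole section. -/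
def powSection (n : ℕ) : C(SU2, ℂ) := ⟨fun v => v.1 0 0 ^ n, (continuous_entry 0 0).pow n⟩

theorem powSection_mem (n : ℕ) : ⇑(powSection n) ∈ V n := by
  intro α v
  change (v * torus α).1 0 0 ^ n = Complex.exp _ * v.1 0 0 ^ n
  rw [Submonoid.coe_mul, torus_coe, Matrix.mul_diagonal, Matrix.cons_val_zero, mul_pow,
    ← Complex.exp_nat_mul, mul_comm]
  congr 2
  ring

theorem contSection_powSection_ne_zero (n : ℕ) :
    contSection (powSection n) (powSection_mem n) ≠ 0 := by
  intro h
  have h1 : ContinuousMap.toLp 2 haar ℂ (powSection n) = ContinuousMap.toLp 2 haar ℂ 0 := by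
    rw [map_zero]; exact congrArg Subtype.val h
  have h2 := congrArg (fun r : C(SU2, ℂ) => r 1) (ContinuousMap.toLp_injective haar h1)
  simp [powSection] at h2

/-- A nonzero vector of an invariant subspace pairs nontrivially with some continuous section `η`.
The rank-one operators with this `η` move the vector to multiples of every continuous section, and
these are total, so the orthogonal complement of the closed subspace is zero. -/
theorem isIrrep_repV {lam m : ℝ} (hlam : 0 < lam) (hm : 0 < m)
    (hm' : m < 2 * Real.pi / lam) (n : ℕ) : IsIrrep (repV lam m n) where
  complete := inferInstance
  map_mul := repV_mul lam m n
  map_star := repV_star lam m n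
  ne_zero := by
    intro h
    obtain ⟨F, hF⟩ := exists_repV_rank_one hlam hm hm' (powSection n) (powSection n)
      (powSection_mem n) (powSection_mem n)
    have h0 := contSection_powSection_ne_zero n
    have h1 := hF (contSection (powSection n) (powSection_mem n))
    rw [h] at h1
    rcases smul_eq_zero.1 h1.symm with h2 | h2
    · exact h0 (inner_self_eq_zero.1 h2)
    · exact h0 h2
  irreducible := by
    intro K hK hinv
    by_cases hbot : K = ⊥
    · exact Or.inl hbot
    right
    obtain ⟨ψ, hψK, hψ0⟩ := Submodule.exists_mem_ne_zero_of_ne_bot hbot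
    have hex : ∃ (η : C(SU2, ℂ)) (hη : ⇑η ∈ V n), inner ℂ (contSection η hη) ψ ≠ 0 := by
      by_contra! h
      exact hψ0 (eq_zero_of_forall_inner_contSection ψ h)
    obtain ⟨η, hη, hne⟩ := hex
    have hmem : ∀ (χ : C(SU2, ℂ)) (hχ : ⇑χ ∈ V n), contSection χ hχ ∈ K := by
      intro χ hχ
      obtain ⟨F, hF⟩ := exists_repV_rank_one hlam hm hm' χ η hχ hη
      have h1 := hinv F ψ hψK
      rw [hF] at h1
      exact (K.smul_mem_iff hne).1 h1
    have : CompleteSpace K := hK.completeSpace_coe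
    rw [← Submodule.orthogonal_eq_bot_iff, Submodule.eq_bot_iff]
    intro y hy
    exact eq_zero_of_forall_inner_contSection y fun χ hχ =>
      (Submodule.mem_orthogonal K y).1 hy _ (hmem χ hχ)

/-! ### The Hilbert space of fields on the orbit -/

theorem continuous_orbitNS {lam m : ℝ} (hlam : 0 < lam) (hm : 0 < m)
    (hm' : m < 2 * Real.pi / lam) : Continuous (orbitNS hlam hm hm') :=
  (continuous_orbitPt lam m).subtype_mk _

theorem measurable_orbitNS {lam m : ℝ} (hlam : 0 < lam) (hm : 0 < m)
    (hm' : m < 2 * Real.pi / lam) : Measurable (orbitNS hlam hm hm') :=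
  (continuous_orbitPt lam m).measurable.subtype_mk

theorem measurableSet_S3NS : MeasurableSet {u : SU2 |
    (u : Matrix (Fin 2) (Fin 2) ℂ) ≠ 1 ∧ (u : Matrix (Fin 2) (Fin 2) ℂ) ≠ -1} := by
  refine IsOpen.measurableSet (IsOpen.inter ?_ ?_) <;>
  exact isOpen_ne_fun continuous_subtype_val continuous_const

/-- The orbit map already avoids the poles, so pulling the measure back along the measurable
inclusion undoes the pushforward. -/
theorem measurePreserving_orbitNS {lam m : ℝ} (hlam : 0 < lam) (hm : 0 < m)
    (hm' : m < 2 * Real.pi / lam) :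
    MeasurePreserving (orbitNS hlam hm hm') haar (orbitMeasure lam m) := by
  refine ⟨measurable_orbitNS hlam hm hm', ?_⟩
  have he : MeasurableEmbedding (Subtype.val : S3NS → SU2) :=
    MeasurableEmbedding.subtype_coe measurableSet_S3NS
  have h : haar.map (orbitPt lam m) =
      (haar.map (orbitNS hlam hm hm')).map (Subtype.val : S3NS → SU2) := by
    rw [Measure.map_map he.measurable (measurable_orbitNS hlam hm hm')]
    rfl
  rw [orbitMeasure, h, he.comap_map]

theorem ae_orbitNS {lam m : ℝ} (hlam : 0 < lam) (hm : 0 < m)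
    (hm' : m < 2 * Real.pi / lam) {p : S3NS → Prop} (h : ∀ᵐ u ∂orbitMeasure lam m, p u) :
    ∀ᵐ v ∂haar, p (orbitNS hlam hm hm' v) :=
  (measurePreserving_orbitNS hlam hm hm').quasiMeasurePreserving.ae h

theorem ae_eq_of_ae_orbitNS {lam m : ℝ} (hlam : 0 < lam) (hm : 0 < m)
    (hm' : m < 2 * Real.pi / lam) {n : ℕ} {φ χ : S3NS → E n} (hφ : StronglyMeasurable φ)
    (hχ : StronglyMeasurable χ)
    (h : ∀ᵐ v ∂haar, φ (orbitNS hlam hm hm' v) = χ (orbitNS hlam hm hm' v)) :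
    φ =ᵐ[orbitMeasure lam m] χ := by
  have hmp := measurePreserving_orbitNS hlam hm hm'
  rw [Filter.EventuallyEq, ← hmp.map_eq, ae_map_iff hmp.measurable.aemeasurable
    (hφ.measurableSet_eq_fun hχ)]
  exact h

theorem continuous_spin_lowest (n : ℕ) : Continuous fun v : SU2 => spin n v (lowest n) :=
  (continuous_spin n).comp (g := fun p : SU2 × E n => spin n p.1 p.2)
    (f := fun v : SU2 => (v, lowest n)) (continuous_id.prodMk continuous_const)

theorem memLp_toSection {lam m : ℝ} (hlam : 0 < lam) (hm : 0 < m)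
    (hm' : m < 2 * Real.pi / lam) (n : ℕ) (φ : Lp (E n) 2 (orbitMeasure lam m)) :
    MemLp (toSection hlam hm hm' n φ) 2 haar := by
  have h1 := (Lp.memLp φ).comp_measurePreserving (measurePreserving_orbitNS hlam hm hm')
  refine h1.mono ((continuous_spin_lowest n).aestronglyMeasurable.inner h1.1) (Filter.Eventually.of_forall fun v => ?_)
  refine (norm_inner_le_norm (𝕜 := ℂ) _ _).trans ?_
  rw [norm_spin, norm_lowest, one_mul]
  rfl

theorem orbitNS_ae_eq {lam m : ℝ} (hlam : 0 < lam) (hm : 0 < m)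
    (hm' : m < 2 * Real.pi / lam) {n : ℕ} (hgen : Generic lam m n) (φ : WL2 lam m n) :
    ∀ᵐ v ∂haar, φ.1 (orbitNS hlam hm hm' v) =
      toSection hlam hm hm' n φ.1 v • spin n v (lowest n) := by
  obtain ⟨φ', hφ', h⟩ := φ.2
  filter_upwards [ae_orbitNS hlam hm hm' h] with v hv
  rw [toSection, hv]
  exact apply_orbitNS_eq hlam hm hm' hgen hφ'.1 v

/-- Restriction of square-integrable fields on the orbit to monopole sections. -/
def fieldToSection {lam m : ℝ} (hlam : 0 < lam) (hm : 0 < m)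
    (hm' : m < 2 * Real.pi / lam) {n : ℕ} (hgen : Generic lam m n) : WL2 lam m n →ₗᵢ[ℂ] VL2 n where
  toFun φ := ⟨(memLp_toSection hlam hm hm' n φ.1).toLp _, toSection hlam hm hm' n φ.1,
    toSection_mem hlam hm hm' n _, MemLp.coeFn_toLp _⟩
  map_add' φ χ := by
    apply Subtype.ext
    change (memLp_toSection hlam hm hm' n (φ + χ).1).toLp _ =
      (memLp_toSection hlam hm hm' n φ.1).toLp _ + (memLp_toSection hlam hm hm' n χ.1).toLp _
    rw [← MemLp.toLp_add, MemLp.toLp_eq_toLp_iff]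
    filter_upwards [ae_orbitNS hlam hm hm' (Lp.coeFn_add φ.1 χ.1)] with v hv
    simp only [toSection, Pi.add_apply, Submodule.coe_add, hv, inner_add_right]
  map_smul' c φ := by
    apply Subtype.ext
    change (memLp_toSection hlam hm hm' n (c • φ).1).toLp _ =
      c • (memLp_toSection hlam hm hm' n φ.1).toLp _
    rw [← MemLp.toLp_const_smul, MemLp.toLp_eq_toLp_iff]
    filter_upwards [ae_orbitNS hlam hm hm' (Lp.coeFn_smul c φ.1)] with v hv
    simp only [toSection, Pi.smul_apply, Submodule.coe_smul, hv, inner_smul_right, smul_eq_mul]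
  norm_map' φ := by
    change ‖(memLp_toSection hlam hm hm' n φ.1).toLp _‖ = ‖φ.1‖
    rw [Lp.norm_toLp, Lp.norm_def, ← eLpNorm_comp_measurePreserving (Lp.aestronglyMeasurable φ.1)
      (measurePreserving_orbitNS hlam hm hm')]
    congr 1
    refine eLpNorm_congr_norm_ae ?_
    -- Pointwise norms agree, because the spin operators are unitary and the lowest weight vector
    -- has norm 1.
    filter_upwards [orbitNS_ae_eq hlam hm hm' hgen φ] with v hv
    rw [Function.comp_apply, hv, norm_smul, norm_spin, norm_lowest, mul_one]

theorem fieldToSection_ae_eq {lam m : ℝ} (hlam : 0 < lam) (hm : 0 < m)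
    (hm' : m < 2 * Real.pi / lam) {n : ℕ} (hgen : Generic lam m n) (φ : WL2 lam m n) :
    (fieldToSection hlam hm hm' hgen φ).1 =ᵐ[haar] toSection hlam hm hm' n φ.1 :=
  (memLp_toSection hlam hm hm' n φ.1).coeFn_toLp

/-- The definition by choice gives no measurability. It is instead recovered on the compact image
from measurability of the composite with the orbit map, a measurable map out of a Polish space; off
the image the field is zero. -/
theorem measurable_toField {lam m : ℝ} (hlam : 0 < lam) (hm : 0 < m)
    (hm' : m < 2 * Real.pi / lam) {n : ℕ} {ψ : SU2 → ℂ} (hψ : ψ ∈ V n)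
    (hmeas : StronglyMeasurable ψ) : Measurable (toField lam m n ψ) := by
  have h1 : Measurable (toField lam m n ψ ∘ orbitNS hlam hm hm') := by
    have : toField lam m n ψ ∘ orbitNS hlam hm hm' = fun v => ψ v • spin n v (lowest n) :=
      funext fun v => toField_apply hlam hm hm' hψ rfl
    rw [this]
    exact (hmeas.smul (continuous_spin_lowest n).stronglyMeasurable).measurable
  have hr : MeasurableSet (Set.range (orbitNS hlam hm hm')) :=
    (isCompact_range (continuous_orbitNS hlam hm hm')).isClosed.measurableSet
  refine measurable_of_restrict_of_restrict_compl hr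
    (((measurable_orbitNS hlam hm hm').measurable_comp_iff_restrict).1 h1) ?_
  have h2 : (Set.range (orbitNS hlam hm hm'))ᶜ.domRestrict (toField lam m n ψ) = fun _ => 0 := by
    ext1 u
    refine toField_of_notMem fun ⟨v, hv⟩ => u.2 ⟨v, Subtype.ext hv⟩
  rw [h2]
  exact measurable_const

/-- The preimage is the field of a representative that is both everywhere equivariant and strongly
measurable; torus averaging provides one. -/
theorem surjective_fieldToSection {lam m : ℝ} (hlam : 0 < lam) (hm : 0 < m)
    (hm' : m < 2 * Real.pi / lam) {n : ℕ} (hgen : Generic lam m n) :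
    Function.Surjective (fieldToSection hlam hm hm' hgen) := by
  intro ψ
  obtain ⟨ψ', hψ', hmeas, h⟩ := exists_stronglyMeasurable_rep ψ.2
  have hmp := measurePreserving_orbitNS hlam hm hm'
  have h1 : MemLp (toField lam m n ψ') 2 (orbitMeasure lam m) := by
    have hF := (measurable_toField hlam hm hm' hψ' hmeas).stronglyMeasurable
    rw [← hmp.map_eq, memLp_map_measure_iff hF.aestronglyMeasurable hmp.measurable.aemeasurable]
    have hL : MemLp ψ' 2 haar := (memLp_congr_ae h).1 (Lp.memLp ψ.1)
    refine hL.mono (hF.comp_measurable hmp.measurable).aestronglyMeasurable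
      (Filter.Eventually.of_forall fun v => ?_)
    rw [Function.comp_apply, toField_apply hlam hm hm' hψ' (v := v) rfl, norm_smul, norm_spin,
      norm_lowest, mul_one]
  refine ⟨⟨h1.toLp _, _, toField_mem, h1.coeFn_toLp⟩, Subtype.ext (Lp.ext ?_)⟩
  refine (fieldToSection_ae_eq hlam hm hm' hgen _).trans ?_
  filter_upwards [h, ae_orbitNS hlam hm hm' h1.coeFn_toLp] with v hv hv'
  rw [hv, toSection, hv']
  exact congrFun (toSection_toField hlam hm hm' hψ') v

/-- The unitary equivalence of monopole sections and constrained fields on the orbit. -/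
def sectionIsometry {lam m : ℝ} (hlam : 0 < lam) (hm : 0 < m)
    (hm' : m < 2 * Real.pi / lam) {n : ℕ} (hgen : Generic lam m n) : VL2 n ≃ₗᵢ[ℂ] WL2 lam m n :=
  (LinearIsometryEquiv.ofSurjective (fieldToSection hlam hm hm' hgen)
    (surjective_fieldToSection hlam hm hm' hgen)).symm

theorem sectionIsometry_ae_eq {lam m : ℝ} (hlam : 0 < lam) (hm : 0 < m)
    (hm' : m < 2 * Real.pi / lam) {n : ℕ} (hgen : Generic lam m n) (ψ : VL2 n) :
    ∀ᵐ v ∂haar, (sectionIsometry hlam hm hm' hgen ψ).1 (orbitNS hlam hm hm' v) =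
      ψ.1 v • spin n v (lowest n) := by
  set φ := sectionIsometry hlam hm hm' hgen ψ
  have h : fieldToSection hlam hm hm' hgen φ = ψ :=
    (LinearIsometryEquiv.ofSurjective (fieldToSection hlam hm hm' hgen)
      (surjective_fieldToSection hlam hm hm' hgen)).apply_symm_apply ψ
  have h2 := fieldToSection_ae_eq hlam hm hm' hgen φ
  rw [h] at h2
  filter_upwards [orbitNS_ae_eq hlam hm hm' hgen φ, h2] with v hv hv2
  rw [hv, hv2]

/-! ### The representation on fields on the orbit -/

/-- Transport of a representation of the double along a unitary equivalence. -/
def conjRep {H K : Type*} [NormedAddCommGroup H] [InnerProductSpace ℂ H] [NormedAddCommGroup K]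
    [InnerProductSpace ℂ K] (T : H ≃ₗᵢ[ℂ] K) (π : DSU2 →ₗ[ℂ] (H →L[ℂ] H)) :
    DSU2 →ₗ[ℂ] (K →L[ℂ] K) where
  toFun F := (T.toContinuousLinearEquiv : H →L[ℂ] K).comp
    ((π F).comp (T.symm.toContinuousLinearEquiv : K →L[ℂ] H))
  map_add' F G := by ext1 x; simp
  map_smul' c F := by ext1 x; simp

theorem conjRep_apply {H K : Type*} [NormedAddCommGroup H] [InnerProductSpace ℂ H]
    [NormedAddCommGroup K] [InnerProductSpace ℂ K] (T : H ≃ₗᵢ[ℂ] K)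
    (π : DSU2 →ₗ[ℂ] (H →L[ℂ] H)) (F : DSU2) (x : K) : conjRep T π F x = T (π F (T.symm x)) := rfl

theorem IsIrrep.conjRep {H K : Type*} [NormedAddCommGroup H] [InnerProductSpace ℂ H]
    [NormedAddCommGroup K] [InnerProductSpace ℂ K] (T : H ≃ₗᵢ[ℂ] K)
    {π : DSU2 →ₗ[ℂ] (H →L[ℂ] H)} (h : IsIrrep π) : IsIrrep (conjRep T π) where
  complete := by
    have := h.complete
    exact (completeSpace_congr T.isometry.isUniformEmbedding (e := T.toEquiv)).1 this
  map_mul F G := by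
    ext1 x
    rw [ContinuousLinearMap.comp_apply, conjRep_apply, conjRep_apply, conjRep_apply, h.map_mul,
      T.symm_apply_apply, ContinuousLinearMap.comp_apply]
  map_star F x y := by
    rw [conjRep_apply, conjRep_apply]
    calc inner ℂ (T (π (dstar F) (T.symm x))) y
        = inner ℂ (T (π (dstar F) (T.symm x))) (T (T.symm y)) := by rw [T.apply_symm_apply]
      _ = inner ℂ (T (T.symm x)) (T (π F (T.symm y))) := by
        rw [T.inner_map_map, T.inner_map_map, h.map_star]
      _ = _ := by rw [T.apply_symm_apply]
  ne_zero h0 := by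
    refine h.ne_zero (LinearMap.ext fun F => ContinuousLinearMap.ext fun x => ?_)
    have h1 : SpinModel.conjRep T π F (T x) = 0 := by rw [h0]; rfl
    rw [conjRep_apply, T.symm_apply_apply] at h1
    exact (map_eq_zero_iff T T.injective).1 h1
  irreducible L hL hinv := by
    have h1 := h.irreducible (L.comap (T.toLinearEquiv : H →ₗ[ℂ] K)) (hL.preimage T.continuous)
      fun F x hx => by
        have := hinv F (T x) hx
        rwa [conjRep_apply, T.symm_apply_apply] at this
    refine h1.imp (fun h2 => ?_) fun h2 => ?_
    · rw [Submodule.eq_bot_iff] at h2 ⊢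
      intro y hy
      have := h2 (T.symm y) (by
        change T (T.symm y) ∈ L
        rwa [T.apply_symm_apply])
      exact (map_eq_zero_iff T.symm T.symm.injective).1 this
    · rw [Submodule.eq_top_iff'] at h2 ⊢
      intro y
      have : T (T.symm y) ∈ L := h2 (T.symm y)
      rwa [T.apply_symm_apply] at this

theorem stronglyMeasurable_convW {n : ℕ} (F : DSU2) {φ : S3NS → E n}
    (hφ : StronglyMeasurable φ) : StronglyMeasurable (convW n F φ) := by
  have h1 : Continuous fun p : S3NS × SU2 => p.1.conj p.2 :=
    Continuous.subtype_mk (f := fun p : S3NS × SU2 => p.2⁻¹ * p.1.1 * p.2) (by fun_prop) _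
  have h2 : Measurable fun p : S3NS × SU2 => spin n p.2 (φ (p.1.conj p.2)) :=
    (continuous_spin n).measurable.comp (g := fun p : SU2 × E n => spin n p.1 p.2)
      (f := fun p : S3NS × SU2 => (p.2, φ (p.1.conj p.2))) (measurable_snd.prodMk (hφ.measurable.comp h1.measurable))
  have h3 : Continuous fun p : S3NS × SU2 => F (p.2, p.2⁻¹ * p.1.1 * p.2) := by fun_prop
  exact (h3.measurable.smul h2).stronglyMeasurable.integral_prod_right

/-- The identity `ρ(g) ρ(g⁻¹ v) = ρ(v)` makes the vector factor independent of the integration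
variable, so it leaves the integral. -/
theorem convW_orbitNS {lam m : ℝ} (hlam : 0 < lam) (hm : 0 < m) (hm' : m < 2 * Real.pi / lam)
    {n : ℕ} (F : DSU2) {φ : S3NS → E n} {ψ : SU2 → ℂ}
    (h : ∀ᵐ v ∂haar, φ (orbitNS hlam hm hm' v) = ψ v • spin n v (lowest n)) (v : SU2) :
    convW n F φ (orbitNS hlam hm hm' v) = convV lam m F ψ v • spin n v (lowest n) := by
  rw [convW, convV, ← integral_smul_const]
  refine integral_congr_ae ?_
  filter_upwards [ae_haar_inv_mul h v] with g hg
  rw [conj_orbitNS, hg, map_smul, ← spin_mul, mul_inv_cancel_left, smul_smul]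
  rfl

theorem coe_ae_eq_convW {lam m : ℝ} (hlam : 0 < lam) (hm : 0 < m)
    (hm' : m < 2 * Real.pi / lam) {n : ℕ} (F : DSU2)
    (φ χ : Lp (E n) 2 (orbitMeasure lam m)) {ψ η : SU2 → ℂ} (hη : η =ᵐ[haar] convV lam m F ψ)
    (hφ : ∀ᵐ v ∂haar, φ (orbitNS hlam hm hm' v) = ψ v • spin n v (lowest n))
    (hχ : ∀ᵐ v ∂haar, χ (orbitNS hlam hm hm' v) = η v • spin n v (lowest n)) :
    ⇑χ =ᵐ[orbitMeasure lam m] convW n F ⇑φ := by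
  have h1 : StronglyMeasurable (⇑χ) := Lp.stronglyMeasurable χ
  have h2 : StronglyMeasurable (⇑φ) := Lp.stronglyMeasurable φ
  refine ae_eq_of_ae_orbitNS hlam hm hm' h1 (stronglyMeasurable_convW F h2) ?_
  filter_upwards [hχ, hη] with v h1 h2
  rw [h1, h2, convW_orbitNS hlam hm hm' F hφ v]

/-- An isometry that multiplies sections by the translated lowest weight vector carries the integral
formula on sections to the one on fields, so the transported representation is the intended one. -/
theorem conjRep_repV_ae_eq {lam m : ℝ} (hlam : 0 < lam) (hm : 0 < m)
    (hm' : m < 2 * Real.pi / lam) {n : ℕ} (T : VL2 n ≃ₗᵢ[ℂ] WL2 lam m n)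
    (hT : ∀ ψ : VL2 n, ∀ᵐ v ∂haar, (T ψ).1 (orbitNS hlam hm hm' v) = ψ.1 v • spin n v (lowest n))
    (F : DSU2) (φ : WL2 lam m n) :
    ⇑(conjRep T (repV lam m n) F φ).1 =ᵐ[orbitMeasure lam m] convW n F ⇑φ.1 := by
  have h1 := hT (T.symm φ)
  rw [T.apply_symm_apply] at h1
  rw [conjRep_apply]
  exact coe_ae_eq_convW hlam hm hm' F φ.1 _ (repV_ae_eq lam m n F (T.symm φ)) h1
    (hT (repV lam m n F (T.symm φ)))

end

end SpinModel

/-! ### Assembly of the representation, momentum space and position space statements -/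

theorem mainTheorem6 (lam m : ℝ) (hlam : 0 < lam) (hm : 0 < m) (hm' : m < 2 * Real.pi / lam) :
    -- the global and the Lie algebra coordinates on momentum space, and the orbits
    (∀ u : SU2, (u : Matrix (Fin 2) (Fin 2) ℂ) =
        (P0 u : ℂ) • 1 + (Complex.I * lam / 2) • slash (Pvec lam u) ∧
      P0 u ^ 2 + lam ^ 2 / 4 * ∑ a, P lam u a ^ 2 = 1) ∧
    (∀ u : S3NS, ∃! m' : ℝ, 0 < m' ∧ m' < 2 * Real.pi / lam ∧ u.1 ∈ conjClass lam m') ∧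
    (∀ u : S3NS,
      (u.1 : Matrix (Fin 2) (Fin 2) ℂ) = NormedSpace.exp
        ((Complex.I * lam / 2) • slash fun a => (lieCoord lam u.1 a : ℂ)) ∧
      ∑ a, lieCoord lam u.1 a ^ 2 < (2 * Real.pi / lam) ^ 2 ∧
      (u.1 ∈ conjClass lam m ↔ ∑ a, lieCoord lam u.1 a ^ 2 = m ^ 2) ∧
      (u.1 ∈ conjClass lam m ↔ P0 u.1 = Real.cos (m * lam / 2))) ∧
    -- the singular elements of the double act on monopole sections and on constrained fields,
    -- and generically these two representations agree once the support condition is imposed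
    (∀ n : ℕ,
      (∀ g f, ∀ ψ ∈ V n, singV lam m g f ψ ∈ V n) ∧
      (∀ g f, ∀ φ ∈ W lam m n, singW n g f φ ∈ W lam m n) ∧
      (∀ g f, ∀ φ ∈ Wsupp lam m n, singW n g f φ ∈ Wsupp lam m n) ∧
      (∀ ψ, singV lam m 1 1 ψ = ψ) ∧
      (∀ φ, singW n 1 1 φ = φ) ∧
      (∀ g₁ f₁ g₂ f₂ ψ, singV lam m g₁ f₁ (singV lam m g₂ f₂ ψ) =
        singV lam m (g₁ * g₂) (singMul f₁ g₂ f₂) ψ) ∧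
      (∀ g₁ f₁ g₂ f₂ φ, singW n g₁ f₁ (singW n g₂ f₂ φ) =
        singW n (g₁ * g₂) (singMul f₁ g₂ f₂) φ) ∧
      (Generic lam m n → ∃ e : V n ≃ₗ[ℂ] Wsupp lam m n,
        (∀ (ψ : V n) (v : SU2) (u : S3NS), u.1 = orbitPt lam m v →
          (e ψ).1 u = ψ.1 v • spin n v (lowest n)) ∧
        ∀ g f (ψ χ : V n), χ.1 = singV lam m g f ψ.1 → (e χ).1 = singW n g f (e ψ).1)) ∧
    -- the unitary irreducible representation of mass `m` and spin `n / 2`, and its realisation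
    (∀ n : ℕ, ∃ πV : DSU2 →ₗ[ℂ] (VL2 n →L[ℂ] VL2 n),
      (∀ F (ψ : VL2 n), ⇑(πV F ψ).1 =ᵐ[haar] convV lam m F ⇑ψ.1) ∧
      IsIrrep πV ∧
      (Generic lam m n →
        ∃ (πW : DSU2 →ₗ[ℂ] (WL2 lam m n →L[ℂ] WL2 lam m n)) (T : VL2 n ≃ₗᵢ[ℂ] WL2 lam m n),
          (∀ F (φ : WL2 lam m n), ⇑(πW F φ).1 =ᵐ[orbitMeasure lam m] convW n F ⇑φ.1) ∧
          IsIrrep πW ∧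
          (∀ ψ : VL2 n, ∀ᵐ v ∂haar, ∀ u : S3NS, u.1 = orbitPt lam m v →
            (T ψ).1 u = ψ.1 v • spin n v (lowest n)) ∧
          ∀ F ψ, T (πV F ψ) = πW F (T ψ))) ∧
    -- the constraint is empty for spin `0`; the support condition is automatic for spin `1/2`,
    -- and for spin `1` on the hemisphere containing the orbit
    W lam m 0 = ⊤ ∧
    W lam m 1 = Wsupp lam m 1 ∧
    (∀ φ ∈ W lam m 2,
      (∀ u : S3NS, u.1 ∉ conjClass lam m → u.1 ∉ conjClass lam (2 * Real.pi / lam - m) →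
        φ u = 0) ∧
      ((∀ u : S3NS, u.1 ∉ patch lam m → φ u = 0) → φ ∈ Wsupp lam m 2)) ∧
    -- momentum space equations for spins `0`, `1/2` and `1`
    (∀ (u : S3NS) (z : ℂ),
      (P0 u.1 * z = Real.cos (m * lam / 2) * z →
        ((∑ a, P lam u.1 a ^ 2 - effMass lam m ^ 2 : ℝ) : ℂ) * z = 0) ∧
      (u.1 ∈ patch lam m → (P0 u.1 * z = Real.cos (m * lam / 2) * z ↔
        ((∑ a, P lam u.1 a ^ 2 - effMass lam m ^ 2 : ℝ) : ℂ) * z = 0))) ∧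
    (∀ (u : S3NS) (z : E 1),
      (Constraint lam m 1 u.1 z →
        slash (Pvec lam u.1) *ᵥ z.ofLp + (effMass lam m : ℂ) • z.ofLp = 0) ∧
      (u.1 ∈ patch lam m → (Constraint lam m 1 u.1 z ↔
        slash (Pvec lam u.1) *ᵥ z.ofLp + (effMass lam m : ℂ) • z.ofLp = 0))) ∧
    cartToWeight ∈ Matrix.unitaryGroup (Fin 3) ℂ ∧
    (∀ (u : SU2) (y z : Fin 3 → ℂ),
      slash y = (u : Matrix (Fin 2) (Fin 2) ℂ) * slash z * ((u⁻¹ : SU2) : Matrix _ _ ℂ) →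
        rho 2 u *ᵥ (cartToWeight *ᵥ z) = cartToWeight *ᵥ y) ∧
    (∀ (u : S3NS) (z : Fin 3 → ℂ),
      (CartConstraint lam m u.1 z →
        Pvec lam u.1 ⬝ᵥ z = 0 ∧
        ((∑ a, P lam u.1 a ^ 2 - effMass lam m ^ 2 : ℝ) : ℂ) • z = 0) ∧
      (m * lam ≠ Real.pi → u.1 ∈ patch lam m → (CartConstraint lam m u.1 z ↔
        crossProduct (Pvec lam u.1) z - (Complex.I * effMass lam m) • z = 0))) ∧
    -- the noncommutative spacetime, its partial derivatives and plane waves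
    (pos lam 0 * pos lam 1 - pos lam 1 * pos lam 0 = (Complex.I * lam) • pos lam 2 ∧
      pos lam 1 * pos lam 2 - pos lam 2 * pos lam 1 = (Complex.I * lam) • pos lam 0 ∧
      pos lam 2 * pos lam 0 - pos lam 0 * pos lam 2 = (Complex.I * lam) • pos lam 1) ∧
    (∀ a b, pd lam a 1 = 0 ∧ pd lam a (ofU (pos lam b)) = if a = b then 1 else 0) ∧
    (∀ (u : S3NS) (a : Fin 3),
      P0op (planeWave lam (lieCoord lam u.1)) =
        (P0 u.1 : ℂ) • planeWave lam (lieCoord lam u.1) ∧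
      pd lam a (planeWave lam (lieCoord lam u.1)) =
        (Complex.I * P lam u.1 a) • planeWave lam (lieCoord lam u.1)) ∧
    -- the Fourier transform is given by its integral, turns coordinates into operators, and is
    -- injective
    (∀ (ν : Measure S3NS) (f : S3NS → ℂ), Integrable f ν →
      (∀ (X : FinRep) (i j : Fin X.dim),
        Integrable (fun u => f u * (planeWave lam (lieCoord lam u.1)).1 X i j) ν ∧
        (qFourier lam ν f).1 X i j =
          ∫ u, f u * (planeWave lam (lieCoord lam u.1)).1 X i j ∂ν) ∧
      qFourier lam ν (fun u => P0 u.1 * f u) = P0op (qFourier lam ν f) ∧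
      (∀ a, qFourier lam ν (fun u => P lam u.1 a * f u) =
        -(Complex.I • pd lam a (qFourier lam ν f))) ∧
      (qFourier lam ν f = 0 → f =ᵐ[ν] 0)) ∧
    -- spin `0`: the noncommutative Klein-Gordon equation
    (∀ (ν : Measure S3NS) (f : S3NS → ℂ), Integrable f ν →
      ((∀ᵐ u ∂ν, P0 u.1 * f u = Real.cos (m * lam / 2) * f u) →
        lapl lam (qFourier lam ν f) + ((effMass lam m : ℂ) ^ 2) • qFourier lam ν f = 0) ∧
      ((∀ᵐ u ∂ν, u.1 ∉ patch lam m → f u = 0) →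
        ((∀ᵐ u ∂ν, P0 u.1 * f u = Real.cos (m * lam / 2) * f u) ↔
          lapl lam (qFourier lam ν f) + ((effMass lam m : ℂ) ^ 2) • qFourier lam ν f = 0))) ∧
    -- spin `1/2`: the noncommutative Dirac equation
    (∀ (ν : Measure S3NS) (φ : S3NS → E 1) (Φ : Fin 2 → Uhat), Integrable φ ν →
      Φ = qFourierVec lam ν (fun u => (φ u).ofLp) →
      ((∀ᵐ u ∂ν, Constraint lam m 1 u.1 (φ u)) →
        Complex.I • dirac lam Φ - (effMass lam m : ℂ) • Φ = 0 ∧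
        ∀ c, lapl lam (Φ c) + ((effMass lam m : ℂ) ^ 2) • Φ c = 0) ∧
      ((∀ᵐ u ∂ν, u.1 ∉ patch lam m → φ u = 0) →
        ((∀ᵐ u ∂ν, Constraint lam m 1 u.1 (φ u)) ↔
          Complex.I • dirac lam Φ - (effMass lam m : ℂ) • Φ = 0))) ∧
    -- spin `1`: the noncommutative curl equation
    (∀ (ν : Measure S3NS) (φ : S3NS → Fin 3 → ℂ) (Φ : Fin 3 → Uhat), Integrable φ ν →
      Φ = qFourierVec lam ν φ →
      ((∀ᵐ u ∂ν, CartConstraint lam m u.1 (φ u)) →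
        divg lam Φ = 0 ∧ ∀ c, lapl lam (Φ c) + ((effMass lam m : ℂ) ^ 2) • Φ c = 0) ∧
      (m * lam ≠ Real.pi → (∀ᵐ u ∂ν, u.1 ∉ patch lam m → φ u = 0) →
        ((∀ᵐ u ∂ν, CartConstraint lam m u.1 (φ u)) ↔
          curl lam Φ + (effMass lam m : ℂ) • Φ = 0))) := by
  refine ⟨fun u => ⟨coe_eq_coord hlam.ne' u, coord_sphere hlam.ne' u⟩,
    existsUnique_conjClass hlam,
    fun u => ⟨coe_eq_exp_lieCoord hlam u, sum_sq_lieCoord_lt hlam u,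
      mem_conjClass_iff_lieCoord hlam hm hm' u, mem_conjClass_iff hlam hm hm' u.1⟩,
    fun n => ⟨fun g f _ hψ => singV_mem lam m g f hψ, fun g f _ hφ => singW_mem_W g f hφ,
      fun g f _ hφ => singW_mem_Wsupp g f hφ, singV_one lam m, singW_one, singV_singV lam m,
      singW_singW, fun hgen => ⟨sectionEquiv hlam hm hm' hgen,
        fun ψ v u h => toField_apply hlam hm hm' ψ.2 h, fun g f ψ χ h => ?_⟩⟩,
    fun n => ⟨repV lam m n, repV_ae_eq lam m n, isIrrep_repV hlam hm hm' n, fun hgen =>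
      ⟨conjRep (sectionIsometry hlam hm hm' hgen) (repV lam m n),
        sectionIsometry hlam hm hm' hgen,
        conjRep_repV_ae_eq hlam hm hm' _ (sectionIsometry_ae_eq hlam hm hm' hgen),
        (isIrrep_repV hlam hm hm' n).conjRep _, fun ψ => ?_, fun F ψ => ?_⟩⟩,
    W_zero_eq_top lam m, W_one_eq_Wsupp hlam hm hm', fun φ hφ => W_two_support hlam hm hm' hφ,
    fun u z => ⟨scalar_constraint_imp hlam.ne' m u.1 z,
      fun hu => scalar_constraint_iff hlam.ne' hu z⟩,
    fun u z => ⟨constraint_one_imp_dirac hlam.ne', fun hu => constraint_one_iff_dirac hlam.ne' hu z⟩,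
    cartToWeight_mem_unitaryGroup, rho_two_cartToWeight,
    fun u z => ⟨fun h => ⟨dotProduct_eq_zero_of_cartConstraint hlam hm hm' h,
        shell_of_cartConstraint hlam hm hm' h⟩,
      fun hpi hu => cartConstraint_iff_curl hlam hm hm' hpi hu z⟩,
    ⟨pos_commutator lam tgen_lie.1, pos_commutator lam tgen_lie.2.1,
      pos_commutator lam tgen_lie.2.2⟩,
    fun a b => ⟨pd_one lam a, pd_pos hlam.ne' a b⟩,
    fun u a => ⟨P0op_planeWave hlam u, pd_planeWave hlam u a⟩,
    fun ν f hf => ⟨fun X i j => ⟨integrable_mul_planeWave hlam hf X i j, ?_⟩,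
      qFourier_P0_mul hlam hf, fun a => ?_, qFourier_injective hlam hf⟩,
    fun ν f hf => kleinGordon_spin_zero hlam m hf,
    fun ν φ Φ hφ hΦ => dirac_spin_half hlam m hφ hΦ,
    fun ν φ Φ hφ hΦ => curl_spin_one hlam hm hm' hφ hΦ⟩
  · change toField lam m n χ.1 = singW n g f (toField lam m n ψ.1)
    rw [h, toField_singV hlam hm hm' g f ψ.2]
  · filter_upwards [sectionIsometry_ae_eq hlam hm hm' hgen ψ] with v hv u hu
    rw [← hv]
    congr 1
    exact Subtype.ext hu
  · rw [conjRep_apply, LinearIsometryEquiv.symm_apply_apply]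
  · exact qFourier_apply hlam hf X i j
  · rw [qFourier_P_mul hlam hf, Pop_eq_neg_I_smul_pd]
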